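/- **Theorem (Local existence).** Identify functions on $\mathbb T^3=\mathbb R^3/\mathbb Z^3$ with $\mathbb Z^3$-periodic functions on $\mathbb R^3$. Let $0\le\gamma\le1$, $\beta\ge4$, let $b:[0,\pi]\to\mathbb R$ be measurable with $0\le b(\theta)\le C_b|\cos\theta|$, let $B(v-u,\omega)=|v-u|^\gamma b(\theta)$ with $\cos\theta=(v-u)\cdot\omega/|v-u|$, and let $\Phi\in C^3(\mathbb T^3)$ with $\Phi\ge0$ and $\|\Phi\|_{C^3(\mathbb T^3)}\le M$. Put $$\mu(v)=e^{-|v|^2/2},\qquad \mu_E(x,v)=\mu(v)e^{-\Phi(x)},\qquad w_\beta(x,v)=\Big(\tfrac{|v|^2}{2}+\Phi(x)+1\Big)^{\beta/2},$$ and consider the Boltzmann equation on $\mathbb T^3\times\mathbb R^3$ $$\partial_tF+v\cdot\nabla_xF-\nabla\Phi(x)\cdot\nabla_vF=Q(F,F),\qquad F(0)=F_0,\qquad Q=Q_+-Q_-,$$ $$Q_+(F_1,F_2)(v)=\int_{\mathbb R^3}\!\int_{\mathbb S^2}B(v-u,\omega)F_1(u')F_2(v')\,d\omega\,du,\qquad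 Q_-(F_1,F_2)(v)=\int_{\mathbb R^3}\!\int_{\mathbb S^2}B(v-u,\omega)F_1(u)F_2(v)\,d\omega\,du,$$ where $v'=v+[(u-v)\cdot\omega]\omega$ and $u'=u-[(u-v)\cdot\omega]\omega$. Write $F=\mu_E+\sqrt{\mu_E}\,f$, $F_0=\mu_E+\sqrt{\mu_E}\,f_0$, and $$\nu(v)=\int_{\mathbb R^3}\!\int_{\mathbb S^2}B(v-u,\omega)\mu(u)\,d\omega\,du,\qquad Kf=\nu f+\tfrac1{\sqrt\mu}\{Q(\mu,\sqrt\mu f)+Q(\sqrt\mu f,\mu)\},\qquad \Gamma(f,f)=\tfrac1{\sqrt\mu}Q(\sqrt\mu f,\sqrt\mu f).$$ Let $(X,V)(s)=(X,V)(s;t,x,v)$ be the characteristic $\dot X=V$, $\dot V=-\nabla\Phi(X)$, $(X,V)(t)=(x,v)$, and $g(\tau)=e^{-\Phi(X(\tau))}\nu(V(\tau))$. A *mild solution* on $[0,T]$ is a measurable $f$ such that for every $t\in[0,T]$ and almost every $(x,v)$ $$f(t,x,v)=e^{-\int_0^tg}f_0(X(0),V(0))+\int_0^te^{-\int_s^tg-\Phi(X(s))}Kf(s,X(s),V(s))\,ds+\int_0^te^{-\int_s^tg-\frac{\Phi(X(s))}2}\Gamma(f,f)(s,X(s),V(s))\,ds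 .$$ There is a constant $C\ge1$, depending only on $\beta,\gamma,M$ and $C_b$, such that for all $f_0$ with $\|w_\beta f_0\|_{L^\infty}<\infty$ (of arbitrary size) and $F_0\ge0$ almost everywhere the following holds with $$T_0=\big(8C\,[1+\|w_\beta f_0\|_{L^\infty}]\big)^{-1}.$$ There is a mild solution $f$ on $[0,T_0]$ such that $F(t)=\mu_E+\sqrt{\mu_E}f(t)\ge0$ almost everywhere and $$\|w_\beta f(t)\|_{L^\infty}\le2\|w_\beta f_0\|_{L^\infty}\qquad\text{for }0\le t\le T_0.$$ It is unique: every mild solution $\tilde f$ on $[0,T_0]$ with the same initial datum and $\sup_{0\le t\le T_0}\|w_\beta\tilde f(t)\|_{L^\infty}<\infty$ satisfies $\tilde f(t)=f(t)$ almost everywhere for all $t\in[0,T_0]$. Moreover, for all $t\in[0,T_0]$, with all integrals absolutely convergent, $$\iint\varphi\,\{F(t)-\mu_E\}\,dv\,dx=\iint\varphi\,\{F_0-\mu_E\}\,dv\,dx$$ for $\varphi=1$ (mass), $\varphi=\frac{|v|^2}2+\Phi(x)$ (energy), and $\varphi=e\cdot v$ with any $e\in\Lambda:=\bigcap_{x}\nabla\Phi(x)^\perp$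 (degenerate momentum); and, with $\mathscr H(F)=\iint F\ln F\,dv\,dx$ (finite for $F(t)$, $F_0$ and $\mu_E$), $$\mathscr H(F(t))-\mathscr H(\mu_E)\le\mathscr H(F_0)-\mathscr H(\mu_E).$$ -/

import Mathlib

open MeasureTheory Set Filter
open scoped ENNReal

namespace BoltzmannPotential

noncomputable section

/-- Three dimensional Euclidean space, used for velocities and for lifts of positions in the torus. -/
abbrev E3 : Type := EuclideanSpace ℝ (Fin 3)

/-- The unit sphere `S²`. -/
abbrev S2 : Type := Metric.sphere (0 : E3) 1

/-- The surface measure on the unit sphere (of total mass `4π`). -/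
def sphereMeasure : Measure S2 := (volume : Measure E3).toSphere

/-- `ℤ³`-periodic functions on `ℝ³`, that is, functions on the torus `𝕋³ = ℝ³/ℤ³`. -/
def IsPeriodic {α : Type*} (g : E3 → α) : Prop :=
  ∀ (i : Fin 3) (x : E3), g (x + EuclideanSpace.single i 1) = g x

/-- The unit cube `[0,1)³`, a fundamental domain of the torus. -/
def unitCube : Set E3 := {x | ∀ i, x i ∈ Ico (0 : ℝ) 1}

/-- The measure `dx dv` on `𝕋³ × ℝ³`. -/
def phaseMeasure : Measure (E3 × E3) :=
  ((volume : Measure E3).restrict unitCube).prod volume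

/-- The norm of `C³(𝕋³)`: the sum over `k ≤ 3` of the sup norms of the `k`-th derivatives. -/
def c3Norm (Φ : E3 → ℝ) : ℝ :=
  ∑ k ∈ Finset.range 4, ⨆ x : E3, ‖iteratedFDeriv ℝ k Φ x‖

/-! ### Collisions -/

/-- Post-collisional velocity `v' = v + [(u - v)·ω] ω`. -/
def vPost (v u : E3) (ω : S2) : E3 := v + (inner ℝ (u - v) (ω : E3)) • (ω : E3)

/-- Post-collisional velocity `u' = u - [(u - v)·ω] ω`. -/
def uPost (v u : E3) (ω : S2) : E3 := u - (inner ℝ (u - v) (ω : E3)) • (ω : E3)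

/-- The collision kernel `B(z, ω) = |z|^γ b(θ)`, where `θ ∈ [0, π]` is the angle between `z` and
`ω`, so that `cos θ = z·ω/|z|`. -/
def collisionKernel (γ : ℝ) (b : ℝ → ℝ) (z : E3) (ω : S2) : ℝ :=
  ‖z‖ ^ γ * b (InnerProductGeometry.angle z (ω : E3))

/-- The gain term `Q₊(F₁, F₂)`. -/
def Qplus (γ : ℝ) (b : ℝ → ℝ) (F₁ F₂ : E3 → ℝ) (v : E3) : ℝ :=
  ∫ u : E3, ∫ ω : S2,
    collisionKernel γ b (v - u) ω * F₁ (uPost v u ω) * F₂ (vPost v u ω) ∂sphereMeasure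

/-- The loss term `Q₋(F₁, F₂)`. -/
def Qminus (γ : ℝ) (b : ℝ → ℝ) (F₁ F₂ : E3 → ℝ) (v : E3) : ℝ :=
  ∫ u : E3, ∫ ω : S2, collisionKernel γ b (v - u) ω * F₁ u * F₂ v ∂sphereMeasure

/-- The Maxwellian `μ(v) = exp(-|v|²/2)`. -/
def maxwellian (v : E3) : ℝ := Real.exp (-(‖v‖ ^ 2 / 2))

/-- The collision frequency `ν`. -/
def collisionFrequency (γ : ℝ) (b : ℝ → ℝ) (v : E3) : ℝ :=
  ∫ u : E3, ∫ ω : S2, collisionKernel γ b (v - u) ω * maxwellian u ∂sphereMeasure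

def K1 (γ : ℝ) (b : ℝ → ℝ) (f : E3 → ℝ) (v : E3) : ℝ :=
  ∫ u : E3, ∫ ω : S2,
    collisionKernel γ b (v - u) ω * √(maxwellian v * maxwellian u) * f u ∂sphereMeasure

def K2 (γ : ℝ) (b : ℝ → ℝ) (f : E3 → ℝ) (v : E3) : ℝ :=
  (∫ u : E3, ∫ ω : S2, collisionKernel γ b (v - u) ω *
      √(maxwellian u * maxwellian (uPost v u ω)) * f (vPost v u ω) ∂sphereMeasure) +
  ∫ u : E3, ∫ ω : S2, collisionKernel γ b (v - u) ω *
      √(maxwellian u * maxwellian (vPost v u ω)) * f (uPost v u ω) ∂sphereMeasure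

/-- `K = K₂ - K₁`; the linearized collision operator is `L f = ν f - K f`. -/
def opK (γ : ℝ) (b : ℝ → ℝ) (f : E3 → ℝ) (v : E3) : ℝ := K2 γ b f v - K1 γ b f v

/-- `Γ(f, f) = μ^{-1/2} [Q₊(√μ f, √μ f) - Q₋(√μ f, √μ f)]`. -/
def opGamma (γ : ℝ) (b : ℝ → ℝ) (f : E3 → ℝ) (v : E3) : ℝ :=
  (√(maxwellian v))⁻¹ *
    (Qplus γ b (fun u => √(maxwellian u) * f u) (fun u => √(maxwellian u) * f u) v -
      Qminus γ b (fun u => √(maxwellian u) * f u) (fun u => √(maxwellian u) * f u) v)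

/-! ### The external potential -/

/-- The local Maxwellian `μ_E(x, v) = exp(-|v|²/2 - Φ(x))`. -/
def localMaxwellian (Φ : E3 → ℝ) (x v : E3) : ℝ := Real.exp (-(‖v‖ ^ 2 / 2) - Φ x)

/-- The density `F = μ_E + √μ_E f` belonging to a perturbation `f`. -/
def density (Φ : E3 → ℝ) (f : E3 → E3 → ℝ) (x v : E3) : ℝ :=
  localMaxwellian Φ x v + √(localMaxwellian Φ x v) * f x v

/-- The weight `w_β(x, v) = (|v|²/2 + Φ(x) + 1)^{β/2}`. -/
def weight (β : ℝ) (Φ : E3 → ℝ) (x v : E3) : ℝ := (‖v‖ ^ 2 / 2 + Φ x + 1) ^ (β / 2)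

/-- The weighted norm `‖w_β f‖_{L^∞(𝕋³ × ℝ³)}` (an essential supremum, possibly infinite). -/
def weightedNorm (β : ℝ) (Φ : E3 → ℝ) (f : E3 → E3 → ℝ) : ℝ≥0∞ :=
  eLpNorm (fun z : E3 × E3 => weight β Φ z.1 z.2 * f z.1 z.2) ∞ phaseMeasure

/-- `Z = (X, V)` solves `X' = V`, `V' = -∇Φ(X)` on `ℝ` with `X(t) = x`, `V(t) = v`. -/
def IsCharacteristic (Φ : E3 → ℝ) (t : ℝ) (x v : E3) (Z : ℝ → E3 × E3) : Prop :=
  (∀ s, HasDerivAt (fun r => (Z r).1) (Z s).2 s) ∧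
  (∀ s, HasDerivAt (fun r => (Z r).2) (-gradient Φ (Z s).1) s) ∧
  Z t = (x, v)

/-- The characteristic through `(x, v)` at time `t`; for a periodic `C³` potential there is exactly
one curve satisfying `IsCharacteristic`. -/
def characteristic (Φ : E3 → ℝ) (t : ℝ) (x v : E3) : ℝ → E3 × E3 :=
  Classical.epsilon (IsCharacteristic Φ t x v)

/-- `X(s) = X(s; t, x, v)`. -/
def charX (Φ : E3 → ℝ) (t : ℝ) (x v : E3) (s : ℝ) : E3 := (characteristic Φ t x v s).1

/-- `V(s) = V(s; t, x, v)`. -/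
def charV (Φ : E3 → ℝ) (t : ℝ) (x v : E3) (s : ℝ) : E3 := (characteristic Φ t x v s).2

/-- `g(τ) = e^{-Φ(X(τ))} ν(V(τ))`. -/
def damping (γ : ℝ) (b : ℝ → ℝ) (Φ : E3 → ℝ) (t : ℝ) (x v : E3) (τ : ℝ) : ℝ :=
  Real.exp (-Φ (charX Φ t x v τ)) * collisionFrequency γ b (charV Φ t x v τ)

/-- `f` is a mild solution on `[0, T]` with initial datum `f₀` of
`∂ₜf + v·∇ₓf - ∇Φ·∇ᵥf + e^{-Φ} L f = e^{-Φ/2} Γ(f, f)`,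
i.e. `F = μ_E + √μ_E f` is a mild solution of `∂ₜF + v·∇ₓF - ∇Φ·∇ᵥF = Q(F, F)`.
The integrated equation holds for every `t ∈ [0, T]` and almost every `(x, v)`. -/
structure IsMildSolution (γ : ℝ) (b : ℝ → ℝ) (Φ : E3 → ℝ) (T : ℝ) (f₀ : E3 → E3 → ℝ)
    (f : ℝ → E3 → E3 → ℝ) : Prop where
  measurable : Measurable fun p : ℝ × E3 × E3 => f p.1 p.2.1 p.2.2
  periodic : ∀ t, IsPeriodic (f t)
  mild : ∀ t ∈ Icc 0 T, ∀ᵐ z ∂phaseMeasure,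
    f t z.1 z.2 =
      Real.exp (-∫ τ in (0 : ℝ)..t, damping γ b Φ t z.1 z.2 τ) *
          f₀ (charX Φ t z.1 z.2 0) (charV Φ t z.1 z.2 0) +
      (∫ s in (0 : ℝ)..t,
        Real.exp (-(∫ τ in s..t, damping γ b Φ t z.1 z.2 τ) - Φ (charX Φ t z.1 z.2 s)) *
          opK γ b (f s (charX Φ t z.1 z.2 s)) (charV Φ t z.1 z.2 s)) +
      ∫ s in (0 : ℝ)..t,
        Real.exp (-(∫ τ in s..t, damping γ b Φ t z.1 z.2 τ) - Φ (charX Φ t z.1 z.2 s) / 2) *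
          opGamma γ b (f s (charX Φ t z.1 z.2 s)) (charV Φ t z.1 z.2 s)

/-- The degenerate subspace `Λ = ⋂ₓ ∇Φ(x)^⊥`. -/
def degenerateSubspace (Φ : E3 → ℝ) : Submodule ℝ E3 := ⨅ x : E3, (ℝ ∙ gradient Φ x)ᗮ

/-- The integral of `φ (F - μ_E)` over `𝕋³ × ℝ³` converges absolutely for both `F = F₁` and
`F = F₂`, and has the same value. -/
def SameMoment (Φ : E3 → ℝ) (φ F₁ F₂ : E3 → E3 → ℝ) : Prop :=
  Integrable (fun z : E3 × E3 => φ z.1 z.2 * (F₁ z.1 z.2 - localMaxwellian Φ z.1 z.2))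
      phaseMeasure ∧
  Integrable (fun z : E3 × E3 => φ z.1 z.2 * (F₂ z.1 z.2 - localMaxwellian Φ z.1 z.2))
      phaseMeasure ∧
  ∫ z : E3 × E3, φ z.1 z.2 * (F₁ z.1 z.2 - localMaxwellian Φ z.1 z.2) ∂phaseMeasure =
    ∫ z : E3 × E3, φ z.1 z.2 * (F₂ z.1 z.2 - localMaxwellian Φ z.1 z.2) ∂phaseMeasure

/-- `F ln F` is integrable over `𝕋³ × ℝ³` (with `0 ln 0 = 0`). -/
def HasEntropy (F : E3 → E3 → ℝ) : Prop :=
  Integrable (fun z : E3 × E3 => F z.1 z.2 * Real.log (F z.1 z.2)) phaseMeasure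

/-- `ℋ(F) = ∫∫ F ln F dv dx`. -/
def entropy (F : E3 → E3 → ℝ) : ℝ :=
  ∫ z : E3 × E3, F z.1 z.2 * Real.log (F z.1 z.2) ∂phaseMeasure

end

end BoltzmannPotential

open BoltzmannPotential

namespace BoltzmannPotential

noncomputable section

/-! Write h = F/√μ_E = √μ_E + f. Along a characteristic the equation is the ordinary differential
equation h' = e^{-Φ/2} (gain(h,h) - h·loss(h)). Since |v|²/2 + Φ is conserved, the weight and μ_E
are constant along characteristics, and every estimate reduces to one in the velocity variable at a
fixed value c ≥ 0 of the potential, with constants independent of c.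

Detailed balance, gain(√μ_E,√μ_E) = √μ_E·loss(√μ_E), turns the equation into f' = S(f) - R(f) f with
R(f) = e^{-Φ/2} loss(√μ_E + f) (`collOp_eq_src_sub_rate`). The source S costs no velocity weight. By
conservation of energy one of u', v' carries at least half of the energy of v (`decay_post_le`), and
the decay in the other one compensates the growth of the kernel, up to a factor 1/sin θ that is
integrable over the sphere (`exists_sphere_sin_bound`, `exists_gain_majorant`). The rate R grows
with |v|, but it is nonnegative as long as F ≥ 0 and then only damps.

Existence comes from the linear scheme g' + R(f) g = S(f). Since S(f) + R(f)√μ_E is the gain term,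
positivity of F propagates, and for short times the ball of radius 2N is preserved. The scheme
contracts in the weight with exponent β - 1: comparing two rates costs one power of |v|, which the
bound in the weight w_β pays for (`abs_src_rate_sub_le`). Uniqueness is the same comparison, with
damping taken from the nonnegative solution, so the competitor needs no sign (`mild_unique`). The
damped formula defining mild solutions and the S - R form are both equivalent to the integrated
equation, by integrating factors for absolutely continuous functions.

For the conservation laws and the entropy, Liouville's theorem (`measurePreserving_flow`) and Fubini
reduce the time evolution of ∬φF to the velocity integrals ∫φ Q(F,F) dv, and the symmetries of the
collision (`weak_form`) give these integrals value zero or a sign. The logarithm is singular where F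
vanishes, so the entropy is computed for F + δμ_E; the error is O(δ(1 + |log δ|)) and disappears as
δ → 0. -/

/-! ### Linear equations with measurable coefficients -/

/-- A Lipschitz function of an absolutely continuous function is absolutely continuous. -/
lemma absolutelyContinuous_comp_lipschitz {f φ : ℝ → ℝ} {a b : ℝ} {s : Set ℝ} {K : NNReal}
    (hφ : LipschitzOnWith K φ s) (hf : AbsolutelyContinuousOnInterval f a b)
    (hs : ∀ x ∈ uIcc a b, f x ∈ s) :
    AbsolutelyContinuousOnInterval (fun x => φ (f x)) a b := by
  rw [absolutelyContinuousOnInterval_iff] at hf ⊢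
  intro ε hε
  -- The divisor is K + 1 because the Lipschitz constant K may vanish.
  obtain ⟨δ, hδ, h⟩ := hf (ε / (K + 1)) (by positivity)
  refine ⟨δ, hδ, fun E hE hsum => ?_⟩
  have h1 := h E hE hsum
  have h2 : ∀ i ∈ Finset.range E.1, dist (φ (f (E.2 i).1)) (φ (f (E.2 i).2)) ≤
      (K + 1) * dist (f (E.2 i).1) (f (E.2 i).2) := by
    intro i hi
    have hE' := hE.1 i hi
    refine (hφ.dist_le_mul _ (hs _ hE'.1) _ (hs _ hE'.2)).trans ?_
    gcongr
    simp
  calc _ ≤ ∑ i ∈ Finset.range E.1, (K + 1 : ℝ) * dist (f (E.2 i).1) (f (E.2 i).2) :=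
        Finset.sum_le_sum h2
    _ = (K + 1) * ∑ i ∈ Finset.range E.1, dist (f (E.2 i).1) (f (E.2 i).2) := by
        rw [Finset.mul_sum]
    _ < (K + 1) * (ε / (K + 1)) := by gcongr
    _ = ε := by field_simp

lemma absolutelyContinuous_comp_of_contDiffOn {f φ : ℝ → ℝ} {a b c d : ℝ}
    (hφ : ContDiffOn ℝ 1 φ (Icc c d)) (hf : AbsolutelyContinuousOnInterval f a b)
    (hs : ∀ x ∈ uIcc a b, f x ∈ Icc c d) :
    AbsolutelyContinuousOnInterval (fun x => φ (f x)) a b := by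
  obtain ⟨K, hK⟩ := hφ.exists_lipschitzOnWith (by decide) (convex_Icc _ _) isCompact_Icc
  exact absolutelyContinuous_comp_lipschitz hK hf hs

lemma absolutelyContinuous_exp {f : ℝ → ℝ} {a b : ℝ}
    (hf : AbsolutelyContinuousOnInterval f a b) :
    AbsolutelyContinuousOnInterval (fun x => Real.exp (f x)) a b := by
  obtain ⟨C, hC⟩ := hf.exists_bound
  exact absolutelyContinuous_comp_of_contDiffOn (c := -C) (d := C)
    Real.contDiff_exp.contDiffOn hf fun x hx => abs_le.1 (hC x hx)

/-- Chain rule along a primitive. -/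
lemma comp_primitive_sub {q φ φ' : ℝ → ℝ} {y₀ t c d : ℝ}
    (hq : IntervalIntegrable q volume 0 t) (hφ : ContDiffOn ℝ 1 φ (Icc c d))
    (hd : ∀ y ∈ Icc c d, HasDerivAt φ (φ' y) y)
    (hy : ∀ s ∈ uIcc 0 t, y₀ + ∫ r in (0 : ℝ)..s, q r ∈ Icc c d) :
    φ (y₀ + ∫ r in (0 : ℝ)..t, q r) - φ y₀ =
      ∫ s in (0 : ℝ)..t, φ' (y₀ + ∫ r in (0 : ℝ)..s, q r) * q s := by
  have h0 : (0 : ℝ) ∈ uIcc 0 t := left_mem_uIcc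
  have hAC : AbsolutelyContinuousOnInterval (fun s => y₀ + ∫ r in (0 : ℝ)..s, q r) 0 t := by
    have h1 := hq.absolutelyContinuousOnInterval_intervalIntegral h0
    have h2 : AbsolutelyContinuousOnInterval (fun _ : ℝ => y₀) 0 t :=
      (contDiff_const.contDiffOn (n := 1)).absolutelyContinuousOnInterval
    exact h2.fun_add h1
  have hAC' := absolutelyContinuous_comp_of_contDiffOn hφ hAC hy
  have key := hAC'.integral_deriv_eq_sub
  simp only [intervalIntegral.integral_same, add_zero] at key
  rw [← key]
  apply intervalIntegral.integral_congr_ae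
  filter_upwards [hq.ae_hasDerivAt_integral] with s hs hs'
  have hs'' := uIoc_subset_uIcc hs'
  have h1 := (hs hs'' 0 h0).const_add y₀
  exact ((hd _ (hy s hs'')).comp s h1).deriv

section Duhamel

variable {a S y : ℝ → ℝ} {y₀ T : ℝ}

lemma uIcc_zero_subset {T t : ℝ} (ht : t ∈ Icc 0 T) : uIcc 0 t ⊆ uIcc 0 T := by
  rw [uIcc_of_le ht.1, uIcc_of_le (ht.1.trans ht.2)]
  exact Icc_subset_Icc_right ht.2

lemma intervalIntegrable_of_mem (ha : IntervalIntegrable a volume 0 T) {t : ℝ}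
    (ht : t ∈ Icc 0 T) : IntervalIntegrable a volume 0 t :=
  ha.mono_set (uIcc_zero_subset ht)

/-- From the integrated equation to the integrating factor formula. -/
lemma duhamel_of_integral (ha : IntervalIntegrable a volume 0 T)
    (hq : IntervalIntegrable (fun s => S s - a s * y s) volume 0 T)
    (hy : ∀ t ∈ Icc 0 T, y t = y₀ + ∫ s in (0 : ℝ)..t, (S s - a s * y s)) :
    ∀ t ∈ Icc 0 T, y t = Real.exp (-∫ τ in (0 : ℝ)..t, a τ) *
      (y₀ + ∫ s in (0 : ℝ)..t, Real.exp (∫ τ in (0 : ℝ)..s, a τ) * S s) := by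
  intro t ht
  have ha' := intervalIntegrable_of_mem ha ht
  have hq' := intervalIntegrable_of_mem hq ht
  have h0 : (0 : ℝ) ∈ uIcc 0 t := left_mem_uIcc
  have hA := ha'.absolutelyContinuousOnInterval_intervalIntegral h0
  have hP := absolutelyContinuous_exp hA
  have hY : AbsolutelyContinuousOnInterval
      (fun s => y₀ + ∫ r in (0 : ℝ)..s, (S r - a r * y r)) 0 t := by
    have h2 : AbsolutelyContinuousOnInterval (fun _ : ℝ => y₀) 0 t :=
      (contDiff_const.contDiffOn (n := 1)).absolutelyContinuousOnInterval
    exact h2.fun_add (hq'.absolutelyContinuousOnInterval_intervalIntegral h0)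
  -- The coefficients are merely integrable, so the product rule is used in its integrated form for
  -- absolutely continuous functions.
  have key := hP.integral_deriv_mul_eq_sub hY
  have h3 : ∫ s in (0 : ℝ)..t, Real.exp (∫ τ in (0 : ℝ)..s, a τ) * S s =
      ∫ x in (0 : ℝ)..t, deriv (fun x => Real.exp (∫ v in (0 : ℝ)..x, a v)) x *
          (y₀ + ∫ r in (0 : ℝ)..x, (S r - a r * y r)) +
        Real.exp (∫ v in (0 : ℝ)..x, a v) *
          deriv (fun s => y₀ + ∫ r in (0 : ℝ)..s, (S r - a r * y r)) x := by
    apply intervalIntegral.integral_congr_ae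
    filter_upwards [ha'.ae_hasDerivAt_integral, hq'.ae_hasDerivAt_integral] with s h1 h2 hs
    have hs' := uIoc_subset_uIcc hs
    have hsT : s ∈ Icc 0 T := by
      have := uIcc_zero_subset ht hs'
      rwa [uIcc_of_le (ht.1.trans ht.2)] at this
    rw [((h1 hs' 0 h0).exp).deriv, ((h2 hs' 0 h0).const_add y₀).deriv, ← hy s hsT]
    ring
  rw [h3, key]
  simp only [intervalIntegral.integral_same, add_zero, Real.exp_zero, one_mul]
  rw [← hy t ht, add_sub_cancel, ← mul_assoc, ← Real.exp_add]
  simp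

lemma intervalIntegrable_exp_mul (ha : IntervalIntegrable a volume 0 T)
    (hS : IntervalIntegrable S volume 0 T) :
    IntervalIntegrable (fun s => Real.exp (∫ τ in (0 : ℝ)..s, a τ) * S s) volume 0 T :=
  hS.continuousOn_mul
    (absolutelyContinuous_exp
      (ha.absolutelyContinuousOnInterval_intervalIntegral left_mem_uIcc)).continuousOn

/-- From the integrating factor formula to the integrated equation. -/
lemma integral_of_duhamel (ha : IntervalIntegrable a volume 0 T)
    (hS : IntervalIntegrable S volume 0 T)
    (hy : ∀ t ∈ Icc 0 T, y t = Real.exp (-∫ τ in (0 : ℝ)..t, a τ) *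
      (y₀ + ∫ s in (0 : ℝ)..t, Real.exp (∫ τ in (0 : ℝ)..s, a τ) * S s)) :
    ∀ t ∈ Icc 0 T, y t = y₀ + ∫ s in (0 : ℝ)..t, (S s - a s * y s) := by
  intro t ht
  have ha' := intervalIntegrable_of_mem ha ht
  have hS' := intervalIntegrable_of_mem hS ht
  have hq' := intervalIntegrable_exp_mul ha' hS'
  have h0 : (0 : ℝ) ∈ uIcc 0 t := left_mem_uIcc
  have hA := ha'.absolutelyContinuousOnInterval_intervalIntegral h0
  have hP := absolutelyContinuous_exp hA.fun_neg
  have hY : AbsolutelyContinuousOnInterval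
      (fun s => y₀ + ∫ r in (0 : ℝ)..s, Real.exp (∫ τ in (0 : ℝ)..r, a τ) * S r) 0 t := by
    have h2 : AbsolutelyContinuousOnInterval (fun _ : ℝ => y₀) 0 t :=
      (contDiff_const.contDiffOn (n := 1)).absolutelyContinuousOnInterval
    exact h2.fun_add (hq'.absolutelyContinuousOnInterval_intervalIntegral h0)
  have key := hP.integral_deriv_mul_eq_sub hY
  simp only [intervalIntegral.integral_same, add_zero, neg_zero, Real.exp_zero, one_mul] at key
  rw [← hy t ht] at key
  rw [← sub_eq_iff_eq_add', ← key]
  apply intervalIntegral.integral_congr_ae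
  filter_upwards [ha'.ae_hasDerivAt_integral, hq'.ae_hasDerivAt_integral] with s h1 h2 hs
  have hs' := uIoc_subset_uIcc hs
  have hsT : s ∈ Icc 0 T := by
    have := uIcc_zero_subset ht hs'
    rwa [uIcc_of_le (ht.1.trans ht.2)] at this
  rw [((h1 hs' 0 h0).fun_neg.exp).deriv, ((h2 hs' 0 h0).const_add y₀).deriv, hy s hsT,
    ← mul_assoc (Real.exp (-_)) (Real.exp _), ← Real.exp_add]
  simp only [neg_add_cancel, Real.exp_zero]
  ring

/-- The integrating factor formula in its two-time form. -/
lemma duhamel_two_time (ha : IntervalIntegrable a volume 0 T) {t : ℝ} (ht : t ∈ Icc 0 T) :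
    Real.exp (-∫ τ in (0 : ℝ)..t, a τ) *
      (y₀ + ∫ s in (0 : ℝ)..t, Real.exp (∫ τ in (0 : ℝ)..s, a τ) * S s) =
    Real.exp (-∫ τ in (0 : ℝ)..t, a τ) * y₀ +
      ∫ s in (0 : ℝ)..t, Real.exp (-∫ τ in s..t, a τ) * S s := by
  rw [mul_add, ← intervalIntegral.integral_const_mul]
  congr 1
  apply intervalIntegral.integral_congr
  intro s hs
  simp only
  rw [← mul_assoc, ← Real.exp_add]
  congr 2
  rw [← intervalIntegral.integral_add_adjacent_intervals (b := s) (a := 0) (c := t)]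
  · ring
  · rw [uIcc_of_le ht.1] at hs
    exact intervalIntegrable_of_mem ha ⟨hs.1, hs.2.trans ht.2⟩
  · rw [uIcc_of_le ht.1] at hs
    refine ha.mono_set ?_
    rw [uIcc_of_le hs.2, uIcc_of_le (ht.1.trans ht.2)]
    exact Icc_subset_Icc hs.1 ht.2

/-- With nonnegative damping the solution is controlled by its source. -/
lemma abs_duhamel_le (ha : IntervalIntegrable a volume 0 T) (ha0 : ∀ s ∈ Icc 0 T, 0 ≤ a s)
    {t : ℝ} {c : ℝ → ℝ} (ht : t ∈ Icc 0 T) (hci : IntervalIntegrable c volume 0 t)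
    (hS : ∀ᵐ s, s ∈ Icc 0 T → |S s| ≤ c s) :
    |Real.exp (-∫ τ in (0 : ℝ)..t, a τ) *
      (y₀ + ∫ s in (0 : ℝ)..t, Real.exp (∫ τ in (0 : ℝ)..s, a τ) * S s)| ≤
      |y₀| + ∫ s in (0 : ℝ)..t, c s := by
  rw [duhamel_two_time ha ht]
  have hexp : ∀ s ∈ Icc 0 t, Real.exp (-∫ τ in s..t, a τ) ≤ 1 := by
    intro s hs
    rw [Real.exp_le_one_iff, neg_nonpos]
    exact intervalIntegral.integral_nonneg hs.2 fun u hu => ha0 u ⟨hs.1.trans hu.1, hu.2.trans ht.2⟩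
  refine (abs_add_le _ _).trans (add_le_add ?_ ?_)
  · rw [abs_mul, abs_of_pos (Real.exp_pos _)]
    exact mul_le_of_le_one_left (abs_nonneg _) (hexp 0 ⟨le_rfl, ht.1⟩)
  · refine intervalIntegral.norm_integral_le_of_norm_le
      (f := fun s => Real.exp (-∫ τ in s..t, a τ) * S s) ht.1 ?_ hci
    filter_upwards [hS] with s h1 hs
    rw [Real.norm_eq_abs, abs_mul, abs_of_pos (Real.exp_pos _)]
    exact (mul_le_of_le_one_left (abs_nonneg _) (hexp s ⟨hs.1.le, hs.2⟩)).trans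
      (h1 ⟨hs.1.le, hs.2.trans ht.2⟩)

/-- Comparison of two linear equations with nonnegative damping. -/
lemma abs_sub_le_of_integral {a₁ a₂ S₁ S₂ y₁ y₂ : ℝ → ℝ}
    (ha₁ : IntervalIntegrable a₁ volume 0 T) (ha0 : ∀ s ∈ Icc 0 T, 0 ≤ a₁ s)
    (hq₁ : IntervalIntegrable (fun s => S₁ s - a₁ s * y₁ s) volume 0 T)
    (hq₂ : IntervalIntegrable (fun s => S₂ s - a₂ s * y₂ s) volume 0 T)
    (h₁ : ∀ t ∈ Icc 0 T, y₁ t = y₀ + ∫ s in (0 : ℝ)..t, (S₁ s - a₁ s * y₁ s))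
    (h₂ : ∀ t ∈ Icc 0 T, y₂ t = y₀ + ∫ s in (0 : ℝ)..t, (S₂ s - a₂ s * y₂ s))
    {c : ℝ → ℝ} {t : ℝ} (ht : t ∈ Icc 0 T) (hci : IntervalIntegrable c volume 0 t)
    (hc : ∀ᵐ s, s ∈ Icc 0 T → |S₁ s - S₂ s - (a₁ s - a₂ s) * y₂ s| ≤ c s) :
    |y₁ t - y₂ t| ≤ ∫ s in (0 : ℝ)..t, c s := by
  have hfun : (fun s => (S₁ s - S₂ s - (a₁ s - a₂ s) * y₂ s) - a₁ s * (y₁ s - y₂ s)) =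
      fun s => (S₁ s - a₁ s * y₁ s) - (S₂ s - a₂ s * y₂ s) := by
    funext s; ring
  -- The difference solves an equation with damping a₁ and zero datum; a₂ enters only through the
  -- source, so only a₁ needs a sign.
  have h := duhamel_of_integral (a := a₁) (S := fun s => S₁ s - S₂ s - (a₁ s - a₂ s) * y₂ s)
    (y := fun s => y₁ s - y₂ s) (y₀ := 0) ha₁ (by rw [hfun]; exact hq₁.sub hq₂) (by
      intro t ht
      rw [hfun, intervalIntegral.integral_sub (intervalIntegrable_of_mem hq₁ ht)
        (intervalIntegrable_of_mem hq₂ ht), h₁ t ht, h₂ t ht]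
      ring) t ht
  rw [h]
  simpa using abs_duhamel_le (y₀ := 0) ha₁ ha0 ht hci hc

end Duhamel

/-! ### Periodic functions -/

/-- The lattice vector with integer coordinates `k`. -/
def latticeVec (k : Fin 3 → ℤ) : E3 := WithLp.toLp 2 fun i => (k i : ℝ)

/-- The representative in the unit cube. -/
def cubeRep (x : E3) : E3 := WithLp.toLp 2 fun i => Int.fract (x i)

lemma latticeVec_eq_sum (k : Fin 3 → ℤ) :
    latticeVec k = ∑ i, k i • (EuclideanSpace.single i (1 : ℝ) : E3) := by
  ext j
  simp [latticeVec, Finset.sum_apply, Pi.single_apply]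

lemma cubeRep_add_latticeVec (x : E3) : cubeRep x + latticeVec (fun i => ⌊x i⌋) = x := by
  ext i
  simp [cubeRep, latticeVec]

lemma IsPeriodic.add_latticeVec {α : Type*} {g : E3 → α} (hg : IsPeriodic g) (k : Fin 3 → ℤ)
    (x : E3) : g (x + latticeVec k) = g x := by
  -- The periods of `g` form a subgroup, so the three unit vectors suffice.
  let H : AddSubgroup E3 :=
    { carrier := {y | ∀ x, g (x + y) = g x}
      zero_mem' := by intro x; simp
      add_mem' := by
        intro a b ha hb x
        rw [← add_assoc, hb, ha]
      neg_mem' := by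
        intro a ha x
        rw [← ha (x + -a)]
        simp }
  have h : latticeVec k ∈ H := by
    rw [latticeVec_eq_sum]
    exact H.sum_mem fun i _ => H.zsmul_mem (fun x => hg i x) _
  exact h x

lemma IsPeriodic.cubeRep {α : Type*} {g : E3 → α} (hg : IsPeriodic g) (x : E3) :
    g (cubeRep x) = g x := by
  rw [← hg.add_latticeVec (fun i => ⌊x i⌋) (BoltzmannPotential.cubeRep x), cubeRep_add_latticeVec]

lemma cubeRep_mem (x : E3) : cubeRep x ∈ unitCube :=
  fun _ => ⟨Int.fract_nonneg _, Int.fract_lt_one _⟩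

lemma norm_le_of_mem_unitCube {x : E3} (hx : x ∈ unitCube) : ‖x‖ ≤ 2 := by
  rw [EuclideanSpace.norm_eq, Real.sqrt_le_left (by norm_num)]
  simp only [Fin.sum_univ_three, Real.norm_eq_abs, sq_abs]
  have h := fun i => hx i
  nlinarith [(h 0).1, (h 0).2, (h 1).1, (h 1).2, (h 2).1, (h 2).2]

lemma IsPeriodic.exists_bound {F : Type*} [NormedAddCommGroup F] {g : E3 → F} (hg : IsPeriodic g)
    (hc : Continuous g) : ∃ C, ∀ x, ‖g x‖ ≤ C := by
  obtain ⟨C, hC⟩ := (isCompact_closedBall (0 : E3) 2).exists_bound_of_continuousOn hc.continuousOn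
  refine ⟨C, fun x => ?_⟩
  rw [← hg.cubeRep]
  exact hC _ (by simpa using norm_le_of_mem_unitCube (cubeRep_mem x))

lemma IsPeriodic.fderiv {F : Type*} [NormedAddCommGroup F] [NormedSpace ℝ F] {g : E3 → F}
    (hg : IsPeriodic g) : IsPeriodic (fderiv ℝ g) := by
  intro i x
  rw [← fderiv_comp_add_right]
  congr 1
  funext y
  exact hg i y

lemma gradient_periodic {Φ : E3 → ℝ} (hP : IsPeriodic Φ) : IsPeriodic (gradient Φ) := by
  intro i x
  simp only [gradient, hP.fderiv i x]

lemma gradient_contDiff {Φ : E3 → ℝ} (hΦ : ContDiff ℝ 3 Φ) : ContDiff ℝ 1 (gradient Φ) := by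
  have h : ContDiff ℝ 1 (_root_.fderiv ℝ Φ) := hΦ.fderiv_right (by norm_num)
  exact (InnerProductSpace.toDual ℝ E3).symm.toContinuousLinearEquiv.contDiff.comp h

/-- The derivative of ∇Φ is continuous and periodic, hence bounded. This global constant makes the
characteristics exist for all times. -/
lemma gradient_lipschitz {Φ : E3 → ℝ} (hΦ : ContDiff ℝ 3 Φ) (hP : IsPeriodic Φ) :
    ∃ K : NNReal, LipschitzWith K (gradient Φ) := by
  have h := gradient_contDiff hΦ
  obtain ⟨C, hC⟩ := ((gradient_periodic hP).fderiv).exists_bound (h.continuous_fderiv one_ne_zero)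
  refine ⟨C.toNNReal, lipschitzWith_of_nnnorm_fderiv_le (𝕜 := ℝ)
    (h.differentiable one_ne_zero) fun x => ?_⟩
  rw [← NNReal.coe_le_coe, coe_nnnorm]
  exact (hC x).trans (Real.le_coe_toNNReal C)

/-! ### The Hamiltonian flow -/

/-- The Hamiltonian vector field `(x, v) ↦ (v, -∇Φ(x))`. -/
def hamField (Φ : E3 → ℝ) (z : E3 × E3) : E3 × E3 := (z.2, -gradient Φ z.1)

lemma hamField_contDiff {Φ : E3 → ℝ} (hΦ : ContDiff ℝ 3 Φ) : ContDiff ℝ 1 (hamField Φ) :=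
  contDiff_snd.prodMk ((gradient_contDiff hΦ).comp contDiff_fst).neg

lemma hamField_lipschitz {Φ : E3 → ℝ} (hΦ : ContDiff ℝ 3 Φ) (hP : IsPeriodic Φ) :
    ∃ K : NNReal, 0 < K ∧ LipschitzWith K (hamField Φ) := by
  obtain ⟨K, hK⟩ := gradient_lipschitz hΦ hP
  refine ⟨max 1 (K * 1), by positivity, ?_⟩
  exact LipschitzWith.prod_snd.prodMk ((hK.comp LipschitzWith.prod_fst).neg)

/-- A globally Lipschitz `C¹` vector field has global integral curves. -/
lemma exists_global_integral_curve {E : Type*} [NormedAddCommGroup E] [NormedSpace ℝ E]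
    [CompleteSpace E] {F : E → E} {K : NNReal} (hK : 0 < K) (hL : LipschitzWith K F)
    (hF : ContDiff ℝ 1 F) (x : E) :
    ∃ Z : ℝ → E, Z 0 = x ∧ ∀ s, HasDerivAt Z (F (Z s)) s := by
  have hK' : (0 : ℝ) < K := hK
  -- On the ball of radius ‖F x‖/K about x the field has norm at most 2‖F x‖, so a curve stays
  -- inside for time 1/(2K). This time does not depend on x, and therefore the local curves glue to
  -- a global one.
  set ε : ℝ := 1 / (2 * K) with hε
  have hεpos : 0 < ε := by positivity
  have hloc : ∀ x : E, ∃ Z : ℝ → E, Z 0 = x ∧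
      IsMIntegralCurveOn (I := modelWithCornersSelf ℝ E) Z F (Ioo (-ε) ε) := by
    intro x
    have hmem : (0 : ℝ) ∈ Icc (-ε) ε := ⟨by linarith, hεpos.le⟩
    have hPL : IsPicardLindelof (fun _ : ℝ => F) (tmin := -ε) (tmax := ε) ⟨0, hmem⟩ x
        (‖F x‖₊ / K) 0 (2 * ‖F x‖₊) K := by
      refine ⟨fun t _ => hL.lipschitzOnWith, fun _ _ => continuousOn_const, ?_, ?_⟩
      · intro t _ y hy
        have h1 := hL.norm_sub_le y x
        have h2 : ‖y - x‖ ≤ ‖F x‖ / K := by simpa [dist_eq_norm] using hy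
        have h3 : K * ‖y - x‖ ≤ ‖F x‖ := by
          calc K * ‖y - x‖ ≤ K * (‖F x‖ / K) := by gcongr
            _ = ‖F x‖ := by field_simp
        have h4 : ‖F y‖ ≤ ‖F y - F x‖ + ‖F x‖ := by
          simpa using norm_add_le (F y - F x) (F x)
        push_cast
        linarith
      · simp only [sub_zero, zero_sub, neg_neg, max_self, NNReal.coe_zero]
        push_cast
        rw [hε]
        apply le_of_eq
        field_simp
    obtain ⟨Z, hZ0, hZ⟩ := hPL.exists_eq_forall_mem_Icc_hasDerivWithinAt₀
    refine ⟨Z, hZ0, fun t ht => ?_⟩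
    have := (hZ t (Ioo_subset_Icc_self ht)).mono Ioo_subset_Icc_self
    exact this.hasFDerivWithinAt.hasMFDerivWithinAt
  obtain ⟨Z, hZ0, hZ⟩ := exists_isMIntegralCurve_of_isMIntegralCurveOn
    (I := modelWithCornersSelf ℝ E) (v := F)
    (contMDiff_vectorSpace_iff_contDiff.2 hF) hεpos hloc x
  refine ⟨Z, hZ0, fun s => ?_⟩
  have h : HasFDerivAt Z (ContinuousLinearMap.smulRight (1 : ℝ →L[ℝ] ℝ) (F (Z s))) s :=
    (hZ s).hasFDerivAt
  simpa using h.hasDerivAt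

lemma isCharacteristic_iff {Φ : E3 → ℝ} {t : ℝ} {x v : E3} {Z : ℝ → E3 × E3} :
    IsCharacteristic Φ t x v Z ↔ (∀ s, HasDerivAt Z (hamField Φ (Z s)) s) ∧ Z t = (x, v) := by
  unfold IsCharacteristic hamField
  constructor
  · rintro ⟨h1, h2, h3⟩
    exact ⟨fun s => (h1 s).prodMk (h2 s), h3⟩
  · rintro ⟨h1, h3⟩
    refine ⟨fun s => ?_, fun s => ?_, h3⟩
    · exact (hasFDerivAt_fst.comp_hasDerivAt s (h1 s))
    · exact (hasFDerivAt_snd.comp_hasDerivAt s (h1 s))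

/-- The flow of the characteristics. -/
def flow (Φ : E3 → ℝ) (s : ℝ) (z : E3 × E3) : E3 × E3 := characteristic Φ 0 z.1 z.2 s

section Flow

variable {Φ : E3 → ℝ} (hΦ : ContDiff ℝ 3 Φ) (hP : IsPeriodic Φ)

include hΦ hP

lemma integral_curve_unique {Z W : ℝ → E3 × E3} (hZ : ∀ s, HasDerivAt Z (hamField Φ (Z s)) s)
    (hW : ∀ s, HasDerivAt W (hamField Φ (W s)) s) {t : ℝ} (h : Z t = W t) : Z = W := by
  obtain ⟨K, -, hK⟩ := hamField_lipschitz hΦ hP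
  exact ODE_solution_unique_univ (v := fun _ => hamField Φ) (s := fun _ => univ) (K := K)
    (fun _ => hK.lipschitzOnWith) (fun s => ⟨hZ s, mem_univ _⟩) (fun s => ⟨hW s, mem_univ _⟩) h

lemma exists_isCharacteristic (t : ℝ) (x v : E3) : ∃ Z, IsCharacteristic Φ t x v Z := by
  obtain ⟨K, hK, hL⟩ := hamField_lipschitz hΦ hP
  obtain ⟨Z, hZ0, hZ⟩ := exists_global_integral_curve hK hL (hamField_contDiff hΦ) (x, v)
  refine ⟨fun s => Z (s - t), isCharacteristic_iff.2 ⟨fun s => ?_, by simpa using hZ0⟩⟩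
  exact (hZ (s - t)).comp_sub_const s t

lemma characteristic_spec (t : ℝ) (x v : E3) :
    IsCharacteristic Φ t x v (characteristic Φ t x v) :=
  Classical.epsilon_spec (exists_isCharacteristic hΦ hP t x v)

lemma hasDerivAt_flow (z : E3 × E3) (s : ℝ) :
    HasDerivAt (fun r => flow Φ r z) (hamField Φ (flow Φ s z)) s :=
  (isCharacteristic_iff.1 (characteristic_spec hΦ hP 0 z.1 z.2)).1 s

lemma flow_zero (z : E3 × E3) : flow Φ 0 z = z :=
  (isCharacteristic_iff.1 (characteristic_spec hΦ hP 0 z.1 z.2)).2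

/-- The field is autonomous and integral curves are unique, so the chosen characteristic through any
time is a time shift of the flow from time 0. -/
lemma characteristic_eq_flow (t : ℝ) (x v : E3) (s : ℝ) :
    characteristic Φ t x v s = flow Φ (s - t) (x, v) := by
  have h := isCharacteristic_iff.1 (characteristic_spec hΦ hP t x v)
  have h2 : ∀ s, HasDerivAt (fun r => flow Φ (r - t) (x, v))
      (hamField Φ (flow Φ (s - t) (x, v))) s := fun s =>
    (hasDerivAt_flow hΦ hP (x, v) (s - t)).comp_sub_const s t
  have := integral_curve_unique hΦ hP h.1 h2 (t := t) (by
    simp only [sub_self]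
    rw [flow_zero hΦ hP, h.2])
  exact congrFun this s

lemma flow_add (s t : ℝ) (z : E3 × E3) : flow Φ (s + t) z = flow Φ s (flow Φ t z) := by
  have h1 : ∀ s, HasDerivAt (fun r => flow Φ (r + t) z) (hamField Φ (flow Φ (s + t) z)) s :=
    fun s => (hasDerivAt_flow hΦ hP z (s + t)).comp_add_const s t
  have := integral_curve_unique hΦ hP h1 (hasDerivAt_flow hΦ hP (flow Φ t z)) (t := 0) (by
    simp only [zero_add]
    rw [flow_zero hΦ hP])
  exact congrFun this s

lemma flow_neg_flow (s : ℝ) (z : E3 × E3) : flow Φ (-s) (flow Φ s z) = z := by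
  rw [← flow_add hΦ hP, neg_add_cancel, flow_zero hΦ hP]

lemma flow_flow_neg (s : ℝ) (z : E3 × E3) : flow Φ s (flow Φ (-s) z) = z := by
  rw [← flow_add hΦ hP, add_neg_cancel, flow_zero hΦ hP]

lemma continuous_flow_time (z : E3 × E3) : Continuous fun s => flow Φ s z :=
  continuous_iff_continuousAt.2 fun s => (hasDerivAt_flow hΦ hP z s).continuousAt

/-- The field is invariant under lattice translations in position, so a translated curve is again a
curve. This is why the flow descends to the torus. -/
lemma flow_add_latticeVec (s : ℝ) (z : E3 × E3) (k : Fin 3 → ℤ) :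
    flow Φ s (z + (latticeVec k, 0)) = flow Φ s z + (latticeVec k, 0) := by
  have h1 : ∀ s, HasDerivAt (fun r => flow Φ r z + (latticeVec k, (0 : E3)))
      (hamField Φ (flow Φ s z + (latticeVec k, 0))) s := by
    intro s
    have h := (hasDerivAt_flow hΦ hP z s).add_const (latticeVec k, (0 : E3))
    have h' : hamField Φ (flow Φ s z + (latticeVec k, 0)) = hamField Φ (flow Φ s z) := by
      simp [hamField, (gradient_periodic hP).add_latticeVec]
    rw [h']
    exact h
  have := integral_curve_unique hΦ hP (hasDerivAt_flow hΦ hP (z + (latticeVec k, 0))) h1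
    (t := 0) (by simp only [flow_zero hΦ hP])
  exact congrFun this s

lemma dist_flow_le {K : NNReal} (hK : LipschitzWith K (hamField Φ)) (s : ℝ) (z w : E3 × E3) :
    dist (flow Φ s z) (flow Φ s w) ≤ dist z w * Real.exp (K * |s|) := by
  rcases le_total 0 s with hs | hs
  · have := dist_le_of_trajectories_ODE (v := fun _ => hamField Φ) (K := K) (a := 0) (b := s)
      (f := fun r => flow Φ r z) (g := fun r => flow Φ r w) (δ := dist z w)
      (fun _ => hK) (continuous_flow_time hΦ hP z).continuousOn
      (fun t _ => (hasDerivAt_flow hΦ hP z t).hasDerivWithinAt)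
      (continuous_flow_time hΦ hP w).continuousOn
      (fun t _ => (hasDerivAt_flow hΦ hP w t).hasDerivWithinAt)
      (by simp only [flow_zero hΦ hP]; exact le_rfl) s ⟨hs, le_rfl⟩
    simpa [abs_of_nonneg hs] using this
  -- Grönwall's inequality runs forward in time; for s ≤ 0 it is applied to the reversed field,
  -- which has the same Lipschitz constant.
  · have hneg : ∀ (z : E3 × E3) (t : ℝ), HasDerivAt (fun r => flow Φ (-r) z)
        (-hamField Φ (flow Φ (-t) z)) t := by
      intro z t
      have := HasDerivAt.scomp t (hasDerivAt_flow hΦ hP z (-t)) (hasDerivAt_neg t)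
      rw [neg_one_smul] at this
      exact this
    have := dist_le_of_trajectories_ODE (v := fun _ z => -hamField Φ z) (K := K) (a := 0) (b := -s)
      (f := fun r => flow Φ (-r) z) (g := fun r => flow Φ (-r) w) (δ := dist z w)
      (fun _ => hK.neg) ((continuous_flow_time hΦ hP z).comp continuous_neg).continuousOn
      (fun t _ => (hneg z t).hasDerivWithinAt)
      ((continuous_flow_time hΦ hP w).comp continuous_neg).continuousOn
      (fun t _ => (hneg w t).hasDerivWithinAt)
      (by simp only [neg_zero, flow_zero hΦ hP]; exact le_rfl) (-s) ⟨by linarith, le_rfl⟩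
    simpa [abs_of_nonpos hs] using this

lemma continuous_flow : Continuous fun p : ℝ × (E3 × E3) => flow Φ p.1 p.2 := by
  obtain ⟨K, -, hK⟩ := hamField_lipschitz hΦ hP
  rw [continuous_iff_continuousAt]
  rintro ⟨s, z⟩
  rw [ContinuousAt, tendsto_iff_dist_tendsto_zero]
  have h1 : Tendsto (fun p : ℝ × (E3 × E3) => dist p.2 z * Real.exp (K * |p.1|) +
      dist (flow Φ p.1 z) (flow Φ s z)) (nhds (s, z)) (nhds 0) := by
    have hc : Continuous fun p : ℝ × (E3 × E3) => dist p.2 z * Real.exp (K * |p.1|) +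
        dist (flow Φ p.1 z) (flow Φ s z) := by
      have := (continuous_flow_time hΦ hP z).comp (continuous_fst (X := ℝ) (Y := E3 × E3))
      fun_prop
    have := hc.tendsto (s, z)
    simpa using this
  refine squeeze_zero (fun _ => dist_nonneg) (fun p => ?_) h1
  exact (dist_triangle _ (flow Φ p.1 z) _).trans (by
    gcongr
    exact dist_flow_le hΦ hP hK _ _ _)

lemma measurable_flow : Measurable fun p : ℝ × (E3 × E3) => flow Φ p.1 p.2 :=
  (continuous_flow hΦ hP).measurable

lemma continuous_flow_space (s : ℝ) : Continuous (flow Φ s) :=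
  (continuous_flow hΦ hP).comp (by fun_prop : Continuous fun z : E3 × E3 => (s, z))

lemma hasDerivAt_flow_fst (z : E3 × E3) (s : ℝ) :
    HasDerivAt (fun r => (flow Φ r z).1) (flow Φ s z).2 s :=
  (characteristic_spec hΦ hP 0 z.1 z.2).1 s

lemma hasDerivAt_flow_snd (z : E3 × E3) (s : ℝ) :
    HasDerivAt (fun r => (flow Φ r z).2) (-gradient Φ (flow Φ s z).1) s :=
  (characteristic_spec hΦ hP 0 z.1 z.2).2.1 s

/-- Conservation of the Hamiltonian along the flow. -/
lemma flow_energy (s : ℝ) (z : E3 × E3) :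
    ‖(flow Φ s z).2‖ ^ 2 / 2 + Φ (flow Φ s z).1 = ‖z.2‖ ^ 2 / 2 + Φ z.1 := by
  have hd : ∀ s, HasDerivAt (fun r => ‖(flow Φ r z).2‖ ^ 2 / 2 + Φ (flow Φ r z).1) 0 s := by
    intro s
    have h1 := ((hasDerivAt_flow_snd hΦ hP z s).norm_sq).div_const 2
    have hg : HasGradientAt Φ (gradient Φ (flow Φ s z).1) (flow Φ s z).1 :=
      ((hΦ.differentiable (by norm_num)) _).hasGradientAt
    have h2 := hg.hasFDerivAt.comp_hasDerivAt s (hasDerivAt_flow_fst hΦ hP z s)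
    have h3 := h1.add h2
    have h4 : (0 : ℝ) = 2 * inner ℝ (flow Φ s z).2 (-gradient Φ (flow Φ s z).1) / 2 +
        (InnerProductSpace.toDual ℝ E3 (gradient Φ (flow Φ s z).1)) (flow Φ s z).2 := by
      rw [InnerProductSpace.toDual_apply_apply, inner_neg_right, real_inner_comm]
      ring
    rw [h4]
    exact h3
  have := is_const_of_deriv_eq_zero (fun s => (hd s).differentiableAt) (fun s => (hd s).deriv) s 0
  simpa [flow_zero hΦ hP] using this

/-- Conservation of the degenerate momentum along the flow. -/
lemma flow_momentum {e : E3} (he : e ∈ degenerateSubspace Φ) (s : ℝ) (z : E3 × E3) :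
    inner ℝ e (flow Φ s z).2 = inner ℝ e z.2 := by
  have hd : ∀ s, HasDerivAt (fun r => inner ℝ e (flow Φ r z).2) 0 s := by
    intro s
    have h1 := (hasDerivAt_const s e).inner ℝ (hasDerivAt_flow_snd hΦ hP z s)
    have h2 : inner ℝ e (gradient Φ (flow Φ s z).1) = 0 := by
      have := (Submodule.mem_iInf _).1 he (flow Φ s z).1
      rw [Submodule.mem_orthogonal_singleton_iff_inner_left] at this
      exact this
    have h3 : (0 : ℝ) = inner ℝ e (-gradient Φ (flow Φ s z).1) +
        inner ℝ (0 : E3) (flow Φ s z).2 := by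
      rw [inner_neg_right, h2, inner_zero_left, neg_zero, add_zero]
    rw [h3]
    exact h1
  have := is_const_of_deriv_eq_zero (fun s => (hd s).differentiableAt) (fun s => (hd s).deriv) s 0
  simpa [flow_zero hΦ hP] using this

end Flow

instance : (volume : Measure (E3 × E3)).IsAddHaarMeasure :=
  Measure.prod.instIsAddHaarMeasure (volume : Measure E3) (volume : Measure E3)

/-! ### Liouville's theorem, by the symplectic Euler scheme -/

/-- One step of the symplectic Euler scheme. -/
def eulerStep (Φ : E3 → ℝ) (h : ℝ) (z : E3 × E3) : E3 × E3 :=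
  (z.1 + h • z.2, z.2 - h • gradient Φ (z.1 + h • z.2))

/-- A shear: each fibre with v fixed is translated by the constant vector h v. The swaps bring the
translated variable into the second factor. -/
lemma measurePreserving_drift (h : ℝ) :
    MeasurePreserving (fun z : E3 × E3 => (z.1 + h • z.2, z.2)) := by
  have h1 : MeasurePreserving (fun z : E3 × E3 => (z.1, z.2 + h • z.1))
      ((volume : Measure E3).prod volume) (volume.prod volume) :=
    (MeasurePreserving.id (volume : Measure E3)).skew_product (g := fun x v => v + h • x)
      (by fun_prop) (Eventually.of_forall fun x => map_add_right_eq_self volume (h • x))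
  have h2 := Measure.measurePreserving_swap (μ := (volume : Measure E3))
    (ν := (volume : Measure E3))
  exact (h2.comp h1).comp h2

lemma measurePreserving_kick {G : E3 → E3} (hG : Measurable G) (h : ℝ) :
    MeasurePreserving (fun z : E3 × E3 => (z.1, z.2 - h • G z.1)) := by
  have h1 : MeasurePreserving (fun z : E3 × E3 => (z.1, z.2 - h • G z.1))
      ((volume : Measure E3).prod volume) (volume.prod volume) :=
    (MeasurePreserving.id (volume : Measure E3)).skew_product (g := fun x v => v - h • G x)
      (by fun_prop) (Eventually.of_forall fun x => by
        simpa [sub_eq_add_neg] using map_add_right_eq_self volume (-(h • G x)))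
  exact h1

lemma measurePreserving_eulerStep {Φ : E3 → ℝ} (hG : Measurable (gradient Φ)) (h : ℝ) :
    MeasurePreserving (eulerStep Φ h) :=
  (measurePreserving_kick hG h).comp (measurePreserving_drift h)

/-- Stability of one step. The exponential form of the constant makes the constants of successive
steps multiply to a bound depending only on the total time. -/
lemma dist_eulerStep_le {Φ : E3 → ℝ} {K : NNReal} (hK : LipschitzWith K (gradient Φ)) (h : ℝ)
    (z w : E3 × E3) :
    dist (eulerStep Φ h z) (eulerStep Φ h w) ≤ Real.exp (|h| * (1 + K)) * dist z w := by
  have h1 : dist z.1 w.1 ≤ dist z w := le_max_left _ _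
  have h2 : dist z.2 w.2 ≤ dist z w := le_max_right _ _
  have h3 : dist (z.1 + h • z.2) (w.1 + h • w.2) ≤ (1 + |h|) * dist z w := by
    calc _ ≤ dist z.1 w.1 + dist (h • z.2) (h • w.2) := dist_add_add_le _ _ _ _
      _ ≤ dist z w + |h| * dist z w := by
        rw [dist_smul₀, Real.norm_eq_abs]
        gcongr
      _ = _ := by ring
  have h4 : dist (gradient Φ (z.1 + h • z.2)) (gradient Φ (w.1 + h • w.2)) ≤
      K * ((1 + |h|) * dist z w) := (hK.dist_le_mul _ _).trans (by gcongr)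
  have h5 : dist (z.2 - h • gradient Φ (z.1 + h • z.2)) (w.2 - h • gradient Φ (w.1 + h • w.2)) ≤
      dist z w + |h| * (K * ((1 + |h|) * dist z w)) := by
    calc _ ≤ dist z.2 w.2 + dist (h • gradient Φ (z.1 + h • z.2))
          (h • gradient Φ (w.1 + h • w.2)) := dist_sub_sub_le _ _ _ _
      _ ≤ _ := by
        rw [dist_smul₀, Real.norm_eq_abs]
        gcongr
  have hd : 0 ≤ dist z w := dist_nonneg
  have hK0 : (0 : ℝ) ≤ K := K.2
  have ha := abs_nonneg h
  have h6 : (1 + |h|) * (1 + |h| * K) ≤ Real.exp (|h| * (1 + K)) := by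
    rw [show |h| * (1 + (K : ℝ)) = |h| + |h| * K by ring, Real.exp_add]
    gcongr
    · linarith [Real.add_one_le_exp |h|]
    · linarith [Real.add_one_le_exp (|h| * K)]
  refine max_le ?_ ?_
  · refine h3.trans (mul_le_mul_of_nonneg_right ?_ hd)
    refine le_trans ?_ h6
    nlinarith [mul_nonneg ha hK0, mul_nonneg ha (mul_nonneg ha hK0)]
  · refine h5.trans ?_
    refine le_trans (b := (1 + |h|) * (1 + |h| * K) * dist z w) ?_ (by gcongr)
    nlinarith [mul_nonneg ha hd]

section Flow

variable {Φ : E3 → ℝ} (hΦ : ContDiff ℝ 3 Φ) (hP : IsPeriodic Φ)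

include hΦ hP

/-- Consistency: the error of one step is of order h². Mean value inequalities suffice, given a
bound R for the speed along the arc and the Lipschitz constant of ∇Φ. -/
lemma dist_eulerStep_flow_le {K : NNReal} (hK : LipschitzWith K (gradient Φ)) {h R : ℝ}
    {z : E3 × E3} (hR : ∀ r ∈ uIcc 0 h, ‖hamField Φ (flow Φ r z)‖ ≤ R) :
    dist (eulerStep Φ h z) (flow Φ h z) ≤ (1 + 2 * K) * R * h ^ 2 := by
  have h0 : (0 : ℝ) ∈ uIcc 0 h := left_mem_uIcc
  have hh : h ∈ uIcc 0 h := right_mem_uIcc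
  have hR0 : 0 ≤ R := (norm_nonneg _).trans (hR 0 h0)
  have hconv : Convex ℝ (uIcc 0 h) := convex_uIcc 0 h
  have habs : ∀ r ∈ uIcc 0 h, |r| ≤ |h| := by
    intro r hr
    rcases le_total 0 h with h' | h'
    · rw [uIcc_of_le h'] at hr
      rw [abs_of_nonneg hr.1, abs_of_nonneg h']; exact hr.2
    · rw [uIcc_of_ge h'] at hr
      rw [abs_of_nonpos hr.2, abs_of_nonpos h']; linarith [hr.1]
  have hdist : ∀ r ∈ uIcc 0 h, ‖flow Φ r z - z‖ ≤ R * |h| := by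
    intro r hr
    have := hconv.norm_image_sub_le_of_norm_hasDerivWithin_le (C := R)
      (fun s hs => (hasDerivAt_flow hΦ hP z s).hasDerivWithinAt) hR h0 hr
    rw [flow_zero hΦ hP] at this
    refine this.trans ?_
    rw [sub_zero, Real.norm_eq_abs]
    exact mul_le_mul_of_nonneg_left (habs r hr) hR0
  have hv : ‖z.2‖ ≤ R := by
    have := hR 0 h0
    rw [flow_zero hΦ hP] at this
    exact (norm_fst_le (hamField Φ z)).trans this
  have hx : ‖(flow Φ h z).1 - (z.1 + h • z.2)‖ ≤ R * |h| * |h| := by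
    have := hconv.norm_image_sub_le_of_norm_hasDerivWithin_le (C := R * |h|)
      (f := fun r => (flow Φ r z).1 - r • z.2) (f' := fun r => (flow Φ r z).2 - (1 : ℝ) • z.2)
      (fun s hs => ((hasDerivAt_flow_fst hΦ hP z s).sub
        ((hasDerivAt_id s).smul_const z.2)).hasDerivWithinAt) (fun r hr => by
        rw [one_smul]
        exact (norm_snd_le (flow Φ r z - z)).trans (hdist r hr)) h0 hh
    simp only [flow_zero hΦ hP, zero_smul, sub_zero, Real.norm_eq_abs] at this
    rwa [sub_sub, add_comm (h • z.2)] at this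
  have hvv : ‖(flow Φ h z).2 - (z.2 - h • gradient Φ (z.1 + h • z.2))‖ ≤
      K * (2 * R * |h|) * |h| := by
    have := hconv.norm_image_sub_le_of_norm_hasDerivWithin_le (C := K * (2 * R * |h|))
      (f := fun r => (flow Φ r z).2 + r • gradient Φ (z.1 + h • z.2))
      (f' := fun r => -gradient Φ (flow Φ r z).1 + (1 : ℝ) • gradient Φ (z.1 + h • z.2))
      (fun s hs => ((hasDerivAt_flow_snd hΦ hP z s).add
        ((hasDerivAt_id s).smul_const _)).hasDerivWithinAt) (fun r hr => by
        rw [one_smul, neg_add_eq_sub]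
        refine (hK.norm_sub_le _ _).trans ?_
        gcongr
        have e : z.1 + h • z.2 - (flow Φ r z).1 = h • z.2 - (flow Φ r z - z).1 := by
          simp only [Prod.fst_sub]; abel
        rw [e]
        refine (norm_sub_le _ _).trans ?_
        rw [norm_smul, Real.norm_eq_abs]
        have h1 := (norm_fst_le (flow Φ r z - z)).trans (hdist r hr)
        have h2 : |h| * ‖z.2‖ ≤ |h| * R := by gcongr
        linarith) h0 hh
    simp only [flow_zero hΦ hP, zero_smul, add_zero, sub_zero, Real.norm_eq_abs] at this
    have e : (flow Φ h z).2 - (z.2 - h • gradient Φ (z.1 + h • z.2)) =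
      (flow Φ h z).2 + h • gradient Φ (z.1 + h • z.2) - z.2 := by abel
    rw [e]
    exact this
  have hsq : h ^ 2 = |h| * |h| := by rw [← sq, sq_abs]
  have hK0 : (0 : ℝ) ≤ K := K.2
  have hRh : 0 ≤ R * (|h| * |h|) := by positivity
  rw [hsq]
  refine max_le ?_ ?_
  · rw [dist_comm, dist_eq_norm]
    refine hx.trans ?_
    nlinarith [mul_nonneg hK0 hRh]
  · rw [dist_comm, dist_eq_norm]
    refine hvv.trans ?_
    nlinarith

lemma tendsto_eulerStep_iterate (t : ℝ) (z : E3 × E3) :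
    Tendsto (fun n : ℕ => (eulerStep Φ (t / (n + 1)))^[n + 1] z) atTop (nhds (flow Φ t z)) := by
  obtain ⟨K, hK⟩ := gradient_lipschitz hΦ hP
  have hcont : Continuous fun r => hamField Φ (flow Φ r z) :=
    (hamField_contDiff hΦ).continuous.comp (continuous_flow_time hΦ hP z)
  obtain ⟨R, hR⟩ := (isCompact_Icc (a := -|t|) (b := |t|)).exists_bound_of_continuousOn
    hcont.continuousOn
  set L : ℝ := 1 + K
  have hL : 0 ≤ L := by positivity
  have hR0 : 0 ≤ R := (norm_nonneg _).trans (hR 0 (by simp))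
  set C : ℝ := (1 + 2 * K) * R with hC
  have hC0 : 0 ≤ C := by positivity
  have key : ∀ n : ℕ, dist ((eulerStep Φ (t / (n + 1)))^[n + 1] z) (flow Φ t z) ≤
      C * t ^ 2 * Real.exp (|t| * L) * (1 / ((n : ℝ) + 1)) := by
    intro n
    set h : ℝ := t / (n + 1) with hh
    have hn : (0 : ℝ) < (n : ℝ) + 1 := by positivity
    have hht : |t| = (n + 1) * |h| := by
      rw [hh, abs_div, abs_of_pos hn]; field_simp
    -- Errors accumulate linearly: k steps of local error C h², each amplified at most by the
    -- exponential stability factor. With n + 1 steps of size t/(n + 1) the total is of order 1/(n +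
    -- 1).
    have ind : ∀ k : ℕ, k ≤ n + 1 → dist ((eulerStep Φ h)^[k] z) (flow Φ (k * h) z) ≤
        k * (C * h ^ 2) * Real.exp (k * |h| * L) := by
      intro k
      induction k with
      | zero => intro _; simp [flow_zero hΦ hP]
      | succ k ih =>
        intro hk
        have ih' := ih (by omega)
        have hkn : (k : ℝ) + 1 ≤ n + 1 := by exact_mod_cast hk
        rw [Function.iterate_succ_apply']
        have e : flow Φ ((k + 1 : ℕ) * h) z = flow Φ h (flow Φ (k * h) z) := by
          rw [← flow_add hΦ hP]; congr 1; push_cast; ring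
        have hstep := dist_eulerStep_flow_le hΦ hP hK (h := h) (R := R) (z := flow Φ (k * h) z) (by
          intro r hr
          rw [← flow_add hΦ hP]
          apply hR
          have hrh : |r| ≤ |h| := by
            rcases le_total 0 h with h' | h'
            · rw [uIcc_of_le h'] at hr
              rw [abs_of_nonneg hr.1, abs_of_nonneg h']; exact hr.2
            · rw [uIcc_of_ge h'] at hr
              rw [abs_of_nonpos hr.2, abs_of_nonpos h']; linarith [hr.1]
          rw [mem_Icc, ← abs_le]
          calc |r + k * h| ≤ |r| + |k * h| := abs_add_le _ _
            _ ≤ |h| + k * |h| := by rw [abs_mul, Nat.abs_cast]; gcongr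
            _ = (k + 1) * |h| := by ring
            _ ≤ (n + 1) * |h| := by gcongr
            _ = |t| := hht.symm)
        rw [e]
        have hexp1 : 1 ≤ Real.exp ((k + 1 : ℕ) * |h| * L) := Real.one_le_exp (by positivity)
        calc _ ≤ dist (eulerStep Φ h ((eulerStep Φ h)^[k] z)) (eulerStep Φ h (flow Φ (k * h) z)) +
              dist (eulerStep Φ h (flow Φ (k * h) z)) (flow Φ h (flow Φ (k * h) z)) :=
              dist_triangle _ _ _
          _ ≤ Real.exp (|h| * L) * (k * (C * h ^ 2) * Real.exp (k * |h| * L)) + C * h ^ 2 := by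
              refine add_le_add ((dist_eulerStep_le hK h _ _).trans ?_) hstep
              gcongr
          _ = k * (C * h ^ 2) * Real.exp ((k + 1 : ℕ) * |h| * L) + C * h ^ 2 := by
              have : Real.exp ((k + 1 : ℕ) * |h| * L) =
                  Real.exp (|h| * L) * Real.exp (k * |h| * L) := by
                rw [← Real.exp_add]; congr 1; push_cast; ring
              rw [this]; ring
          _ ≤ k * (C * h ^ 2) * Real.exp ((k + 1 : ℕ) * |h| * L) +
              C * h ^ 2 * Real.exp ((k + 1 : ℕ) * |h| * L) := by
              exact add_le_add le_rfl (le_mul_of_one_le_right (by positivity) hexp1)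
          _ = _ := by push_cast; ring
    have h1 := ind (n + 1) le_rfl
    have e1 : ((n + 1 : ℕ) : ℝ) * h = t := by rw [hh]; push_cast; field_simp
    have e2 : ((n + 1 : ℕ) : ℝ) * |h| = |t| := by rw [hht]; push_cast; ring
    rw [e1, e2] at h1
    refine h1.trans (le_of_eq ?_)
    have e3 : ((n + 1 : ℕ) : ℝ) * (C * h ^ 2) = C * t ^ 2 * (1 / (n + 1)) := by
      rw [hh]; push_cast; field_simp
    rw [e3]; ring
  rw [tendsto_iff_dist_tendsto_zero]
  refine squeeze_zero (fun _ => dist_nonneg) key ?_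
  simpa using (tendsto_one_div_add_atTop_nhds_zero_nat (𝕜 := ℝ)).const_mul
    (C * t ^ 2 * Real.exp (|t| * L))

/-- Symplectic Euler steps are compositions of shears and preserve volume. For an open set, a point
that the flow sends into U is eventually sent into U by the schemes, so Fatou's lemma passes the
volume bound to the limit. No derivative of the flow in its initial point is needed. -/
lemma volume_flow_preimage_isOpen_le (t : ℝ) {U : Set (E3 × E3)} (hU : IsOpen U) :
    volume (flow Φ t ⁻¹' U) ≤ volume U := by
  set σ : ℕ → E3 × E3 → E3 × E3 := fun n => (eulerStep Φ (t / (n + 1)))^[n + 1]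
  have hσ : ∀ n, MeasurePreserving (σ n) := fun n =>
    (measurePreserving_eulerStep (gradient_contDiff hΦ).continuous.measurable _).iterate _
  have hmeas : MeasurableSet (flow Φ t ⁻¹' U) :=
    (continuous_flow_space hΦ hP t).measurable hU.measurableSet
  calc volume (flow Φ t ⁻¹' U) = ∫⁻ z, (flow Φ t ⁻¹' U).indicator 1 z :=
        (lintegral_indicator_one hmeas).symm
    _ ≤ ∫⁻ z, liminf (fun n => (σ n ⁻¹' U).indicator 1 z) atTop := by
        apply lintegral_mono
        intro z
        by_cases hz : z ∈ flow Φ t ⁻¹' U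
        · rw [indicator_of_mem hz]
          have hev : ∀ᶠ n in atTop, z ∈ σ n ⁻¹' U :=
            (tendsto_eulerStep_iterate hΦ hP t z).eventually (hU.mem_nhds hz)
          apply le_liminf_of_le
          · isBoundedDefault
          · filter_upwards [hev] with n hn
            rw [indicator_of_mem hn]
        · rw [indicator_of_notMem hz]; exact zero_le
    _ ≤ liminf (fun n => ∫⁻ z, (σ n ⁻¹' U).indicator 1 z) atTop :=
        lintegral_liminf_le fun n =>
          measurable_one.indicator ((hσ n).measurable hU.measurableSet)
    _ = volume U := by
        simp_rw [lintegral_indicator_one ((hσ _).measurable hU.measurableSet),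
          (hσ _).measure_preimage hU.measurableSet.nullMeasurableSet]
        simp

/-- **Liouville's theorem** for the flow of the characteristics. -/
lemma measurePreserving_flow (t : ℝ) : MeasurePreserving (flow Φ t) := by
  have hle : ∀ (t : ℝ) (A : Set (E3 × E3)), volume (flow Φ t ⁻¹' A) ≤ volume A := by
    intro t A
    -- Outer regularity extends the inequality from open sets to all sets.
    rw [A.measure_eq_iInf_isOpen volume]
    refine le_iInf fun U => le_iInf fun hAU => le_iInf fun hU => ?_
    exact (measure_mono (preimage_mono hAU)).trans (volume_flow_preimage_isOpen_le hΦ hP t hU)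
  refine ⟨(continuous_flow_space hΦ hP t).measurable, ?_⟩
  ext A hA
  rw [Measure.map_apply (continuous_flow_space hΦ hP t).measurable hA]
  refine le_antisymm (hle t A) ?_
  -- The reverse inequality is the same bound for the inverse flow.
  have h1 := hle (-t) (flow Φ t ⁻¹' A)
  have h2 : flow Φ (-t) ⁻¹' (flow Φ t ⁻¹' A) = A := by
    ext z
    simp [flow_flow_neg hΦ hP]
  rwa [h2] at h1

/-! ### The flow on the torus -/

omit hΦ hP in
lemma measurableSet_unitCube : MeasurableSet unitCube := by
  have : unitCube = ⋂ i : Fin 3, (fun x : E3 => x i) ⁻¹' Ico (0 : ℝ) 1 := by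
    ext x; simp [unitCube]
  rw [this]
  exact MeasurableSet.iInter fun i =>
    (by fun_prop : Measurable fun x : E3 => x i) measurableSet_Ico

omit hΦ hP in
lemma measurableSet_cell : MeasurableSet (unitCube ×ˢ (univ : Set E3)) :=
  measurableSet_unitCube.prod MeasurableSet.univ

omit hΦ hP in
lemma phaseMeasure_eq :
    phaseMeasure = (volume : Measure (E3 × E3)).restrict (unitCube ×ˢ univ) := by
  rw [phaseMeasure, Measure.volume_eq_prod, ← Measure.prod_restrict, Measure.restrict_univ]

omit hΦ hP in
lemma add_latticeVec_mem_unitCube_iff (x : E3) (k : Fin 3 → ℤ) :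
    x + latticeVec k ∈ unitCube ↔ k = fun i => -⌊x i⌋ := by
  constructor
  · intro h
    funext i
    have hi : (0 : ℝ) ≤ x i + k i ∧ x i + k i < 1 := by simpa [latticeVec] using h i
    have : ⌊x i⌋ = -k i := by
      rw [Int.floor_eq_iff]; push_cast; constructor <;> linarith [hi.1, hi.2]
    omega
  · rintro rfl i
    have h1 := Int.floor_le (x i)
    have h2 := Int.lt_floor_add_one (x i)
    have : (x + latticeVec fun i => -⌊x i⌋) i = x i - ⌊x i⌋ := by simp [latticeVec, sub_eq_add_neg]
    rw [this]
    constructor <;> linarith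

-- The lattice translates of the cell tile the space; this is the partition of unity behind the
-- unfolding argument.
omit hΦ hP in
lemma tsum_indicator_cell (z : E3 × E3) :
    ∑' k : Fin 3 → ℤ, (unitCube ×ˢ (univ : Set E3)).indicator (1 : E3 × E3 → ℝ≥0∞)
      (z + (latticeVec k, 0)) = 1 := by
  rw [tsum_eq_single (fun i => -⌊z.1 i⌋)]
  · rw [indicator_of_mem]
    · rfl
    · exact ⟨(add_latticeVec_mem_unitCube_iff z.1 _).2 rfl, mem_univ _⟩
  · intro k hk
    rw [indicator_of_notMem]
    rintro ⟨h, -⟩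
    exact hk ((add_latticeVec_mem_unitCube_iff z.1 k).1 h)

omit hΦ hP in
lemma IsPeriodic.add_latticeVec_prod {α : Type*} {h : E3 × E3 → α}
    (hh : IsPeriodic fun x v => h (x, v)) (k : Fin 3 → ℤ) (z : E3 × E3) :
    h (z + (latticeVec k, 0)) = h z := by
  have := congrFun (hh.add_latticeVec k z.1) z.2
  simpa [Prod.add_def] using this

/-- The flow moves the cell, so its invariance on the whole space is not directly enough. Inserting
the partition of unity, translating each term back into the cell and summing the translates of the
moved cell shows that the image of the cell is again a fundamental domain. -/
lemma lintegral_phase_flow (s : ℝ) {h : E3 × E3 → ℝ≥0∞} (hm : Measurable h)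
    (hh : IsPeriodic fun x v => h (x, v)) :
    ∫⁻ z, h (flow Φ s z) ∂phaseMeasure = ∫⁻ z, h z ∂phaseMeasure := by
  set D : Set (E3 × E3) := unitCube ×ˢ univ with hD
  have hDm : MeasurableSet D := measurableSet_cell
  set χ : E3 × E3 → ℝ≥0∞ := D.indicator 1 with hχ
  have hχm : Measurable χ := measurable_one.indicator hDm
  have hform : ∀ g : E3 × E3 → ℝ≥0∞, ∫⁻ z, g z ∂phaseMeasure = ∫⁻ z, χ z * g z := by
    intro g
    rw [phaseMeasure_eq, ← lintegral_indicator hDm]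
    congr 1
    funext z
    by_cases hz : z ∈ D <;> simp [hχ, hz]
  have hfl : ∀ t, Measurable (flow Φ t) := fun t => (continuous_flow_space hΦ hP t).measurable
  calc ∫⁻ z, h (flow Φ s z) ∂phaseMeasure = ∫⁻ z, χ z * h (flow Φ s z) := hform _
    _ = ∫⁻ z, χ (flow Φ (-s) (flow Φ s z)) * h (flow Φ s z) := by
        simp_rw [flow_neg_flow hΦ hP]
    _ = ∫⁻ z, χ (flow Φ (-s) z) * h z :=
        (measurePreserving_flow hΦ hP s).lintegral_comp
          (f := fun z => χ (flow Φ (-s) z) * h z) ((hχm.comp (hfl _)).mul hm)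
    _ = ∫⁻ z, ∑' k : Fin 3 → ℤ, χ (z + (latticeVec k, 0)) * (χ (flow Φ (-s) z) * h z) := by
        simp_rw [ENNReal.tsum_mul_right, hχ, hD, tsum_indicator_cell, one_mul]
    _ = ∑' k : Fin 3 → ℤ, ∫⁻ z, χ (z + (latticeVec k, 0)) * (χ (flow Φ (-s) z) * h z) := by
        rw [lintegral_tsum]
        intro k
        exact ((hχm.comp (measurable_add_const _)).mul
          ((hχm.comp (hfl _)).mul hm)).aemeasurable
    _ = ∑' k : Fin 3 → ℤ, ∫⁻ z, χ z * (χ (flow Φ (-s) z + (latticeVec (-k), 0)) * h z) := by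
        congr 1
        funext k
        rw [← lintegral_add_right_eq_self
          (fun z => χ z * (χ (flow Φ (-s) z + (latticeVec (-k), 0)) * h z))
          (latticeVec k, (0 : E3))]
        congr 1
        funext z
        rw [flow_add_latticeVec hΦ hP, hh.add_latticeVec_prod]
        have : flow Φ (-s) z + (latticeVec k, 0) + (latticeVec (-k), (0 : E3)) = flow Φ (-s) z := by
          rw [add_assoc]
          have : ((latticeVec k, 0) + (latticeVec (-k), (0 : E3)) : E3 × E3) = 0 := by
            ext i <;> simp [latticeVec]
          rw [this, add_zero]
        rw [this]
    _ = ∑' k : Fin 3 → ℤ, ∫⁻ z, χ z * (χ (flow Φ (-s) z + (latticeVec k, 0)) * h z) :=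
        (Equiv.neg (Fin 3 → ℤ)).tsum_eq
          fun k => ∫⁻ z, χ z * (χ (flow Φ (-s) z + (latticeVec k, 0)) * h z)
    _ = ∫⁻ z, ∑' k : Fin 3 → ℤ, χ z * (χ (flow Φ (-s) z + (latticeVec k, 0)) * h z) := by
        rw [lintegral_tsum]
        intro k
        exact (hχm.mul ((hχm.comp ((hfl _).add_const _)).mul hm)).aemeasurable
    _ = ∫⁻ z, χ z * h z := by
        simp_rw [ENNReal.tsum_mul_left, ENNReal.tsum_mul_right, hχ, hD, tsum_indicator_cell,
          one_mul]
    _ = ∫⁻ z, h z ∂phaseMeasure := (hform h).symm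

omit hΦ hP in
lemma measurable_cubeRep : Measurable cubeRep := by
  unfold cubeRep
  refine (WithLp.measurable_toLp 2 (Fin 3 → ℝ)).comp (measurable_pi_iff.2 fun i => ?_)
  exact measurable_fract.comp (by fun_prop)

omit hΦ hP in
lemma cubeRep_periodic : IsPeriodic cubeRep := by
  intro i x
  ext j
  simp only [cubeRep, PiLp.add_apply, PiLp.single_apply, EuclideanSpace.single]
  split_ifs <;> simp

/-- The flow on the torus preserves the phase measure. -/
lemma measurePreserving_torusFlow (s : ℝ) :
    MeasurePreserving (fun z => (cubeRep (flow Φ s z).1, (flow Φ s z).2))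
      phaseMeasure phaseMeasure := by
  have hc : Measurable fun z : E3 × E3 => (cubeRep z.1, z.2) :=
    (measurable_cubeRep.comp measurable_fst).prodMk measurable_snd
  have hm : Measurable fun z => (cubeRep (flow Φ s z).1, (flow Φ s z).2) :=
    hc.comp (continuous_flow_space hΦ hP s).measurable
  refine ⟨hm, ?_⟩
  ext A hA
  rw [Measure.map_apply hm hA, ← lintegral_indicator_one (hm hA)]
  have h1 := lintegral_phase_flow hΦ hP s
    (h := fun z => A.indicator 1 (cubeRep z.1, z.2)) ((measurable_one.indicator hA).comp hc) (by
      intro i x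
      funext v
      simp only [cubeRep_periodic i x])
  have h2 : ∫⁻ z, (A.indicator 1 (cubeRep z.1, z.2) : ℝ≥0∞) ∂phaseMeasure = phaseMeasure A := by
    rw [← lintegral_indicator_one hA, phaseMeasure_eq]
    apply setLIntegral_congr_fun measurableSet_cell
    rintro z ⟨hz, -⟩
    have : cubeRep z.1 = z.1 := by
      ext i
      exact Int.fract_eq_self.2 (hz i)
    simp only [this]
  rw [← h2, ← h1]
  rfl

lemma integral_phase_flow (s : ℝ) {h : E3 × E3 → ℝ} (hm : Measurable h)
    (hh : IsPeriodic fun x v => h (x, v)) :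
    ∫ z, h (flow Φ s z) ∂phaseMeasure = ∫ z, h z ∂phaseMeasure := by
  have hmp := measurePreserving_torusFlow hΦ hP s
  have h1 : ∀ z, h (cubeRep (flow Φ s z).1, (flow Φ s z).2) = h (flow Φ s z) := fun z =>
    congrFun (hh.cubeRep (flow Φ s z).1) _
  simp_rw [← h1]
  rw [← integral_map hmp.measurable.aemeasurable hm.aestronglyMeasurable, hmp.map_eq]

-- Periodic null sets may be tested on the whole space, where the flow preserves Lebesgue measure.
omit hΦ hP in
lemma ae_phaseMeasure_iff {P : E3 × E3 → Prop} (hPer : IsPeriodic fun x v => P (x, v)) :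
    (∀ᵐ z ∂phaseMeasure, P z) ↔ ∀ᵐ z, P z := by
  rw [phaseMeasure_eq, ae_restrict_iff' measurableSet_cell]
  refine ⟨fun h => ?_, fun h => h.mono fun z hz _ => hz⟩
  have h2 : ∀ k : Fin 3 → ℤ, ∀ᵐ z : E3 × E3, z + (latticeVec k, 0) ∈ unitCube ×ˢ (univ : Set E3) →
      P (z + (latticeVec k, 0)) := fun k =>
    (measurePreserving_add_right (volume : Measure (E3 × E3)) (latticeVec k, (0 : E3))
      ).quasiMeasurePreserving.ae h
  filter_upwards [ae_all_iff.2 h2] with z hz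
  rw [← hPer.add_latticeVec_prod (fun i => -⌊z.1 i⌋) z]
  exact hz _ ⟨(add_latticeVec_mem_unitCube_iff z.1 _).2 rfl, mem_univ _⟩

lemma ae_phase_flow {P : E3 × E3 → Prop} (hPer : IsPeriodic fun x v => P (x, v))
    (h : ∀ᵐ z ∂phaseMeasure, P z) (s : ℝ) : ∀ᵐ z ∂phaseMeasure, P (flow Φ s z) := by
  have h1 := (measurePreserving_flow hΦ hP s).quasiMeasurePreserving.ae
    ((ae_phaseMeasure_iff hPer).1 h)
  rw [phaseMeasure_eq]
  exact ae_restrict_of_ae h1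

end Flow

instance : SFinite phaseMeasure := by
  unfold phaseMeasure; infer_instance

/-! ### Integration over the sphere -/

instance : IsFiniteMeasure sphereMeasure := by
  unfold sphereMeasure; infer_instance

-- The surface measure of a set is defined by the volume of the cone over it, and volume is
-- invariant under x ↦ -x.
open scoped Pointwise in
lemma measurePreserving_neg_sphere :
    MeasurePreserving (fun ω : S2 => -ω) sphereMeasure sphereMeasure := by
  have hm : Measurable fun ω : S2 => -ω := continuous_neg.measurable
  refine ⟨hm, ?_⟩
  ext s hs
  rw [Measure.map_apply hm hs, sphereMeasure, Measure.toSphere_apply' _ (hm hs),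
    Measure.toSphere_apply' _ hs]
  congr 1
  rw [← Measure.measure_preimage_neg (volume : Measure E3)
    (Ioo (0 : ℝ) 1 • (Subtype.val '' s))]
  congr 1
  ext x
  simp only [Set.mem_smul, mem_preimage, mem_image, Subtype.exists]
  constructor
  · rintro ⟨r, hr, y, ⟨a, ha, has, rfl⟩, rfl⟩
    exact ⟨r, hr, -a, ⟨-a, by simpa using ha, has, rfl⟩, by simp⟩
  · rintro ⟨r, hr, y, ⟨a, ha, has, rfl⟩, h⟩
    refine ⟨r, hr, -a, ⟨-a, by simpa using ha, ?_, rfl⟩, ?_⟩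
    · have : (-(⟨-a, by simpa using ha⟩ : S2)) = ⟨a, ha⟩ := by ext; simp
      rw [this]; exact has
    · rw [smul_neg, h, neg_neg]

/-- Polar coordinates for a function homogeneous of degree zero: the radial factor is ∫₀¹ r² dr =
1/3. Only the inequality used later is recorded. -/
lemma lintegral_sphere_eq_ball {k : E3 → ℝ≥0∞} (hk : Measurable k)
    (hom : ∀ r : ℝ, 0 < r → ∀ x, k (r • x) = k x) :
    (∫⁻ ω : S2, k ω ∂sphereMeasure) * ENNReal.ofReal (1 / 3) ≤
      ∫⁻ x in Metric.ball (0 : E3) 1, k x := by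
  have hdim : Module.finrank ℝ E3 - 1 = 2 := by simp
  have hmp := Measure.measurePreserving_homeomorphUnitSphereProd (volume : Measure E3)
  rw [hdim] at hmp
  have h1 := lintegral_prod_mul (μ := (volume : Measure E3).toSphere)
    (ν := Measure.volumeIoiPow 2) (f := fun ω : S2 => k ω)
    (g := (Iio (⟨1, mem_Ioi.2 one_pos⟩ : Ioi (0 : ℝ))).indicator 1)
    (hk.comp measurable_subtype_coe).aemeasurable
    (measurable_one.indicator measurableSet_Iio).aemeasurable
  rw [lintegral_indicator_one measurableSet_Iio, Measure.volumeIoiPow_apply_Iio] at h1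
  have h2 : ENNReal.ofReal (1 / 3) = ENNReal.ofReal ((1 : ℝ) ^ (2 + 1) / ((2 : ℕ) + 1)) := by
    congr 1; norm_num
  rw [sphereMeasure, h2, ← h1, ← hmp.lintegral_comp_emb (Homeomorph.measurableEmbedding _)]
  have h3 : ∀ x : ({0}ᶜ : Set E3), k ((homeomorphUnitSphereProd E3 x).1 : E3) *
      (Iio (⟨1, mem_Ioi.2 one_pos⟩ : Ioi (0 : ℝ))).indicator 1 (homeomorphUnitSphereProd E3 x).2 ≤
      (Metric.ball (0 : E3) 1).indicator k x := by
    intro x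
    have hx : (x : E3) ≠ 0 := x.2
    by_cases hlt : (homeomorphUnitSphereProd E3 x).2 ∈ Iio (⟨1, mem_Ioi.2 one_pos⟩ : Ioi (0 : ℝ))
    · rw [indicator_of_mem hlt, Pi.one_apply, mul_one]
      have hlt' : ‖(x : E3)‖ < 1 := by
        have h : ((homeomorphUnitSphereProd E3 x).2 : ℝ) < 1 := hlt
        simpa using h
      rw [indicator_of_mem (by simpa using hlt')]
      apply le_of_eq
      have : ((homeomorphUnitSphereProd E3 x).1 : E3) = ‖(x : E3)‖⁻¹ • (x : E3) := by
        simp [homeomorphUnitSphereProd_apply_fst_coe]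
      rw [this, hom _ (by positivity)]
    · rw [indicator_of_notMem hlt, mul_zero]; exact zero_le
  refine (lintegral_mono h3).trans ?_
  rw [lintegral_subtype_comap (MeasurableSet.singleton 0).compl,
    ← lintegral_indicator measurableSet_ball]
  exact setLIntegral_le_lintegral _ _

/-- An integrable singularity on the line. -/
def halfSing (t : ℝ) : ℝ := (Ioo (-1 : ℝ) 1).indicator (fun t => |t| ^ (-(1 / 2) : ℝ)) t

lemma integrable_halfSing : Integrable halfSing := by
  have h1 : IntervalIntegrable (fun t : ℝ => |t| ^ (-(1 / 2) : ℝ)) volume 0 1 := by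
    have := intervalIntegral.intervalIntegrable_rpow' (a := 0) (b := 1)
      (r := -(1 / 2)) (by norm_num)
    refine this.congr ?_
    rw [uIoc_of_le zero_le_one]
    intro t ht
    simp only [abs_of_pos ht.1]
  have h2 : IntervalIntegrable (fun t : ℝ => |t| ^ (-(1 / 2) : ℝ)) volume (-1) 0 := by
    rw [IntervalIntegrable.iff_comp_neg]
    simpa using h1.symm
  have h3 := h2.trans h1
  rw [intervalIntegrable_iff_integrableOn_Ioo_of_le (by norm_num)] at h3
  exact (integrable_indicator_iff measurableSet_Ioo).2 h3

/-- The singularity sits on the axis through ±z and has codimension two. Passing to the unit ball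
and to orthonormal coordinates with first axis along z, one has 1/sin θ ≤ (x₁² + x₂²)^{-1/2} ≤ |x₁
x₂|^{-1/2}, which is a product of integrable functions of one variable. The bound does not depend on
z because the frame is adapted to z. -/
lemma exists_sphere_sin_bound : ∃ S : ℝ, 0 ≤ S ∧ ∀ z : E3,
    ∫⁻ ω : S2, (ENNReal.ofReal (Real.sin (InnerProductGeometry.angle z ω)))⁻¹ ∂sphereMeasure ≤
      ENNReal.ofReal S := by
  set I : ℝ := ∫ y : Fin 3 → ℝ, ∏ i, halfSing (y i)
  have hprod : Integrable (fun y : Fin 3 → ℝ => ∏ i, halfSing (y i)) :=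
    Integrable.fintype_prod (f := fun _ => halfSing) fun _ => integrable_halfSing
  have hnn : ∀ t, 0 ≤ halfSing t := fun t => indicator_nonneg (fun t _ => by positivity) t
  have hI : 0 ≤ I := integral_nonneg fun y => Finset.prod_nonneg fun i _ => hnn _
  refine ⟨sphereMeasure.real univ + 3 * I, by positivity, fun z => ?_⟩
  -- The angle with the zero vector is π/2 by convention, so the integrand is 1.
  rcases eq_or_ne z 0 with rfl | hz
  · simp only [InnerProductGeometry.angle_zero_left, Real.sin_pi_div_two, ENNReal.ofReal_one,
      inv_one, lintegral_one]
    rw [← ENNReal.ofReal_toReal (measure_ne_top sphereMeasure univ)]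
    exact ENNReal.ofReal_le_ofReal (le_add_of_nonneg_right (by positivity))
  set k : E3 → ℝ≥0∞ := fun x => (ENNReal.ofReal (Real.sin (InnerProductGeometry.angle z x)))⁻¹
  have hk : Measurable k := by
    have h1 : Measurable fun x : E3 => InnerProductGeometry.angle z x := by
      unfold InnerProductGeometry.angle
      fun_prop
    exact (ENNReal.measurable_ofReal.comp (Real.measurable_sin.comp h1)).inv
  have hball := lintegral_sphere_eq_ball hk (fun r hr x => by
    simp only [k, InnerProductGeometry.angle_smul_right_of_pos _ _ hr])
  -- an orthonormal basis adapted to `z`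
  obtain ⟨bs, hbs⟩ := Orthonormal.exists_orthonormalBasis_extension_of_card_eq (𝕜 := ℝ) (E := E3)
    (ι := Fin 3) (by simp) (v := fun _ => ‖z‖⁻¹ • z) (s := {0}) (by
      constructor
      · rintro ⟨i, hi⟩
        simp [Set.domRestrict, norm_smul, hz]
      · rintro ⟨i, hi⟩ ⟨j, hj⟩ hij
        exact absurd (Subtype.ext (hi.trans hj.symm)) hij)
  have hb0 : bs 0 = ‖z‖⁻¹ • z := hbs 0 rfl
  have hmp : MeasurePreserving (fun x : E3 => (WithLp.ofLp (bs.repr x) : Fin 3 → ℝ)) :=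
    (PiLp.volume_preserving_ofLp (Fin 3)).comp bs.measurePreserving_repr
  have hne : ∀ᵐ x : E3, ∀ i, bs.repr x i ≠ 0 := by
    have : ∀ᵐ y : Fin 3 → ℝ, ∀ i, y i ≠ 0 := by
      rw [ae_all_iff]
      intro i
      rw [ae_iff]
      simp only [not_not]
      exact Measure.pi_hyperplane (fun _ : Fin 3 => (volume : Measure ℝ)) i 0
    exact hmp.quasiMeasurePreserving.ae this
  have hmain : ∫⁻ x in Metric.ball (0 : E3) 1, k x ≤ ENNReal.ofReal I := by
    have hle : ∫⁻ x in Metric.ball (0 : E3) 1, k x ≤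
        ∫⁻ x : E3, ENNReal.ofReal (∏ i, halfSing (bs.repr x i)) := by
      rw [← lintegral_indicator measurableSet_ball]
      apply lintegral_mono_ae
      filter_upwards [hne] with x hx
      by_cases hxb : x ∈ Metric.ball (0 : E3) 1
      · rw [indicator_of_mem hxb]
        have hxn : ‖x‖ < 1 := by simpa using hxb
        have hsq : ‖x‖ ^ 2 = bs.repr x 0 ^ 2 + bs.repr x 1 ^ 2 + bs.repr x 2 ^ 2 := by
          rw [← bs.repr.norm_map x, EuclideanSpace.norm_sq_eq]
          simp [Fin.sum_univ_three]
        have hx0 : x ≠ 0 := by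
          rintro rfl
          exact hx 0 (by simp)
        have hzpos : 0 < ‖z‖ := norm_pos_iff.2 hz
        have hxpos : 0 < ‖x‖ := norm_pos_iff.2 hx0
        have hin : inner ℝ z x = ‖z‖ * bs.repr x 0 := by
          rw [bs.repr_apply_apply, hb0, inner_smul_left]
          simp only [map_inv₀, conj_trivial]
          field_simp
        have hsin : Real.sin (InnerProductGeometry.angle z x) * ‖x‖ =
            √(bs.repr x 1 ^ 2 + bs.repr x 2 ^ 2) := by
          have h1 := InnerProductGeometry.sin_angle_mul_norm_mul_norm z x
          have h2 : inner ℝ z z * inner ℝ x x - inner ℝ z x * inner ℝ z x =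
              ‖z‖ ^ 2 * (bs.repr x 1 ^ 2 + bs.repr x 2 ^ 2) := by
            rw [hin, real_inner_self_eq_norm_sq, real_inner_self_eq_norm_sq, hsq]; ring
          rw [h2, Real.sqrt_mul (by positivity), Real.sqrt_sq hzpos.le] at h1
          have h3 : ‖z‖ * (Real.sin (InnerProductGeometry.angle z x) * ‖x‖) =
            ‖z‖ * √(bs.repr x 1 ^ 2 + bs.repr x 2 ^ 2) := by rw [← h1]; ring
          exact mul_left_cancel₀ hzpos.ne' h3
        have hcoord : ∀ i, |bs.repr x i| < 1 := by
          intro i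
          have : bs.repr x i ^ 2 ≤ ‖x‖ ^ 2 := by
            rw [hsq]
            fin_cases i <;> simp only [Fin.zero_eta, Fin.mk_one, Fin.reduceFinMk] <;>
              nlinarith [sq_nonneg (bs.repr x 0), sq_nonneg (bs.repr x 1),
              sq_nonneg (bs.repr x 2)]
          exact (abs_le_of_sq_le_sq' this hxpos.le |> abs_le.2).trans_lt hxn
        have hs : ∀ i, halfSing (bs.repr x i) = |bs.repr x i| ^ (-(1 / 2) : ℝ) := by
          intro i
          rw [halfSing, indicator_of_mem]
          exact abs_lt.1 (hcoord i)
        have hp : ∀ i, 0 < |bs.repr x i| := fun i => abs_pos.2 (hx i)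
        simp only [hs, Fin.prod_univ_three]
        -- Inside the unit ball this factor is at least one; inserting it gives a product over all
        -- three coordinates.
        have h0 : 1 ≤ |bs.repr x 0| ^ (-(1 / 2) : ℝ) :=
          Real.one_le_rpow_of_pos_of_le_one_of_nonpos (hp 0) (hcoord 0).le (by norm_num)
        have hprod2 : |bs.repr x 1| ^ (-(1 / 2) : ℝ) * |bs.repr x 2| ^ (-(1 / 2) : ℝ) =
            (√(|bs.repr x 1| * |bs.repr x 2|))⁻¹ := by
          rw [← Real.mul_rpow (hp 1).le (hp 2).le, Real.rpow_neg (by positivity),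
            Real.sqrt_eq_rpow]
        have hlast : (Real.sin (InnerProductGeometry.angle z x))⁻¹ ≤
            (√(|bs.repr x 1| * |bs.repr x 2|))⁻¹ := by
          have hpos : 0 < |bs.repr x 1| * |bs.repr x 2| := mul_pos (hp 1) (hp 2)
          apply inv_anti₀ (Real.sqrt_pos.2 hpos)
          have h1 : √(|bs.repr x 1| * |bs.repr x 2|) ≤
              √(bs.repr x 1 ^ 2 + bs.repr x 2 ^ 2) := by
            apply Real.sqrt_le_sqrt
            rw [← sq_abs (bs.repr x 1), ← sq_abs (bs.repr x 2)]
            nlinarith [sq_nonneg (|bs.repr x 1| - |bs.repr x 2|)]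
          rw [← hsin] at h1
          refine h1.trans ?_
          exact mul_le_of_le_one_right (InnerProductGeometry.sin_angle_nonneg _ _) hxn.le
        have hsinpos : 0 < Real.sin (InnerProductGeometry.angle z x) := by
          have h1 : 0 < Real.sin (InnerProductGeometry.angle z x) * ‖x‖ := by
            rw [hsin]
            have := hx 1
            positivity
          exact pos_of_mul_pos_left h1 hxpos.le
        change (ENNReal.ofReal (Real.sin (InnerProductGeometry.angle z x)))⁻¹ ≤ _
        rw [← ENNReal.ofReal_inv_of_pos hsinpos]
        refine ENNReal.ofReal_le_ofReal (hlast.trans ?_)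
        rw [mul_assoc, hprod2]
        exact le_mul_of_one_le_left (by positivity) h0
      · rw [indicator_of_notMem hxb]; exact zero_le
    refine hle.trans (le_of_eq ?_)
    have hm2 : AEMeasurable (fun y : Fin 3 → ℝ => ENNReal.ofReal (∏ i, halfSing (y i))) :=
      hprod.aestronglyMeasurable.aemeasurable.ennreal_ofReal
    have := lintegral_map' (f := fun y : Fin 3 → ℝ => ENNReal.ofReal (∏ i, halfSing (y i)))
      (g := fun x : E3 => (WithLp.ofLp (bs.repr x) : Fin 3 → ℝ)) (μ := volume)
      (by rw [hmp.map_eq]; exact hm2) hmp.measurable.aemeasurable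
    rw [hmp.map_eq] at this
    rw [← this, ← ofReal_integral_eq_lintegral_ofReal hprod
      (Eventually.of_forall fun y => Finset.prod_nonneg fun i _ => hnn _)]
  have h5 := hball.trans hmain
  calc ∫⁻ ω : S2, (ENNReal.ofReal (Real.sin (InnerProductGeometry.angle z ω)))⁻¹ ∂sphereMeasure
      = (∫⁻ ω : S2, k ω ∂sphereMeasure) * ENNReal.ofReal (1 / 3) * ENNReal.ofReal 3 := by
        rw [mul_assoc, ← ENNReal.ofReal_mul (by norm_num)]
        simp [k]
    _ ≤ ENNReal.ofReal I * ENNReal.ofReal 3 := by gcongr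
    _ = ENNReal.ofReal (3 * I) := by rw [← ENNReal.ofReal_mul hI, mul_comm]
    _ ≤ _ := ENNReal.ofReal_le_ofReal (le_add_of_nonneg_left measureReal_nonneg)

/-! ### The collision map -/

lemma inner_sphere_self (ω : S2) : inner ℝ (ω : E3) (ω : E3) = 1 := by
  rw [real_inner_self_eq_norm_sq, norm_eq_of_mem_sphere]; norm_num

lemma post_sub (v u : E3) (ω : S2) :
    inner ℝ (uPost v u ω - vPost v u ω) (ω : E3) = -inner ℝ (u - v) (ω : E3) := by
  simp only [uPost, vPost, inner_sub_left, inner_add_left, inner_smul_left, inner_sphere_self,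
    conj_trivial]
  ring

lemma vPost_post (v u : E3) (ω : S2) : vPost (vPost v u ω) (uPost v u ω) (-ω) = v := by
  have h := post_sub v u ω
  unfold vPost at h ⊢
  rw [show ((-ω : S2) : E3) = -(ω : E3) from rfl, inner_neg_right, h]
  simp

lemma uPost_post (v u : E3) (ω : S2) : uPost (vPost v u ω) (uPost v u ω) (-ω) = u := by
  have h := post_sub v u ω
  unfold uPost at h ⊢
  rw [show ((-ω : S2) : E3) = -(ω : E3) from rfl, inner_neg_right, h]
  simp

lemma vPost_swap (v u : E3) (ω : S2) : vPost u v (-ω) = uPost v u ω := by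
  unfold uPost vPost
  rw [show ((-ω : S2) : E3) = -(ω : E3) from rfl, inner_neg_right, ← neg_sub u v, inner_neg_left]
  simp [sub_eq_add_neg]

lemma uPost_swap (v u : E3) (ω : S2) : uPost u v (-ω) = vPost v u ω := by
  unfold uPost vPost
  rw [show ((-ω : S2) : E3) = -(ω : E3) from rfl, inner_neg_right, ← neg_sub u v, inner_neg_left]
  simp [sub_eq_add_neg]

lemma vPost_add_uPost (v u : E3) (ω : S2) : vPost v u ω + uPost v u ω = v + u := by
  unfold uPost vPost; abel

lemma norm_sq_post (v u : E3) (ω : S2) :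
    ‖vPost v u ω‖ ^ 2 + ‖uPost v u ω‖ ^ 2 = ‖v‖ ^ 2 + ‖u‖ ^ 2 := by
  simp only [← real_inner_self_eq_norm_sq, vPost, uPost, inner_add_left, inner_add_right,
    inner_sub_left, inner_sub_right, inner_smul_left, inner_smul_right, inner_sphere_self,
    conj_trivial, real_inner_comm (ω : E3)]
  ring

lemma measurable_vPost : Measurable fun p : S2 × E3 × E3 => vPost p.2.1 p.2.2 p.1 := by
  unfold vPost
  have : Measurable fun p : S2 × E3 × E3 => (p.1 : E3) := measurable_subtype_coe.comp measurable_fst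
  fun_prop

lemma measurable_uPost : Measurable fun p : S2 × E3 × E3 => uPost p.2.1 p.2.2 p.1 := by
  unfold uPost
  have : Measurable fun p : S2 × E3 × E3 => (p.1 : E3) := measurable_subtype_coe.comp measurable_fst
  fun_prop

/-- The collision with fixed `ω`, as a linear map. -/
def collisionLin (ω : S2) : E3 × E3 →ₗ[ℝ] E3 × E3 where
  toFun p := (vPost p.1 p.2 ω, uPost p.1 p.2 ω)
  map_add' p q := by
    ext1
    · simp only [vPost, Prod.fst_add, Prod.snd_add, add_sub_add_comm, inner_add_left, add_smul]
      abel
    · simp only [uPost, Prod.fst_add, Prod.snd_add, add_sub_add_comm, inner_add_left, add_smul]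
  map_smul' c p := by
    have h : inner ℝ (c • p.2 - c • p.1) (ω : E3) = c * inner ℝ (p.2 - p.1) (ω : E3) := by
      rw [← smul_sub, inner_smul_left, conj_trivial]
    ext1 <;> simp only [vPost, uPost, Prod.smul_fst, Prod.smul_snd, h, mul_smul, smul_add, smul_sub,
      RingHom.id_apply]

lemma vPost_neg (v u : E3) (ω : S2) : vPost v u (-ω) = vPost v u ω := by
  unfold vPost
  rw [show ((-ω : S2) : E3) = -(ω : E3) from rfl, inner_neg_right]; simp

lemma uPost_neg (v u : E3) (ω : S2) : uPost v u (-ω) = uPost v u ω := by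
  unfold uPost
  rw [show ((-ω : S2) : E3) = -(ω : E3) from rfl, inner_neg_right]; simp

/-- For fixed ω the collision is a linear involution, so its determinant is ±1. -/
lemma map_collisionLin (ω : S2) :
    Measure.map (fun p : E3 × E3 => (vPost p.1 p.2 ω, uPost p.1 p.2 ω)) volume = volume := by
  have hinv : (collisionLin ω) ∘ₗ (collisionLin ω) = LinearMap.id := by
    refine LinearMap.ext fun p => Prod.ext ?_ ?_
    · have := vPost_post p.1 p.2 ω
      rw [vPost_neg] at this
      exact this
    · have := uPost_post p.1 p.2 ω
      rw [uPost_neg] at this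
      exact this
  have hdet : LinearMap.det (collisionLin ω) * LinearMap.det (collisionLin ω) = 1 := by
    rw [← LinearMap.det_comp, hinv, LinearMap.det_id]
  have hne : LinearMap.det (collisionLin ω) ≠ 0 := by
    intro h; rw [h] at hdet; simp at hdet
  have habs : |(LinearMap.det (collisionLin ω))⁻¹| = 1 := by
    rcases mul_self_eq_one_iff.1 hdet with h | h <;> simp [h]
  have := Measure.map_linearMap_addHaar_eq_smul_addHaar (volume : Measure (E3 × E3)) hne
  rw [habs, ENNReal.ofReal_one, one_smul] at this
  exact this

/-- The measure `dω dv du`. -/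
def collisionMeasure : Measure (S2 × E3 × E3) := sphereMeasure.prod volume

/-- The pre/post-collisional involution `(ω, v, u) ↦ (-ω, v', u')`. -/
def preToPost (q : S2 × E3 × E3) : S2 × E3 × E3 :=
  (-q.1, vPost q.2.1 q.2.2 q.1, uPost q.2.1 q.2.2 q.1)

/-- The exchange of the two particles, `(ω, v, u) ↦ (-ω, u, v)`. -/
def exchange (q : S2 × E3 × E3) : S2 × E3 × E3 := (-q.1, q.2.2, q.2.1)

lemma measurePreserving_preToPost :
    MeasurePreserving preToPost collisionMeasure collisionMeasure :=
  measurePreserving_neg_sphere.skew_product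
    (g := fun ω (p : E3 × E3) => (vPost p.1 p.2 ω, uPost p.1 p.2 ω))
    (measurable_vPost.prodMk measurable_uPost) (Eventually.of_forall fun ω => map_collisionLin ω)

lemma measurePreserving_exchange :
    MeasurePreserving exchange collisionMeasure collisionMeasure :=
  measurePreserving_neg_sphere.prod
    (Measure.measurePreserving_swap (μ := (volume : Measure E3)) (ν := (volume : Measure E3)))

/-- The measure `du dω`. -/
def partnerMeasure : Measure (E3 × S2) := (volume : Measure E3).prod sphereMeasure

instance : SFinite partnerMeasure := by unfold partnerMeasure; infer_instance

lemma measurePreserving_regroup :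
    MeasurePreserving (fun q : S2 × E3 × E3 => (q.2.1, (q.2.2, q.1))) collisionMeasure
      ((volume : Measure E3).prod partnerMeasure) := by
  have h1 := Measure.measurePreserving_swap (μ := sphereMeasure) (ν := (volume : Measure (E3 × E3)))
  have h2 := measurePreserving_prodAssoc (volume : Measure E3) (volume : Measure E3) sphereMeasure
  exact h2.comp h1

/-! ### The collision kernel -/

/-- The assumptions on the collision kernel. -/
structure AdmissibleKernel (γ : ℝ) (b : ℝ → ℝ) (Cb : ℝ) : Prop where
  exp_nonneg : 0 ≤ γ
  exp_le_one : γ ≤ 1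
  measurable : Measurable b
  bound : ∀ θ ∈ Icc 0 Real.pi, 0 ≤ b θ ∧ b θ ≤ Cb * |Real.cos θ|

/-- The square root of the Maxwellian. -/
def sqrtMax (u : E3) : ℝ := √(maxwellian u)

lemma sqrtMax_eq (u : E3) : sqrtMax u = Real.exp (-(‖u‖ ^ 2 / 4)) := by
  rw [sqrtMax, maxwellian, ← Real.exp_half]
  congr 1; ring

lemma sqrtMax_pos (u : E3) : 0 < sqrtMax u := by rw [sqrtMax_eq]; positivity

lemma sqrtMax_mul_self (u : E3) : sqrtMax u * sqrtMax u = maxwellian u :=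
  Real.mul_self_sqrt (Real.exp_pos _).le

lemma continuous_sqrtMax : Continuous sqrtMax := by
  have : sqrtMax = fun u => Real.exp (-(‖u‖ ^ 2 / 4)) := funext sqrtMax_eq
  rw [this]; fun_prop

lemma measurable_sqrtMax : Measurable sqrtMax := continuous_sqrtMax.measurable

lemma sqrtMax_post (v u : E3) (ω : S2) :
    sqrtMax (uPost v u ω) * sqrtMax (vPost v u ω) = sqrtMax u * sqrtMax v := by
  have := norm_sq_post v u ω
  simp only [sqrtMax_eq, ← Real.exp_add]
  congr 1; linarith

section Kernel

variable {γ : ℝ} {b : ℝ → ℝ} {Cb : ℝ} (hk : AdmissibleKernel γ b Cb)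

include hk

lemma AdmissibleKernel.nonneg (z : E3) (ω : S2) : 0 ≤ collisionKernel γ b z ω :=
  mul_nonneg (by positivity) (hk.bound _ ⟨InnerProductGeometry.angle_nonneg _ _,
    InnerProductGeometry.angle_le_pi _ _⟩).1

lemma AdmissibleKernel.le (z : E3) (ω : S2) : collisionKernel γ b z ω ≤
    |Cb| * ((1 + ‖z‖) * |Real.cos (InnerProductGeometry.angle z (ω : E3))|) := by
  have h1 := (hk.bound _ ⟨InnerProductGeometry.angle_nonneg z (ω : E3),
    InnerProductGeometry.angle_le_pi _ _⟩)
  have h2 : ‖z‖ ^ γ ≤ 1 + ‖z‖ := by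
    rcases le_total ‖z‖ 1 with h | h
    · have := Real.rpow_le_one (norm_nonneg z) h hk.exp_nonneg
      linarith [norm_nonneg z]
    · have := Real.rpow_le_rpow_of_exponent_le h hk.exp_le_one
      rw [Real.rpow_one] at this
      linarith
  have h3 : b (InnerProductGeometry.angle z (ω : E3)) ≤
      |Cb| * |Real.cos (InnerProductGeometry.angle z (ω : E3))| :=
    h1.2.trans (mul_le_mul_of_nonneg_right (le_abs_self _) (abs_nonneg _))
  calc collisionKernel γ b z ω ≤ (1 + ‖z‖) *
        (|Cb| * |Real.cos (InnerProductGeometry.angle z (ω : E3))|) :=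
        mul_le_mul h2 h3 h1.1 (by positivity)
    _ = _ := by ring

lemma AdmissibleKernel.le' (z : E3) (ω : S2) :
    collisionKernel γ b z ω ≤ |Cb| * (1 + ‖z‖) := by
  refine (hk.le z ω).trans ?_
  gcongr
  exact mul_le_of_le_one_right (by positivity) (Real.abs_cos_le_one _)

lemma AdmissibleKernel.measurable_kernel :
    Measurable fun p : E3 × S2 => collisionKernel γ b p.1 p.2 := by
  unfold collisionKernel InnerProductGeometry.angle
  have h2 : Measurable fun p : E3 × S2 => (p.2 : E3) := measurable_subtype_coe.comp measurable_snd
  have := hk.measurable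
  fun_prop

-- The velocities v', u' are even in ω, but b need not be symmetric under θ ↦ π - θ. Since (v' -
-- u')·ω = -(v - u)·ω, replacing ω by -ω keeps the angle itself.
omit hk in
lemma collisionKernel_post (v u : E3) (ω : S2) :
    collisionKernel γ b (vPost v u ω - uPost v u ω) (-ω) = collisionKernel γ b (v - u) ω := by
  have h1 : ‖vPost v u ω - uPost v u ω‖ = ‖v - u‖ := by
    have h2 := norm_sq_post v u ω
    have h3 := congrArg (fun y => ‖y‖ ^ 2) (vPost_add_uPost v u ω)
    have h4 := parallelogram_law_with_norm ℝ (vPost v u ω) (uPost v u ω)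
    have h5 := parallelogram_law_with_norm ℝ v u
    have : ‖vPost v u ω - uPost v u ω‖ ^ 2 = ‖v - u‖ ^ 2 := by nlinarith
    exact (sq_eq_sq₀ (norm_nonneg _) (norm_nonneg _)).1 this
  have h2 : inner ℝ (vPost v u ω - uPost v u ω) ((-ω : S2) : E3) = inner ℝ (v - u) (ω : E3) := by
    have h := post_sub v u ω
    rw [show ((-ω : S2) : E3) = -(ω : E3) from rfl, inner_neg_right, ← neg_sub (uPost v u ω),
      inner_neg_left, h, ← inner_neg_left, neg_sub, neg_neg]
  unfold collisionKernel InnerProductGeometry.angle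
  rw [h1, h2, show ((-ω : S2) : E3) = -(ω : E3) from rfl, norm_neg]

omit hk in
lemma collisionKernel_swap (v u : E3) (ω : S2) :
    collisionKernel γ b (u - v) (-ω) = collisionKernel γ b (v - u) ω := by
  unfold collisionKernel
  rw [show ((-ω : S2) : E3) = -(ω : E3) from rfl, ← neg_sub v u, norm_neg,
    InnerProductGeometry.angle_neg_neg]

/-! ### Gain and loss operators -/

/-- The kernel `B(v - u, ω) √μ(u)`. -/
def weightedKernel (γ : ℝ) (b : ℝ → ℝ) (v : E3) (p : E3 × S2) : ℝ :=
  collisionKernel γ b (v - p.1) p.2 * sqrtMax p.1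

/-- The normalized gain operator. -/
def gainOp (γ : ℝ) (b : ℝ → ℝ) (f g : E3 → ℝ) (v : E3) : ℝ :=
  ∫ p, weightedKernel γ b v p * (f (uPost v p.1 p.2) * g (vPost v p.1 p.2)) ∂partnerMeasure

/-- The normalized loss rate. -/
def lossOp (γ : ℝ) (b : ℝ → ℝ) (f : E3 → ℝ) (v : E3) : ℝ :=
  ∫ p, weightedKernel γ b v p * f p.1 ∂partnerMeasure

lemma weightedKernel_nonneg (v : E3) (p : E3 × S2) : 0 ≤ weightedKernel γ b v p :=
  mul_nonneg (hk.nonneg _ _) (sqrtMax_pos _).le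

lemma measurable_weightedKernel :
    Measurable fun q : E3 × (E3 × S2) => weightedKernel γ b q.1 q.2 := by
  have h1 : Measurable fun q : E3 × (E3 × S2) => collisionKernel γ b (q.1 - q.2.1) q.2.2 :=
    hk.measurable_kernel.comp (g := fun p : E3 × S2 => collisionKernel γ b p.1 p.2)
      (f := fun q : E3 × (E3 × S2) => (q.1 - q.2.1, q.2.2))
      ((measurable_fst.sub (measurable_fst.comp measurable_snd)).prodMk
        (measurable_snd.comp measurable_snd))
  exact h1.mul (measurable_sqrtMax.comp (measurable_fst.comp measurable_snd))

lemma measurable_weightedKernel_right (v : E3) : Measurable (weightedKernel γ b v) :=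
  (measurable_weightedKernel hk).comp (g := fun q : E3 × (E3 × S2) => weightedKernel γ b q.1 q.2)
    (f := fun p => (v, p)) (measurable_const.prodMk measurable_id)

omit hk in
lemma measurable_vPost' : Measurable fun q : E3 × (E3 × S2) => vPost q.1 q.2.1 q.2.2 :=
  measurable_vPost.comp (g := fun p : S2 × E3 × E3 => vPost p.2.1 p.2.2 p.1)
    (f := fun q : E3 × (E3 × S2) => (q.2.2, (q.1, q.2.1)))
    ((measurable_snd.comp measurable_snd).prodMk
      (measurable_fst.prodMk (measurable_fst.comp measurable_snd)))

omit hk in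
lemma measurable_uPost' : Measurable fun q : E3 × (E3 × S2) => uPost q.1 q.2.1 q.2.2 :=
  measurable_uPost.comp (g := fun p : S2 × E3 × E3 => uPost p.2.1 p.2.2 p.1)
    (f := fun q : E3 × (E3 × S2) => (q.2.2, (q.1, q.2.1)))
    ((measurable_snd.comp measurable_snd).prodMk
      (measurable_fst.prodMk (measurable_fst.comp measurable_snd)))

lemma measurable_gainOp {P : Type*} [MeasurableSpace P] {f g : P → E3 → ℝ}
    (hf : Measurable fun q : P × E3 => f q.1 q.2) (hg : Measurable fun q : P × E3 => g q.1 q.2) :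
    Measurable fun q : P × E3 => gainOp γ b (f q.1) (g q.1) q.2 := by
  have h1 : Measurable fun q : (P × E3) × (E3 × S2) => (q.1.2, q.2) :=
    (measurable_snd.comp measurable_fst).prodMk measurable_snd
  have hp : Measurable fun q : (P × E3) × (E3 × S2) => q.1.1 := measurable_fst.comp measurable_fst
  refine (StronglyMeasurable.integral_prod_right (ν := partnerMeasure)
    (f := fun (q : P × E3) (p : E3 × S2) => weightedKernel γ b q.2 p *
      (f q.1 (uPost q.2 p.1 p.2) * g q.1 (vPost q.2 p.1 p.2))) ?_).measurable
  refine Measurable.stronglyMeasurable ?_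
  exact ((measurable_weightedKernel hk).comp h1).mul
    ((hf.comp (hp.prodMk (measurable_uPost'.comp h1))).mul
      (hg.comp (hp.prodMk (measurable_vPost'.comp h1))))

lemma measurable_lossOp {P : Type*} [MeasurableSpace P] {f : P → E3 → ℝ}
    (hf : Measurable fun q : P × E3 => f q.1 q.2) :
    Measurable fun q : P × E3 => lossOp γ b (f q.1) q.2 := by
  have h1 : Measurable fun q : (P × E3) × (E3 × S2) => (q.1.2, q.2) :=
    (measurable_snd.comp measurable_fst).prodMk measurable_snd
  have hp : Measurable fun q : (P × E3) × (E3 × S2) => q.1.1 := measurable_fst.comp measurable_fst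
  refine (StronglyMeasurable.integral_prod_right (ν := partnerMeasure)
    (f := fun (q : P × E3) (p : E3 × S2) => weightedKernel γ b q.2 p * f q.1 p.1) ?_).measurable
  refine Measurable.stronglyMeasurable ?_
  exact ((measurable_weightedKernel hk).comp h1).mul
    (hf.comp (hp.prodMk (measurable_fst.comp measurable_snd)))

end Kernel

/-! ### Majorants -/

/-- The p-th power of the inequality y ≤ exp y at y = e/(4p). -/
lemma rpow_le_exp {p e : ℝ} (hp : 0 < p) (he : 0 ≤ e) :
    e ^ p ≤ (4 * p) ^ p * Real.exp (e / 4) := by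
  have h1 : e / (4 * p) ≤ Real.exp (e / (4 * p)) := by
    linarith [Real.add_one_le_exp (e / (4 * p))]
  have h2 : (e / (4 * p)) ^ p ≤ Real.exp (e / (4 * p)) ^ p :=
    Real.rpow_le_rpow (by positivity) h1 hp.le
  rw [Real.div_rpow he (by positivity), ← Real.exp_mul, div_le_iff₀ (by positivity)] at h2
  have h3 : e / (4 * p) * p = e / 4 := by field_simp
  rw [h3] at h2
  linarith

lemma integrable_exp_neg_mul_norm_sq {c : ℝ} (hc : 0 < c) :
    Integrable fun u : E3 => Real.exp (-(c * ‖u‖ ^ 2)) := by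
  have h := (GaussianFourier.integrable_cexp_neg_mul_sq_norm_add (V := E3) (b := (c : ℂ))
    (by simpa using hc) 0 0).norm
  refine h.congr (Eventually.of_forall fun u => ?_)
  simp only [inner_zero_left, Complex.ofReal_zero, mul_zero, add_zero, Complex.norm_exp]
  congr 1
  have : (-(c : ℂ) * (‖u‖ : ℂ) ^ 2) = ((-(c * ‖u‖ ^ 2) : ℝ) : ℂ) := by push_cast; ring
  rw [this, Complex.ofReal_re]

lemma norm_le_exp (u : E3) : ‖u‖ ≤ 4 * Real.exp (‖u‖ ^ 2 / 8) := by
  have h1 := Real.add_one_le_exp (‖u‖ ^ 2 / 8)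
  nlinarith [sq_nonneg (‖u‖ - 4), norm_nonneg u]

lemma integrable_affine_mul_sqrtMax (c : ℝ) : Integrable fun u : E3 => (c + ‖u‖) * sqrtMax u := by
  have h1 : Integrable fun u : E3 => (|c| + 4) * Real.exp (-((1 / 8) * ‖u‖ ^ 2)) :=
    (integrable_exp_neg_mul_norm_sq (by norm_num)).const_mul _
  refine h1.mono' (by
    exact ((continuous_const.add continuous_norm).mul continuous_sqrtMax).aestronglyMeasurable)
    (Eventually.of_forall fun u => ?_)
  rw [Real.norm_eq_abs, abs_mul, abs_of_pos (sqrtMax_pos u), sqrtMax_eq]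
  have h2 : |c + ‖u‖| ≤ (|c| + 4) * Real.exp (‖u‖ ^ 2 / 8) := by
    have h3 := norm_le_exp u
    have h4 : 1 ≤ Real.exp (‖u‖ ^ 2 / 8) := Real.one_le_exp (by positivity)
    calc |c + ‖u‖| ≤ |c| + ‖u‖ := by
          simpa using abs_add_le c ‖u‖
      _ ≤ |c| * Real.exp (‖u‖ ^ 2 / 8) + 4 * Real.exp (‖u‖ ^ 2 / 8) :=
          add_le_add (le_mul_of_one_le_right (abs_nonneg c) h4) h3
      _ = _ := by ring
  calc |c + ‖u‖| * Real.exp (-(‖u‖ ^ 2 / 4)) ≤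
        (|c| + 4) * Real.exp (‖u‖ ^ 2 / 8) * Real.exp (-(‖u‖ ^ 2 / 4)) := by gcongr
    _ = _ := by rw [mul_assoc, ← Real.exp_add]; congr 2; ring

/-- The decay `(1 + |y|²/2)^{-1/2}`. -/
def halfDecay (y : E3) : ℝ := (√(1 + ‖y‖ ^ 2 / 2))⁻¹

lemma halfDecay_nonneg (y : E3) : 0 ≤ halfDecay y := by unfold halfDecay; positivity

lemma halfDecay_le_one (y : E3) : halfDecay y ≤ 1 := by
  unfold halfDecay
  apply inv_le_one_of_one_le₀
  rw [Real.one_le_sqrt]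
  have := sq_nonneg ‖y‖
  linarith

lemma norm_mul_halfDecay_le (y : E3) : ‖y‖ * halfDecay y ≤ 2 := by
  unfold halfDecay
  have hpos : 0 < √(1 + ‖y‖ ^ 2 / 2) := by positivity
  rw [← div_eq_mul_inv, div_le_iff₀ hpos]
  have : ‖y‖ / 2 ≤ √(1 + ‖y‖ ^ 2 / 2) := by
    apply Real.le_sqrt_of_sq_le
    nlinarith [sq_nonneg ‖y‖]
  linarith

lemma measurable_halfDecay : Measurable halfDecay := by
  unfold halfDecay; fun_prop

/-- Existence of a uniform majorant for the gain operator. -/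
lemma exists_gain_majorant (Cb : ℝ) : ∃ C : ℝ, 0 ≤ C ∧ ∀ (γ : ℝ) (b : ℝ → ℝ),
    AdmissibleKernel γ b Cb → ∀ v : E3,
      Integrable (fun p : E3 × S2 => weightedKernel γ b v p *
        (halfDecay (uPost v p.1 p.2) + halfDecay (vPost v p.1 p.2))) partnerMeasure ∧
      ∫ p, weightedKernel γ b v p *
        (halfDecay (uPost v p.1 p.2) + halfDecay (vPost v p.1 p.2)) ∂partnerMeasure ≤ C := by
  obtain ⟨S, hS0, hS⟩ := exists_sphere_sin_bound
  set c : E3 → ℝ := fun u => (|Cb| + 1) * ((4 + ‖u‖) * sqrtMax u) with hc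
  have hcint : Integrable c := (integrable_affine_mul_sqrtMax 4).const_mul _
  have hcpos : ∀ u, 0 < c u := fun u => by
    have := sqrtMax_pos u
    simp only [hc]; positivity
  set C : ℝ := (∫ u, c u) * (sphereMeasure.real univ + S) with hC
  have hC0 : 0 ≤ C := mul_nonneg (integral_nonneg fun u => (hcpos u).le)
    (add_nonneg measureReal_nonneg hS0)
  refine ⟨C, hC0, fun γ b hk v => ?_⟩
  set F : E3 × S2 → ℝ := fun p => weightedKernel γ b v p *
    (halfDecay (uPost v p.1 p.2) + halfDecay (vPost v p.1 p.2)) with hF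
  have hFm : Measurable F := by
    have h1 : Measurable fun p : E3 × S2 => (v, p) := measurable_const.prodMk measurable_id
    exact (measurable_weightedKernel_right hk v).mul
      ((measurable_halfDecay.comp (measurable_uPost'.comp h1)).add
        (measurable_halfDecay.comp (measurable_vPost'.comp h1)))
  have hF0 : ∀ p, 0 ≤ F p := fun p => mul_nonneg (weightedKernel_nonneg hk v p)
    (add_nonneg (halfDecay_nonneg _) (halfDecay_nonneg _))
  -- The majorant depends on v only through the direction of v - u, and the integral of 1/sin θ over
  -- the sphere is bounded independently of that direction.
  have hpt : ∀ (u : E3) (ω : S2), ENNReal.ofReal (F (u, ω)) ≤ ENNReal.ofReal (c u) *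
      (1 + (ENNReal.ofReal (Real.sin (InnerProductGeometry.angle (v - u) (ω : E3))))⁻¹) := by
    intro u ω
    set z : E3 := v - u with hz
    set s : ℝ := Real.sin (InnerProductGeometry.angle z (ω : E3)) with hs
    have hs0 : 0 ≤ s := InnerProductGeometry.sin_angle_nonneg _ _
    -- If sin θ = 0 the right side is infinite, since c u > 0; the `+ 1` in the definition of c
    -- ensures this even when Cb = 0.
    rcases hs0.eq_or_lt with h0 | hspos
    · rw [← h0]
      simp only [ENNReal.ofReal_zero, ENNReal.inv_zero, add_top]
      rw [ENNReal.mul_top (by simpa using hcpos u)]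
      exact le_top
    rw [← ENNReal.ofReal_inv_of_pos hspos, ← ENNReal.ofReal_one,
      ← ENNReal.ofReal_add zero_le_one (by positivity), ← ENNReal.ofReal_mul (hcpos u).le]
    apply ENNReal.ofReal_le_ofReal
    have hω : ‖(ω : E3)‖ = 1 := norm_eq_of_mem_sphere ω
    have hcos : Real.cos (InnerProductGeometry.angle z (ω : E3)) * ‖z‖ = inner ℝ z (ω : E3) := by
      have := InnerProductGeometry.cos_angle_mul_norm_mul_norm z (ω : E3)
      rwa [hω, mul_one] at this
    have hin : inner ℝ (u - v) (ω : E3) = -inner ℝ z (ω : E3) := by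
      rw [← inner_neg_left, hz, neg_sub]
    have hu' : |inner ℝ z (ω : E3)| ≤ ‖u‖ + ‖uPost v u ω‖ := by
      have h1 : (inner ℝ z (ω : E3)) • (ω : E3) = uPost v u ω - u := by
        rw [uPost, hin]; simp
      have h2 : |inner ℝ z (ω : E3)| = ‖uPost v u ω - u‖ := by
        rw [← h1, norm_smul, hω, mul_one, Real.norm_eq_abs]
      rw [h2]
      linarith [norm_sub_le (uPost v u ω) u]
    have hv' : ‖z‖ * s ≤ ‖u‖ + ‖vPost v u ω‖ := by
      have h1 : vPost v u ω - u = z - (inner ℝ z (ω : E3)) • (ω : E3) := by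
        rw [vPost, hin, hz]; simp; abel
      have h2 : ‖z - (inner ℝ z (ω : E3)) • (ω : E3)‖ = ‖z‖ * s := by
        have h3 := InnerProductGeometry.sin_angle_mul_norm_mul_norm z (ω : E3)
        rw [hω, mul_one, inner_sphere_self, mul_one, ← hs] at h3
        rw [mul_comm, h3, ← Real.sqrt_sq (norm_nonneg (z - _)), ← real_inner_self_eq_norm_sq]
        congr 1
        simp only [inner_sub_left, inner_sub_right, inner_smul_left, inner_smul_right,
          inner_sphere_self, conj_trivial, real_inner_comm (ω : E3)]
        ring
      rw [← h2, ← h1]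
      linarith [norm_sub_le (vPost v u ω) u]
    have hB := hk.le z ω
    set κ : ℝ := |Real.cos (InnerProductGeometry.angle z (ω : E3))| with hκ
    have hκ0 : 0 ≤ κ := abs_nonneg _
    have hκ1 : κ ≤ 1 := Real.abs_cos_le_one _
    have hκz : κ * ‖z‖ = |inner ℝ z (ω : E3)| := by rw [← hcos, abs_mul, abs_norm]
    -- Here the factor |cos θ| matters: |z||cos θ| = |u' - u| ≤ |u| + |u'|, and the decay in u'
    -- absorbs |u'|.
    have t1 : (1 + ‖z‖) * κ * halfDecay (uPost v u ω) ≤ 3 + ‖u‖ := by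
      have h1 := norm_mul_halfDecay_le (uPost v u ω)
      have h2 := halfDecay_le_one (uPost v u ω)
      have h3 := halfDecay_nonneg (uPost v u ω)
      calc (1 + ‖z‖) * κ * halfDecay (uPost v u ω) = (κ + κ * ‖z‖) * halfDecay (uPost v u ω) := by
            ring
        _ ≤ (1 + (‖u‖ + ‖uPost v u ω‖)) * halfDecay (uPost v u ω) := by
            rw [hκz]; gcongr
        _ = (1 + ‖u‖) * halfDecay (uPost v u ω) + ‖uPost v u ω‖ * halfDecay (uPost v u ω) := by ring
        _ ≤ (1 + ‖u‖) * 1 + 2 := by gcongr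
        _ = 3 + ‖u‖ := by ring
    -- The cosine does not help for v'. Instead |z| sin θ = |v' - u| ≤ |u| + |v'|, at the price of
    -- 1/sin θ.
    have t2 : (1 + ‖z‖) * κ * halfDecay (vPost v u ω) ≤ 1 + (2 + ‖u‖) * s⁻¹ := by
      have h1 := norm_mul_halfDecay_le (vPost v u ω)
      have h2 := halfDecay_le_one (vPost v u ω)
      have h3 := halfDecay_nonneg (vPost v u ω)
      have h4 : ‖z‖ ≤ (‖u‖ + ‖vPost v u ω‖) * s⁻¹ := by
        rw [← div_eq_mul_inv, le_div_iff₀ hspos]; exact hv'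
      calc (1 + ‖z‖) * κ * halfDecay (vPost v u ω) ≤ (1 + ‖z‖) * 1 * halfDecay (vPost v u ω) := by
            gcongr
        _ ≤ (1 + (‖u‖ + ‖vPost v u ω‖) * s⁻¹) * 1 * halfDecay (vPost v u ω) := by gcongr
        _ = halfDecay (vPost v u ω) + (‖u‖ * halfDecay (vPost v u ω) +
            ‖vPost v u ω‖ * halfDecay (vPost v u ω)) * s⁻¹ := by ring
        _ ≤ 1 + (‖u‖ * 1 + 2) * s⁻¹ := by gcongr
        _ = _ := by ring
    have hm := sqrtMax_pos u
    calc F (u, ω) ≤ (|Cb| * ((1 + ‖z‖) * κ)) * sqrtMax u *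
          (halfDecay (uPost v u ω) + halfDecay (vPost v u ω)) := by
          simp only [hF, weightedKernel]
          gcongr
          exact add_nonneg (halfDecay_nonneg _) (halfDecay_nonneg _)
      _ = |Cb| * sqrtMax u * ((1 + ‖z‖) * κ * halfDecay (uPost v u ω) +
          (1 + ‖z‖) * κ * halfDecay (vPost v u ω)) := by ring
      _ ≤ |Cb| * sqrtMax u * ((3 + ‖u‖) + (1 + (2 + ‖u‖) * s⁻¹)) := by gcongr
      _ ≤ (|Cb| + 1) * sqrtMax u * ((4 + ‖u‖) * (1 + s⁻¹)) := by
          have : (3 + ‖u‖) + (1 + (2 + ‖u‖) * s⁻¹) ≤ (4 + ‖u‖) * (1 + s⁻¹) := by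
            have : 0 ≤ s⁻¹ := by positivity
            nlinarith
          gcongr
          linarith
      _ = c u * (1 + s⁻¹) := by simp only [hc]; ring
  have hlin : ∫⁻ p, ENNReal.ofReal (F p) ∂partnerMeasure ≤ ENNReal.ofReal C := by
    rw [partnerMeasure, lintegral_prod _ hFm.ennreal_ofReal.aemeasurable]
    calc ∫⁻ u, ∫⁻ ω, ENNReal.ofReal (F (u, ω)) ∂sphereMeasure
        ≤ ∫⁻ u, ENNReal.ofReal (c u) * ENNReal.ofReal (sphereMeasure.real univ + S) := by
          apply lintegral_mono
          intro u
          refine (lintegral_mono (hpt u)).trans ?_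
          rw [lintegral_const_mul' _ _ ENNReal.ofReal_ne_top, lintegral_add_left measurable_const,
            lintegral_one, ENNReal.ofReal_add measureReal_nonneg hS0, ofReal_measureReal]
          exact mul_le_mul' le_rfl (add_le_add le_rfl (hS _))
      _ = ENNReal.ofReal C := by
          rw [lintegral_mul_const' _ _ ENNReal.ofReal_ne_top,
            ← ofReal_integral_eq_lintegral_ofReal hcint
              (Eventually.of_forall fun u => (hcpos u).le),
            ← ENNReal.ofReal_mul (integral_nonneg fun u => (hcpos u).le)]
  have hint : Integrable F partnerMeasure := by
    refine ⟨hFm.aestronglyMeasurable, ?_⟩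
    rw [hasFiniteIntegral_iff_ofReal (Eventually.of_forall hF0)]
    exact hlin.trans_lt ENNReal.ofReal_lt_top
  refine ⟨hint, ?_⟩
  rw [← ofReal_integral_eq_lintegral_ofReal hint (Eventually.of_forall hF0)] at hlin
  exact (ENNReal.ofReal_le_ofReal_iff hC0).1 hlin

/-- Existence of a uniform majorant for the loss operator. -/
lemma exists_loss_majorant (Cb : ℝ) : ∃ C : ℝ, 0 ≤ C ∧ ∀ (γ : ℝ) (b : ℝ → ℝ),
    AdmissibleKernel γ b Cb → ∀ v : E3,
      Integrable (weightedKernel γ b v) partnerMeasure ∧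
      ∫ p, weightedKernel γ b v p ∂partnerMeasure ≤ C * (1 + ‖v‖) := by
  set c : E3 → ℝ := fun u => |Cb| * ((1 + ‖u‖) * sqrtMax u) with hc
  have hcint : Integrable c := (integrable_affine_mul_sqrtMax 1).const_mul _
  have hc0 : ∀ u, 0 ≤ c u := fun u => by
    have := sqrtMax_pos u
    simp only [hc]; positivity
  have hcp : Integrable (fun p : E3 × S2 => c p.1) partnerMeasure :=
    hcint.comp_fst sphereMeasure
  refine ⟨∫ p : E3 × S2, c p.1 ∂partnerMeasure, integral_nonneg fun p => hc0 _, fun γ b hk v => ?_⟩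
  have hpt : ∀ p, weightedKernel γ b v p ≤ c p.1 * (1 + ‖v‖) := by
    intro p
    have h1 := hk.le' (v - p.1) p.2
    have hm := sqrtMax_pos p.1
    calc weightedKernel γ b v p ≤ |Cb| * (1 + ‖v - p.1‖) * sqrtMax p.1 := by
          unfold weightedKernel; gcongr
      _ ≤ |Cb| * ((1 + ‖p.1‖) * (1 + ‖v‖)) * sqrtMax p.1 := by
          gcongr
          have := norm_sub_le v p.1
          nlinarith [norm_nonneg v, norm_nonneg p.1, mul_nonneg (norm_nonneg v) (norm_nonneg p.1)]
      _ = _ := by simp only [hc]; ring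
  have hm := measurable_weightedKernel_right hk v
  have hint : Integrable (weightedKernel γ b v) partnerMeasure := by
    refine (hcp.mul_const (1 + ‖v‖)).mono' hm.aestronglyMeasurable
      (Eventually.of_forall fun p => ?_)
    rw [Real.norm_eq_abs, abs_of_nonneg (weightedKernel_nonneg hk v p)]
    exact hpt p
  refine ⟨hint, ?_⟩
  rw [← integral_mul_const]
  exact integral_mono hint (hcp.mul_const _) hpt

/-! ### Weighted estimates -/

/-- The shifted energy `|v|²/2 + c + 1`. -/
def en (c : ℝ) (v : E3) : ℝ := ‖v‖ ^ 2 / 2 + c + 1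

/-- The square root of the local Maxwellian at a point where the potential has the value `c`. -/
def sqrtLoc (c : ℝ) (v : E3) : ℝ := Real.exp (-((‖v‖ ^ 2 / 2 + c) / 2))

lemma sqrtLoc_eq (c : ℝ) (v : E3) : sqrtLoc c v = Real.exp (-(c / 2)) * sqrtMax v := by
  rw [sqrtLoc, sqrtMax_eq, ← Real.exp_add]; congr 1; ring

lemma sqrtLoc_pos (c : ℝ) (v : E3) : 0 < sqrtLoc c v := Real.exp_pos _

lemma measurable_sqrtLoc (c : ℝ) : Measurable (sqrtLoc c) := by
  unfold sqrtLoc; fun_prop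

lemma sqrtLoc_post (c : ℝ) (v u : E3) (ω : S2) :
    sqrtLoc c (uPost v u ω) * sqrtLoc c (vPost v u ω) = sqrtLoc c u * sqrtLoc c v := by
  have := sqrtMax_post v u ω
  simp only [sqrtLoc_eq]
  linear_combination Real.exp (-(c / 2)) ^ 2 * this

lemma en_post (c : ℝ) (v u : E3) (ω : S2) :
    en c (uPost v u ω) + en c (vPost v u ω) = en c u + en c v := by
  have := norm_sq_post v u ω
  unfold en; linarith

/-- Measurable functions of velocity with polynomial decay. -/
structure Decays (c k A : ℝ) (f : E3 → ℝ) : Prop where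
  measurable : Measurable f
  bound : ∀ v, |f v| ≤ A * en c v ^ (-(k / 2))

section Decay

variable {c : ℝ} (hc : 0 ≤ c)

include hc

lemma one_add_le_en (v : E3) : 1 + ‖v‖ ^ 2 / 2 ≤ en c v := by unfold en; linarith

lemma one_le_en (v : E3) : 1 ≤ en c v := by
  have := one_add_le_en hc v
  have := sq_nonneg ‖v‖
  linarith

lemma en_pos (v : E3) : 0 < en c v := zero_lt_one.trans_le (one_le_en hc v)

lemma en_rpow_le_one {p : ℝ} (hp : p ≤ 0) (v : E3) : en c v ^ p ≤ 1 :=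
  Real.rpow_le_one_of_one_le_of_nonpos (one_le_en hc v) hp

lemma one_add_norm_le_en (v : E3) : 1 + ‖v‖ ≤ 2 * en c v ^ (1 / 2 : ℝ) := by
  rw [← Real.sqrt_eq_rpow]
  have h1 := one_add_le_en hc v
  have : (1 + ‖v‖) / 2 ≤ √(en c v) := by
    apply Real.le_sqrt_of_sq_le
    nlinarith [sq_nonneg (‖v‖ - 1)]
  linarith

variable {k A A' : ℝ} {f g : E3 → ℝ}

lemma Decays.nonneg (hf : Decays c k A f) : 0 ≤ A := by
  have h := (abs_nonneg _).trans (hf.bound 0)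
  exact nonneg_of_mul_nonneg_left h (Real.rpow_pos_of_pos (en_pos hc 0) _)

lemma Decays.mono_exponent (hf : Decays c k A f) {k' : ℝ} (hk : k' ≤ k) : Decays c k' A f := by
  refine ⟨hf.measurable, fun v => (hf.bound v).trans ?_⟩
  have := hf.nonneg hc
  gcongr
  exact one_le_en hc v

lemma Decays.mono_const (hf : Decays c k A f) (hA : A ≤ A') : Decays c k A' f := by
  refine ⟨hf.measurable, fun v => (hf.bound v).trans ?_⟩
  have := (en_pos hc v).le
  gcongr

omit hc in
lemma Decays.add (hf : Decays c k A f) (hg : Decays c k A' g) :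
    Decays c k (A + A') (fun v => f v + g v) := by
  refine ⟨hf.measurable.add hg.measurable, fun v => (abs_add_le _ _).trans ?_⟩
  linarith [hf.bound v, hg.bound v]

omit hc in
lemma Decays.const_mul (hf : Decays c k A f) (r : ℝ) :
    Decays c k (|r| * A) (fun v => r * f v) := by
  refine ⟨hf.measurable.const_mul r, fun v => ?_⟩
  rw [abs_mul, mul_assoc]
  exact mul_le_mul_of_nonneg_left (hf.bound v) (abs_nonneg r)

omit hc in
lemma Decays.zero : Decays c k 0 (fun _ => 0) :=
  ⟨measurable_const, fun v => by simp⟩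

lemma Decays.abs_le (hf : Decays c k A f) (hk : 0 ≤ k) (v : E3) : |f v| ≤ A :=
  (hf.bound v).trans (mul_le_of_le_one_right (hf.nonneg hc) (en_rpow_le_one hc (by linarith) v))

/-- The constant in the decay of the Maxwellian. -/
def locConst (k : ℝ) : ℝ := (4 * (k / 2)) ^ (k / 2) * Real.exp (1 / 2)

lemma sqrtLoc_le_exp (v : E3) (hk : 0 < k) :
    sqrtLoc c v * en c v ^ (k / 2) ≤ locConst k * Real.exp (-(en c v / 4)) := by
  have h1 := rpow_le_exp (p := k / 2) (by positivity) (en_pos hc v).le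
  have h2 : sqrtLoc c v = Real.exp (1 / 2) * Real.exp (-(en c v / 2)) := by
    rw [sqrtLoc, en, ← Real.exp_add]; congr 1; ring
  calc sqrtLoc c v * en c v ^ (k / 2) ≤
        sqrtLoc c v * ((4 * (k / 2)) ^ (k / 2) * Real.exp (en c v / 4)) := by
        have := (sqrtLoc_pos c v).le
        gcongr
    _ = locConst k * (Real.exp (-(en c v / 2)) * Real.exp (en c v / 4)) := by
        rw [h2, locConst]; ring
    _ = _ := by rw [← Real.exp_add]; congr 2; ring

lemma sqrtLoc_decays (hk : 0 < k) : Decays c k (locConst k) (sqrtLoc c) := by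
  refine ⟨measurable_sqrtLoc c, fun v => ?_⟩
  have h1 := sqrtLoc_le_exp hc v hk
  have he := en_pos hc v
  rw [abs_of_pos (sqrtLoc_pos c v), Real.rpow_neg he.le, ← div_eq_mul_inv,
    le_div_iff₀ (Real.rpow_pos_of_pos he _)]
  refine h1.trans (mul_le_of_le_one_right ?_ ?_)
  · unfold locConst; positivity
  · rw [Real.exp_le_one_iff]; linarith

/-- The energies of u' and v' sum to at least that of v, so the larger one is at least half of it
and supplies the full decay in v. The smaller one keeps at least the decay `halfDecay`, since k ≥ 1.
-/
lemma decay_post_le (hk : 1 ≤ k) (v u : E3) (ω : S2) :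
    en c (uPost v u ω) ^ (-(k / 2)) * en c (vPost v u ω) ^ (-(k / 2)) ≤
      2 ^ (k / 2) * en c v ^ (-(k / 2)) *
        (halfDecay (uPost v u ω) + halfDecay (vPost v u ω)) := by
  have hhalf : ∀ y : E3, en c y ^ (-(k / 2)) ≤ halfDecay y := by
    intro y
    have h1 : 1 + ‖y‖ ^ 2 / 2 ≤ en c y := one_add_le_en hc y
    calc en c y ^ (-(k / 2)) ≤ en c y ^ (-(1 / 2 : ℝ)) :=
          Real.rpow_le_rpow_of_exponent_le (one_le_en hc y) (by linarith)
      _ ≤ (1 + ‖y‖ ^ 2 / 2) ^ (-(1 / 2 : ℝ)) :=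
          Real.rpow_le_rpow_of_nonpos (by positivity) h1 (by norm_num)
      _ = halfDecay y := by
          rw [halfDecay, Real.rpow_neg (by positivity), Real.sqrt_eq_rpow]
  have hbig : ∀ y : E3, en c v ≤ 2 * en c y →
      en c y ^ (-(k / 2)) ≤ 2 ^ (k / 2) * en c v ^ (-(k / 2)) := by
    intro y hy
    have hv := en_pos hc v
    calc en c y ^ (-(k / 2)) ≤ (en c v / 2) ^ (-(k / 2)) :=
          Real.rpow_le_rpow_of_nonpos (by positivity) (by linarith) (by linarith)
      _ = _ := by
          rw [Real.div_rpow hv.le (by norm_num), Real.rpow_neg (by norm_num : (0 : ℝ) ≤ 2)]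
          field_simp
  have hsum := en_post c v u ω
  have hu := one_le_en hc u
  have hv := (en_pos hc v).le
  have hp1 := (en_pos hc (uPost v u ω)).le
  have hp2 := (en_pos hc (vPost v u ω)).le
  rcases le_total (en c (vPost v u ω)) (en c (uPost v u ω)) with h | h
  · calc _ ≤ (2 ^ (k / 2) * en c v ^ (-(k / 2))) * halfDecay (vPost v u ω) := by
          gcongr
          · exact hbig _ (by linarith)
          · exact hhalf _
      _ ≤ _ := by
          gcongr
          linarith [halfDecay_nonneg (uPost v u ω)]
  · calc _ ≤ halfDecay (uPost v u ω) * (2 ^ (k / 2) * en c v ^ (-(k / 2))) := by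
          gcongr
          · exact halfDecay_nonneg _
          · exact hhalf _
          · exact hbig _ (by linarith)
      _ = (2 ^ (k / 2) * en c v ^ (-(k / 2))) * halfDecay (uPost v u ω) := by ring
      _ ≤ _ := by
          gcongr
          linarith [halfDecay_nonneg (vPost v u ω)]

end Decay

/-- The constant of the gain majorant. -/
def gainConst (Cb : ℝ) : ℝ := (exists_gain_majorant Cb).choose

/-- The constant of the loss majorant. -/
def lossConst (Cb : ℝ) : ℝ := (exists_loss_majorant Cb).choose

lemma gainConst_nonneg (Cb : ℝ) : 0 ≤ gainConst Cb := (exists_gain_majorant Cb).choose_spec.1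

lemma lossConst_nonneg (Cb : ℝ) : 0 ≤ lossConst Cb := (exists_loss_majorant Cb).choose_spec.1

/-! ### Bounds and multilinearity of the gain and loss operators. -/

section Operators

variable {γ : ℝ} {b : ℝ → ℝ} {Cb : ℝ} (hk : AdmissibleKernel γ b Cb) {c : ℝ} (hc : 0 ≤ c)
  {k A A' : ℝ} {f g f₁ f₂ : E3 → ℝ}

include hk hc

lemma gain_pointwise (hf : Decays c k A f) (hg : Decays c k A' g) (h1 : 1 ≤ k) (v : E3)
    (p : E3 × S2) :
    ‖weightedKernel γ b v p * (f (uPost v p.1 p.2) * g (vPost v p.1 p.2))‖ ≤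
      (2 ^ (k / 2) * A * A' * en c v ^ (-(k / 2))) * (weightedKernel γ b v p *
        (halfDecay (uPost v p.1 p.2) + halfDecay (vPost v p.1 p.2))) := by
  have hw := weightedKernel_nonneg hk v p
  have hA := hf.nonneg hc
  have hA' := hg.nonneg hc
  have hp := decay_post_le hc h1 v p.1 p.2
  rw [norm_mul, norm_mul, Real.norm_eq_abs, Real.norm_eq_abs, Real.norm_eq_abs, abs_of_nonneg hw]
  have hu := (en_pos hc (uPost v p.1 p.2)).le
  calc _ ≤ weightedKernel γ b v p * ((A * en c (uPost v p.1 p.2) ^ (-(k / 2))) *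
        (A' * en c (vPost v p.1 p.2) ^ (-(k / 2)))) := by
        gcongr
        · exact hf.bound _
        · exact hg.bound _
    _ = weightedKernel γ b v p * (A * A') * (en c (uPost v p.1 p.2) ^ (-(k / 2)) *
        en c (vPost v p.1 p.2) ^ (-(k / 2))) := by ring
    _ ≤ weightedKernel γ b v p * (A * A') * (2 ^ (k / 2) * en c v ^ (-(k / 2)) *
        (halfDecay (uPost v p.1 p.2) + halfDecay (vPost v p.1 p.2))) := by gcongr
    _ = _ := by ring

lemma integrable_gain (hf : Decays c k A f) (hg : Decays c k A' g) (h1 : 1 ≤ k) (v : E3) :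
    Integrable (fun p : E3 × S2 => weightedKernel γ b v p *
      (f (uPost v p.1 p.2) * g (vPost v p.1 p.2))) partnerMeasure := by
  have hm : Measurable fun p : E3 × S2 => (v, p) := measurable_const.prodMk measurable_id
  refine (((exists_gain_majorant Cb).choose_spec.2 γ b hk v).1.const_mul
    (2 ^ (k / 2) * A * A' * en c v ^ (-(k / 2)))).mono' ?_
    (Eventually.of_forall fun p => gain_pointwise hk hc hf hg h1 v p)
  exact ((measurable_weightedKernel_right hk v).mul
    ((hf.measurable.comp (measurable_uPost'.comp hm)).mul
      (hg.measurable.comp (measurable_vPost'.comp hm)))).aestronglyMeasurable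

/-- The gain term reproduces the decay of its arguments without losing any power of |v|, although
the kernel may grow; this is what closes the weighted estimate. -/
lemma abs_gainOp_le (hf : Decays c k A f) (hg : Decays c k A' g) (h1 : 1 ≤ k) (v : E3) :
    |gainOp γ b f g v| ≤
      gainConst Cb * 2 ^ (k / 2) * A * A' * en c v ^ (-(k / 2)) := by
  have hmaj := (exists_gain_majorant Cb).choose_spec.2 γ b hk v
  have hA := hf.nonneg hc
  have hA' := hg.nonneg hc
  have hv := (en_pos hc v).le
  refine (norm_integral_le_of_norm_le (hmaj.1.const_mul
    (2 ^ (k / 2) * A * A' * en c v ^ (-(k / 2))))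
    (Eventually.of_forall fun p => gain_pointwise hk hc hf hg h1 v p)).trans ?_
  rw [integral_const_mul]
  calc _ ≤ (2 ^ (k / 2) * A * A' * en c v ^ (-(k / 2))) * gainConst Cb := by
        gcongr
        exact hmaj.2
    _ = _ := by ring

lemma loss_pointwise (hf : Decays c k A f) (h0 : 0 ≤ k) (v : E3) (p : E3 × S2) :
    ‖weightedKernel γ b v p * f p.1‖ ≤ A * weightedKernel γ b v p := by
  rw [norm_mul, Real.norm_eq_abs, Real.norm_eq_abs, abs_of_nonneg (weightedKernel_nonneg hk v p),
    mul_comm]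
  exact mul_le_mul_of_nonneg_right (hf.abs_le hc h0 _) (weightedKernel_nonneg hk v p)

lemma integrable_loss (hf : Decays c k A f) (h0 : 0 ≤ k) (v : E3) :
    Integrable (fun p : E3 × S2 => weightedKernel γ b v p * f p.1) partnerMeasure :=
  (((exists_loss_majorant Cb).choose_spec.2 γ b hk v).1.const_mul A).mono'
    ((measurable_weightedKernel_right hk v).mul
      (hf.measurable.comp measurable_fst)).aestronglyMeasurable
    (Eventually.of_forall fun p => loss_pointwise hk hc hf h0 v p)

/-- In contrast to the gain term, half a power of the energy, that is one power of |v|, is lost. -/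
lemma abs_lossOp_le (hf : Decays c k A f) (h0 : 0 ≤ k) (v : E3) :
    |lossOp γ b f v| ≤ 2 * lossConst Cb * A * en c v ^ (1 / 2 : ℝ) := by
  have hmaj := (exists_loss_majorant Cb).choose_spec.2 γ b hk v
  have hA := hf.nonneg hc
  have hL := lossConst_nonneg Cb
  refine (norm_integral_le_of_norm_le (hmaj.1.const_mul A)
    (Eventually.of_forall fun p => loss_pointwise hk hc hf h0 v p)).trans ?_
  rw [integral_const_mul]
  calc _ ≤ A * (lossConst Cb * (1 + ‖v‖)) := by
        gcongr
        exact hmaj.2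
    _ ≤ A * (lossConst Cb * (2 * en c v ^ (1 / 2 : ℝ))) := by
        gcongr
        exact one_add_norm_le_en hc v
    _ = _ := by ring

lemma gainOp_add_left (h₁ : Decays c k A f₁) (h₂ : Decays c k A f₂) (hg : Decays c k A' g)
    (h1 : 1 ≤ k) (v : E3) :
    gainOp γ b (fun v => f₁ v + f₂ v) g v = gainOp γ b f₁ g v + gainOp γ b f₂ g v := by
  unfold gainOp
  rw [← integral_add (integrable_gain hk hc h₁ hg h1 v) (integrable_gain hk hc h₂ hg h1 v)]
  congr 1; funext p; ring

lemma gainOp_add_right (hg : Decays c k A' g) (h₁ : Decays c k A f₁) (h₂ : Decays c k A f₂)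
    (h1 : 1 ≤ k) (v : E3) :
    gainOp γ b g (fun v => f₁ v + f₂ v) v = gainOp γ b g f₁ v + gainOp γ b g f₂ v := by
  unfold gainOp
  rw [← integral_add (integrable_gain hk hc hg h₁ h1 v) (integrable_gain hk hc hg h₂ h1 v)]
  congr 1; funext p; ring

lemma lossOp_add (h₁ : Decays c k A f₁) (h₂ : Decays c k A' f₂) (h0 : 0 ≤ k) (v : E3) :
    lossOp γ b (fun v => f₁ v + f₂ v) v = lossOp γ b f₁ v + lossOp γ b f₂ v := by
  unfold lossOp
  rw [← integral_add (integrable_loss hk hc h₁ h0 v) (integrable_loss hk hc h₂ h0 v)]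
  congr 1; funext p; ring

omit hk hc in
lemma gainOp_const_mul_left (r : ℝ) (f g : E3 → ℝ) (v : E3) :
    gainOp γ b (fun v => r * f v) g v = r * gainOp γ b f g v := by
  unfold gainOp
  rw [← integral_const_mul]
  congr 1; funext p; ring

omit hk hc in
lemma gainOp_const_mul_right (r : ℝ) (f g : E3 → ℝ) (v : E3) :
    gainOp γ b f (fun v => r * g v) v = r * gainOp γ b f g v := by
  unfold gainOp
  rw [← integral_const_mul]
  congr 1; funext p; ring

omit hk hc in
lemma lossOp_const_mul (r : ℝ) (f : E3 → ℝ) (v : E3) :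
    lossOp γ b (fun v => r * f v) v = r * lossOp γ b f v := by
  unfold lossOp
  rw [← integral_const_mul]
  congr 1; funext p; ring

/-- Polarization through the intermediate product f₂(u') f₁(v'). -/
lemma gainOp_sub_gainOp (h₁ : Decays c k A f₁) (h₂ : Decays c k A f₂) (h1 : 1 ≤ k) (v : E3) :
    gainOp γ b f₁ f₁ v - gainOp γ b f₂ f₂ v =
      gainOp γ b (fun v => f₁ v - f₂ v) f₁ v + gainOp γ b f₂ (fun v => f₁ v - f₂ v) v := by
  have i₁ := integrable_gain hk hc h₁ h₁ h1 v
  have i₂ := integrable_gain hk hc h₂ h₂ h1 v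
  have i₃ := integrable_gain hk hc h₂ h₁ h1 v
  unfold gainOp
  have e₁ : ∫ p, weightedKernel γ b v p * ((f₁ (uPost v p.1 p.2) - f₂ (uPost v p.1 p.2)) *
      f₁ (vPost v p.1 p.2)) ∂partnerMeasure = ∫ p, weightedKernel γ b v p *
      (f₁ (uPost v p.1 p.2) * f₁ (vPost v p.1 p.2)) ∂partnerMeasure - ∫ p, weightedKernel γ b v p *
      (f₂ (uPost v p.1 p.2) * f₁ (vPost v p.1 p.2)) ∂partnerMeasure := by
    rw [← integral_sub i₁ i₃]; congr 1; funext p; ring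
  have e₂ : ∫ p, weightedKernel γ b v p * (f₂ (uPost v p.1 p.2) *
      (f₁ (vPost v p.1 p.2) - f₂ (vPost v p.1 p.2))) ∂partnerMeasure = ∫ p, weightedKernel γ b v p *
      (f₂ (uPost v p.1 p.2) * f₁ (vPost v p.1 p.2)) ∂partnerMeasure - ∫ p, weightedKernel γ b v p *
      (f₂ (uPost v p.1 p.2) * f₂ (vPost v p.1 p.2)) ∂partnerMeasure := by
    rw [← integral_sub i₃ i₂]; congr 1; funext p; ring
  rw [e₁, e₂]; ring

lemma gainOp_sub_left (h₁ : Decays c k A f₁) (h₂ : Decays c k A f₂) (hg : Decays c k A' g)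
    (h1 : 1 ≤ k) (v : E3) :
    gainOp γ b f₁ g v - gainOp γ b f₂ g v = gainOp γ b (fun v => f₁ v - f₂ v) g v := by
  unfold gainOp
  rw [← integral_sub (integrable_gain hk hc h₁ hg h1 v) (integrable_gain hk hc h₂ hg h1 v)]
  congr 1; funext p; ring

lemma gainOp_sub_right (hg : Decays c k A' g) (h₁ : Decays c k A f₁) (h₂ : Decays c k A f₂)
    (h1 : 1 ≤ k) (v : E3) :
    gainOp γ b g f₁ v - gainOp γ b g f₂ v = gainOp γ b g (fun v => f₁ v - f₂ v) v := by
  unfold gainOp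
  rw [← integral_sub (integrable_gain hk hc hg h₁ h1 v) (integrable_gain hk hc hg h₂ h1 v)]
  congr 1; funext p; ring

lemma lossOp_sub (h₁ : Decays c k A f₁) (h₂ : Decays c k A f₂) (h0 : 0 ≤ k) (v : E3) :
    lossOp γ b f₁ v - lossOp γ b f₂ v = lossOp γ b (fun v => f₁ v - f₂ v) v := by
  unfold lossOp
  rw [← integral_sub (integrable_loss hk hc h₁ h0 v) (integrable_loss hk hc h₂ h0 v)]
  congr 1; funext p; ring

omit hc in
lemma lossOp_nonneg (hf : ∀ v, 0 ≤ f v) (v : E3) : 0 ≤ lossOp γ b f v :=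
  integral_nonneg fun p => mul_nonneg (weightedKernel_nonneg hk v p) (hf _)

omit hc in
lemma gainOp_nonneg (hf : ∀ v, 0 ≤ f v) (v : E3) : 0 ≤ gainOp γ b f f v :=
  integral_nonneg fun p => mul_nonneg (weightedKernel_nonneg hk v p) (mul_nonneg (hf _) (hf _))

-- Detailed balance: √μ_E(u') √μ_E(v') = √μ_E(u) √μ_E(v), so the local Maxwellian is an equilibrium
-- of the collision operator.
omit hk hc in
lemma gainOp_sqrtLoc (v : E3) :
    gainOp γ b (sqrtLoc c) (sqrtLoc c) v = sqrtLoc c v * lossOp γ b (sqrtLoc c) v := by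
  unfold gainOp lossOp
  rw [← integral_const_mul]
  congr 1; funext p
  rw [sqrtLoc_post]; ring

/-! ### The collision operator relative to the local Maxwellian -/

omit hk hc in
/-- The collision operator acting on `h = F / √μ_E`, at a point where the potential is `c`. -/
def collOp (γ : ℝ) (b : ℝ → ℝ) (c : ℝ) (h : E3 → ℝ) (v : E3) : ℝ :=
  Real.exp (-(c / 2)) * (gainOp γ b h h v - h v * lossOp γ b h v)

omit hk hc in
/-- The part of the collision operator treated as a source for the perturbation `g`. -/
def collSrc (γ : ℝ) (b : ℝ → ℝ) (c : ℝ) (g : E3 → ℝ) (v : E3) : ℝ :=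
  Real.exp (-(c / 2)) * (gainOp γ b (sqrtLoc c) g v + gainOp γ b g (sqrtLoc c) v +
    gainOp γ b g g v - sqrtLoc c v * lossOp γ b g v)

omit hk hc in
/-- The collision rate. -/
def collRate (γ : ℝ) (b : ℝ → ℝ) (c : ℝ) (g : E3 → ℝ) (v : E3) : ℝ :=
  Real.exp (-(c / 2)) * lossOp γ b (fun v => sqrtLoc c v + g v) v

omit hk in
lemma sqrtLoc_decays_max (h1 : 1 ≤ k) :
    Decays c k (max A (locConst k)) (sqrtLoc c) :=
  (sqrtLoc_decays hc (by linarith)).mono_const hc (le_max_right _ _)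

/-- Expanding the quadratic form, the pure equilibrium terms cancel by `gainOp_sqrtLoc`. The
unbounded loss rate multiplies only g and is kept on the left as damping; every other term is
harmless in the weighted norm. -/
lemma collOp_eq_src_sub_rate (hg : Decays c k A g) (h1 : 1 ≤ k) (v : E3) :
    collOp γ b c (fun v => sqrtLoc c v + g v) v =
      collSrc γ b c g v - collRate γ b c g v * g v := by
  have hm := sqrtLoc_decays_max (A := A) hc h1
  have hg' := hg.mono_const hc (le_max_left A (locConst k))
  unfold collOp collSrc collRate
  rw [gainOp_add_left hk hc hm hg' (hm.add hg') h1, gainOp_add_right hk hc hm hm hg' h1,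
    gainOp_add_right hk hc hg' hm hg' h1, lossOp_add hk hc hm hg' (by linarith), gainOp_sqrtLoc]
  ring

omit hc in
lemma collRate_nonneg (hg : ∀ v, 0 ≤ sqrtLoc c v + g v) (v : E3) : 0 ≤ collRate γ b c g v :=
  mul_nonneg (Real.exp_pos _).le (lossOp_nonneg hk hg v)

omit hk in
lemma exp_neg_half_le_one : Real.exp (-(c / 2)) ≤ 1 := by
  rw [Real.exp_le_one_iff]; linarith

/-! ### Size and Lipschitz estimates for source, rate and collision operator. -/

omit hk hc in
/-- The constant in the estimates of the source term. -/
def srcConst (Cb k : ℝ) : ℝ :=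
  2 * gainConst Cb * 2 ^ (k / 2) * (locConst k + 1) + 2 * lossConst Cb * (locConst (k + 1) + 1)

omit hk hc in
lemma locConst_nonneg (h1 : 0 ≤ k) : 0 ≤ locConst k := by unfold locConst; positivity

omit hk hc in
lemma srcConst_nonneg (Cb : ℝ) (h1 : 0 ≤ k) : 0 ≤ srcConst Cb k := by
  have h1 := gainConst_nonneg Cb
  have h2 := lossConst_nonneg Cb
  have h3 := locConst_nonneg (k := k) (by linarith)
  have h4 := locConst_nonneg (k := k + 1) (by linarith)
  unfold srcConst; positivity

/-- The gain terms keep the weight. The only loss term carries the factor `sqrtLoc`, which is given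
decay k + 1 in order to pay for the half power of energy lost by `lossOp`. -/
lemma abs_collSrc_sub_le (h₁ : Decays c k A f₁) (h₂ : Decays c k A f₂) {D : ℝ}
    (hd : Decays c k D (fun v => f₁ v - f₂ v)) (h1 : 1 ≤ k) (v : E3) :
    |collSrc γ b c f₁ v - collSrc γ b c f₂ v| ≤
      (2 * gainConst Cb * 2 ^ (k / 2) * (locConst k + A) + 2 * lossConst Cb * locConst (k + 1)) *
        D * en c v ^ (-(k / 2)) := by
  have hm : Decays c k (locConst k) (sqrtLoc c) := sqrtLoc_decays hc (by linarith)
  have e : collSrc γ b c f₁ v - collSrc γ b c f₂ v = Real.exp (-(c / 2)) *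
      (gainOp γ b (sqrtLoc c) (fun v => f₁ v - f₂ v) v +
        gainOp γ b (fun v => f₁ v - f₂ v) (sqrtLoc c) v +
        (gainOp γ b (fun v => f₁ v - f₂ v) f₁ v + gainOp γ b f₂ (fun v => f₁ v - f₂ v) v) -
        sqrtLoc c v * lossOp γ b (fun v => f₁ v - f₂ v) v) := by
    rw [← gainOp_sub_gainOp hk hc h₁ h₂ h1, ← lossOp_sub hk hc h₁ h₂ (by linarith),
      ← gainOp_sub_left hk hc h₁ h₂ hm h1, ← gainOp_sub_right hk hc hm h₁ h₂ h1]
    unfold collSrc; ring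
  have b1 := abs_gainOp_le hk hc hm hd h1 v
  have b2 := abs_gainOp_le hk hc hd hm h1 v
  have b3 := abs_gainOp_le hk hc hd h₁ h1 v
  have b4 := abs_gainOp_le hk hc h₂ hd h1 v
  have b5 := abs_lossOp_le hk hc hd (by linarith) v
  have hev := en_pos hc v
  have hD := hd.nonneg hc
  have hL := lossConst_nonneg Cb
  have b6 : |sqrtLoc c v * lossOp γ b (fun v => f₁ v - f₂ v) v| ≤
      2 * lossConst Cb * locConst (k + 1) * D * en c v ^ (-(k / 2)) := by
    have b7 := (sqrtLoc_decays hc (k := k + 1) (by linarith)).bound v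
    rw [abs_mul]
    calc _ ≤ (locConst (k + 1) * en c v ^ (-((k + 1) / 2))) *
          (2 * lossConst Cb * D * en c v ^ (1 / 2 : ℝ)) :=
          mul_le_mul b7 b5 (abs_nonneg _) ((abs_nonneg _).trans b7)
      _ = 2 * lossConst Cb * locConst (k + 1) * D *
          (en c v ^ (-((k + 1) / 2)) * en c v ^ (1 / 2 : ℝ)) := by ring
      _ = _ := by rw [← Real.rpow_add hev]; congr 2; ring
  rw [e, abs_mul, abs_of_pos (Real.exp_pos _)]
  refine (mul_le_of_le_one_left (abs_nonneg _) (exp_neg_half_le_one hc)).trans ?_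
  refine (abs_sub _ _).trans ?_
  have t1 := abs_add_le (gainOp γ b (sqrtLoc c) (fun v => f₁ v - f₂ v) v +
        gainOp γ b (fun v => f₁ v - f₂ v) (sqrtLoc c) v)
        (gainOp γ b (fun v => f₁ v - f₂ v) f₁ v + gainOp γ b f₂ (fun v => f₁ v - f₂ v) v)
  have t2 := abs_add_le (gainOp γ b (sqrtLoc c) (fun v => f₁ v - f₂ v) v)
        (gainOp γ b (fun v => f₁ v - f₂ v) (sqrtLoc c) v)
  have t3 := abs_add_le (gainOp γ b (fun v => f₁ v - f₂ v) f₁ v)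
    (gainOp γ b f₂ (fun v => f₁ v - f₂ v) v)
  linarith

lemma abs_collSrc_le (hf : Decays c k A f) (h1 : 1 ≤ k) (v : E3) :
    |collSrc γ b c f v| ≤ srcConst Cb k * (A * (1 + A)) * en c v ^ (-(k / 2)) := by
  have hA := hf.nonneg hc
  -- Comparison with the zero perturbation, whose source vanishes.
  have h := abs_collSrc_sub_le hk hc hf (Decays.zero.mono_const hc hA) (D := A)
    (by simpa using hf) h1 v
  have h0 : collSrc γ b c (fun _ => 0) v = 0 := by simp [collSrc, gainOp, lossOp]
  rw [h0, sub_zero] at h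
  refine h.trans ?_
  have h2 := gainConst_nonneg Cb
  have h3 := lossConst_nonneg Cb
  have h4 := locConst_nonneg (k := k) (by linarith)
  have h5 := locConst_nonneg (k := k + 1) (by linarith)
  have hpow : 0 ≤ en c v ^ (-(k / 2)) := Real.rpow_nonneg (en_pos hc v).le _
  refine mul_le_mul_of_nonneg_right ?_ hpow
  have : (2 * gainConst Cb * 2 ^ (k / 2) * (locConst k + A) + 2 * lossConst Cb * locConst (k + 1))
      ≤ srcConst Cb k * (1 + A) := by
    unfold srcConst
    have p1 : (0 : ℝ) ≤ 2 * gainConst Cb * 2 ^ (k / 2) := by positivity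
    have p2 : (0 : ℝ) ≤ 2 * lossConst Cb := by positivity
    -- The `+ 1` in `srcConst` serves to absorb A into the factor 1 + A.
    have q1 : locConst k + A ≤ (locConst k + 1) * (1 + A) := by nlinarith [mul_nonneg h4 hA]
    have q2 : locConst (k + 1) ≤ (locConst (k + 1) + 1) * (1 + A) := by
      nlinarith [mul_nonneg h5 hA]
    nlinarith [mul_le_mul_of_nonneg_left q1 p1, mul_le_mul_of_nonneg_left q2 p2]
  calc _ ≤ srcConst Cb k * (1 + A) * A := mul_le_mul_of_nonneg_right this hA
    _ = _ := by ring

lemma abs_collRate_sub_le (h₁ : Decays c k A f₁) (h₂ : Decays c k A f₂) {D : ℝ}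
    (hd : Decays c k D (fun v => f₁ v - f₂ v)) (h1 : 1 ≤ k) (v : E3) :
    |collRate γ b c f₁ v - collRate γ b c f₂ v| ≤ 2 * lossConst Cb * D * en c v ^ (1 / 2 : ℝ) := by
  have hm : Decays c k (locConst k) (sqrtLoc c) := sqrtLoc_decays hc (by linarith)
  have e : collRate γ b c f₁ v - collRate γ b c f₂ v =
      Real.exp (-(c / 2)) * lossOp γ b (fun v => f₁ v - f₂ v) v := by
    unfold collRate
    rw [lossOp_add hk hc hm h₁ (by linarith), lossOp_add hk hc hm h₂ (by linarith),
      ← lossOp_sub hk hc h₁ h₂ (by linarith)]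
    ring
  rw [e, abs_mul, abs_of_pos (Real.exp_pos _)]
  exact (mul_le_of_le_one_left (abs_nonneg _) (exp_neg_half_le_one hc)).trans
    (abs_lossOp_le hk hc hd (by linarith) v)

lemma abs_collRate_le (hf : Decays c k A f) (h1 : 1 ≤ k) (v : E3) :
    |collRate γ b c f v| ≤ 2 * lossConst Cb * (locConst k + A) * en c v ^ (1 / 2 : ℝ) := by
  have hm : Decays c k (locConst k) (sqrtLoc c) := sqrtLoc_decays hc (by linarith)
  unfold collRate
  rw [abs_mul, abs_of_pos (Real.exp_pos _)]
  exact (mul_le_of_le_one_left (abs_nonneg _) (exp_neg_half_le_one hc)).trans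
    (abs_lossOp_le hk hc (hm.add hf) (by linarith) v)

/-- Stability of the linear equation defining the iteration. -/
lemma abs_src_rate_sub_le (h₁ : Decays c (k + 1) A f₁) (h₂ : Decays c (k + 1) A f₂) {D : ℝ}
    (hd : Decays c k D (fun v => f₁ v - f₂ v)) (h1 : 1 ≤ k) {y : ℝ} (v : E3)
    (hy : |y| ≤ A * en c v ^ (-((k + 1) / 2))) :
    |collSrc γ b c f₁ v - collSrc γ b c f₂ v - (collRate γ b c f₁ v - collRate γ b c f₂ v) * y| ≤
      srcConst Cb k * (1 + A) * D * en c v ^ (-(k / 2)) := by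
  have hA := h₁.nonneg hc
  have hD := hd.nonneg hc
  have hev := en_pos hc v
  have d1 := h₁.mono_exponent hc (k' := k) (by linarith)
  have d2 := h₂.mono_exponent hc (k' := k) (by linarith)
  have b1 := abs_collSrc_sub_le hk hc d1 d2 hd h1 v
  have b2 := abs_collRate_sub_le hk hc d1 d2 hd h1 v
  have hL := lossConst_nonneg Cb
  -- The growth en^{1/2} of the rate difference meets the decay -(k+1)/2 of y and leaves exactly
  -- -k/2. This is why the comparison takes place in the weight k while the solutions decay with k +
  -- 1.
  have b3 : |(collRate γ b c f₁ v - collRate γ b c f₂ v) * y| ≤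
      2 * lossConst Cb * A * D * en c v ^ (-(k / 2)) := by
    rw [abs_mul]
    calc _ ≤ (2 * lossConst Cb * D * en c v ^ (1 / 2 : ℝ)) *
          (A * en c v ^ (-((k + 1) / 2))) := by gcongr
      _ = 2 * lossConst Cb * A * D *
          (en c v ^ (1 / 2 : ℝ) * en c v ^ (-((k + 1) / 2))) := by ring
      _ = _ := by rw [← Real.rpow_add hev]; congr 2; ring
  refine (abs_sub _ _).trans ((add_le_add b1 b3).trans ?_)
  rw [← add_mul]
  have hpow : 0 ≤ en c v ^ (-(k / 2)) := by positivity
  refine mul_le_mul_of_nonneg_right ?_ hpow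
  rw [← add_mul]
  refine mul_le_mul_of_nonneg_right ?_ hD
  have h2 := gainConst_nonneg Cb
  have h4 := locConst_nonneg (k := k) (by linarith)
  have h5 := locConst_nonneg (k := k + 1) (by linarith)
  unfold srcConst
  have p1 : (0 : ℝ) ≤ 2 * gainConst Cb * 2 ^ (k / 2) := by positivity
  have p2 : (0 : ℝ) ≤ 2 * lossConst Cb := by positivity
  have q1 : locConst k + A ≤ (locConst k + 1) * (1 + A) := by nlinarith [mul_nonneg h4 hA]
  have q2 : locConst (k + 1) + A ≤ (locConst (k + 1) + 1) * (1 + A) := by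
    nlinarith [mul_nonneg h5 hA]
  nlinarith [mul_le_mul_of_nonneg_left q1 p1, mul_le_mul_of_nonneg_left q2 p2]

omit hk hc in
/-- The constant in the estimates of the collision operator. -/
def collConst (Cb k : ℝ) : ℝ := 2 * gainConst Cb * 2 ^ (k / 2) + 4 * lossConst Cb

omit hk hc in
lemma collConst_nonneg (Cb k : ℝ) : 0 ≤ collConst Cb k := by
  have h1 := gainConst_nonneg Cb
  have h2 := lossConst_nonneg Cb
  unfold collConst; positivity

/-- No decay is retained here. In the moment and entropy integrals the operator is multiplied by
`sqrtLoc`, so growth of order en^{1/2} is good enough. -/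
lemma abs_collOp_sub_le (h₁ : Decays c k A f₁) (h₂ : Decays c k A f₂) {D : ℝ}
    (hd : Decays c k D (fun v => f₁ v - f₂ v)) (h1 : 1 ≤ k) (v : E3) :
    |collOp γ b c f₁ v - collOp γ b c f₂ v| ≤ collConst Cb k * A * D * en c v ^ (1 / 2 : ℝ) := by
  have hA := h₁.nonneg hc
  have hD := hd.nonneg hc
  have hev := en_pos hc v
  have e : collOp γ b c f₁ v - collOp γ b c f₂ v = Real.exp (-(c / 2)) *
      ((gainOp γ b (fun v => f₁ v - f₂ v) f₁ v + gainOp γ b f₂ (fun v => f₁ v - f₂ v) v) -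
        ((f₁ v - f₂ v) * lossOp γ b f₁ v + f₂ v * lossOp γ b (fun v => f₁ v - f₂ v) v)) := by
    rw [← gainOp_sub_gainOp hk hc h₁ h₂ h1, ← lossOp_sub hk hc h₁ h₂ (by linarith)]
    unfold collOp; ring
  have b3 := abs_gainOp_le hk hc hd h₁ h1 v
  have b4 := abs_gainOp_le hk hc h₂ hd h1 v
  have b5 := abs_lossOp_le hk hc hd (by linarith) v
  have b6 := abs_lossOp_le hk hc h₁ (by linarith) v
  have b7 := hd.abs_le hc (by linarith) v
  have b8 := h₂.abs_le hc (by linarith) v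
  have hG := gainConst_nonneg Cb
  have hL := lossConst_nonneg Cb
  have hpow : en c v ^ (-(k / 2)) ≤ en c v ^ (1 / 2 : ℝ) :=
    Real.rpow_le_rpow_of_exponent_le (one_le_en hc v) (by linarith)
  have c1 : |(f₁ v - f₂ v) * lossOp γ b f₁ v| ≤
      D * (2 * lossConst Cb * A * en c v ^ (1 / 2 : ℝ)) := by
    rw [abs_mul]; gcongr
  have c2 : |f₂ v * lossOp γ b (fun v => f₁ v - f₂ v) v| ≤
      A * (2 * lossConst Cb * D * en c v ^ (1 / 2 : ℝ)) := by
    rw [abs_mul]; gcongr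
  have c3 : gainConst Cb * 2 ^ (k / 2) * D * A * en c v ^ (-(k / 2)) ≤
      gainConst Cb * 2 ^ (k / 2) * D * A * en c v ^ (1 / 2 : ℝ) := by gcongr
  rw [e, abs_mul, abs_of_pos (Real.exp_pos _)]
  refine (mul_le_of_le_one_left (abs_nonneg _) (exp_neg_half_le_one hc)).trans ?_
  refine (abs_sub _ _).trans ?_
  have t1 := abs_add_le (gainOp γ b (fun v => f₁ v - f₂ v) f₁ v)
    (gainOp γ b f₂ (fun v => f₁ v - f₂ v) v)
  have t2 := abs_add_le ((f₁ v - f₂ v) * lossOp γ b f₁ v)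
    (f₂ v * lossOp γ b (fun v => f₁ v - f₂ v) v)
  unfold collConst
  linarith

lemma abs_collOp_le (hf : Decays c k A f) (h1 : 1 ≤ k) (v : E3) :
    |collOp γ b c f v| ≤ collConst Cb k * A ^ 2 * en c v ^ (1 / 2 : ℝ) := by
  have hA := hf.nonneg hc
  have h := abs_collOp_sub_le hk hc hf (Decays.zero.mono_const hc hA) (D := A)
    (by simpa using hf) h1 v
  have h0 : collOp γ b c (fun _ => 0) v = 0 := by simp [collOp, gainOp, lossOp]
  rw [h0, sub_zero] at h
  refine h.trans (le_of_eq ?_)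
  ring

end Operators

/-! ### The operators of the linearized problem -/

lemma measurable_integral_integral {P : Type*} [MeasurableSpace P] {G : P → E3 → S2 → ℝ}
    (hG : Measurable fun q : P × (E3 × S2) => G q.1 q.2.1 q.2.2) :
    Measurable fun p => ∫ u : E3, ∫ ω : S2, G p u ω ∂sphereMeasure := by
  have h1 : StronglyMeasurable fun q : P × E3 => ∫ ω : S2, G q.1 q.2 ω ∂sphereMeasure := by
    refine StronglyMeasurable.integral_prod_right (ν := sphereMeasure)
      (f := fun (q : P × E3) (ω : S2) => G q.1 q.2 ω) ?_
    refine Measurable.stronglyMeasurable ?_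
    exact hG.comp (f := fun r : (P × E3) × S2 => (r.1.1, (r.1.2, r.2)))
      ((measurable_fst.comp measurable_fst).prodMk
        ((measurable_snd.comp measurable_fst).prodMk measurable_snd))
  exact (StronglyMeasurable.integral_prod_right (ν := (volume : Measure E3))
    (f := fun (p : P) (u : E3) => ∫ ω : S2, G p u ω ∂sphereMeasure) h1).measurable

lemma integral_integral_eq {G : E3 → S2 → ℝ}
    (hG : Integrable (fun p : E3 × S2 => G p.1 p.2) partnerMeasure) :
    ∫ u : E3, ∫ ω : S2, G u ω ∂sphereMeasure = ∫ p, G p.1 p.2 ∂partnerMeasure :=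
  (integral_prod (fun p : E3 × S2 => G p.1 p.2) hG).symm

lemma sqrt_maxwellian_mul (u v : E3) : √(maxwellian u * maxwellian v) = sqrtMax u * sqrtMax v :=
  Real.sqrt_mul (Real.exp_pos _).le _

section OperatorIdentities

variable {γ : ℝ} {b : ℝ → ℝ} {Cb : ℝ} (hk : AdmissibleKernel γ b Cb)

include hk

lemma measurable_opK {P : Type*} [MeasurableSpace P] {f : P → E3 → ℝ}
    (hf : Measurable fun q : P × E3 => f q.1 q.2) :
    Measurable fun q : P × E3 => opK γ b (f q.1) q.2 := by
  have h1 : Measurable fun q : (P × E3) × (E3 × S2) => (q.1.2, q.2) :=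
    (measurable_snd.comp measurable_fst).prodMk measurable_snd
  have hp : Measurable fun q : (P × E3) × (E3 × S2) => q.1.1 := measurable_fst.comp measurable_fst
  have hv : Measurable fun q : (P × E3) × (E3 × S2) => q.1.2 := measurable_snd.comp measurable_fst
  have hu : Measurable fun q : (P × E3) × (E3 × S2) => q.2.1 := measurable_fst.comp measurable_snd
  have hB : Measurable fun q : (P × E3) × (E3 × S2) =>
      collisionKernel γ b (q.1.2 - q.2.1) q.2.2 :=
    hk.measurable_kernel.comp (g := fun p : E3 × S2 => collisionKernel γ b p.1 p.2)
      (f := fun q : (P × E3) × (E3 × S2) => (q.1.2 - q.2.1, q.2.2))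
      ((hv.sub hu).prodMk (measurable_snd.comp measurable_snd))
  have hup : Measurable fun q : (P × E3) × (E3 × S2) => uPost q.1.2 q.2.1 q.2.2 :=
    measurable_uPost'.comp h1
  have hvp : Measurable fun q : (P × E3) × (E3 × S2) => vPost q.1.2 q.2.1 q.2.2 :=
    measurable_vPost'.comp h1
  have m1 := measurable_integral_integral (P := P × E3) (G := fun q u ω =>
    collisionKernel γ b (q.2 - u) ω * (sqrtMax u * sqrtMax (uPost q.2 u ω)) *
      f q.1 (vPost q.2 u ω)) ((hB.mul ((measurable_sqrtMax.comp hu).mul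
      (measurable_sqrtMax.comp hup))).mul (hf.comp (hp.prodMk hvp)))
  have m2 := measurable_integral_integral (P := P × E3) (G := fun q u ω =>
    collisionKernel γ b (q.2 - u) ω * (sqrtMax u * sqrtMax (vPost q.2 u ω)) *
      f q.1 (uPost q.2 u ω)) ((hB.mul ((measurable_sqrtMax.comp hu).mul
      (measurable_sqrtMax.comp hvp))).mul (hf.comp (hp.prodMk hup)))
  have m3 := measurable_integral_integral (P := P × E3) (G := fun q u ω =>
    collisionKernel γ b (q.2 - u) ω * (sqrtMax q.2 * sqrtMax u) * f q.1 u)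
      ((hB.mul ((measurable_sqrtMax.comp hv).mul
      (measurable_sqrtMax.comp hu))).mul (hf.comp (hp.prodMk hu)))
  unfold opK K1 K2
  simp only [sqrt_maxwellian_mul]
  exact (m1.add m2).sub m3

lemma measurable_opGamma {P : Type*} [MeasurableSpace P] {f : P → E3 → ℝ}
    (hf : Measurable fun q : P × E3 => f q.1 q.2) :
    Measurable fun q : P × E3 => opGamma γ b (f q.1) q.2 := by
  have h1 : Measurable fun q : (P × E3) × (E3 × S2) => (q.1.2, q.2) :=
    (measurable_snd.comp measurable_fst).prodMk measurable_snd
  have hp : Measurable fun q : (P × E3) × (E3 × S2) => q.1.1 := measurable_fst.comp measurable_fst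
  have hv : Measurable fun q : (P × E3) × (E3 × S2) => q.1.2 := measurable_snd.comp measurable_fst
  have hu : Measurable fun q : (P × E3) × (E3 × S2) => q.2.1 := measurable_fst.comp measurable_snd
  have hB : Measurable fun q : (P × E3) × (E3 × S2) =>
      collisionKernel γ b (q.1.2 - q.2.1) q.2.2 :=
    hk.measurable_kernel.comp (g := fun p : E3 × S2 => collisionKernel γ b p.1 p.2)
      (f := fun q : (P × E3) × (E3 × S2) => (q.1.2 - q.2.1, q.2.2))
      ((hv.sub hu).prodMk (measurable_snd.comp measurable_snd))
  have hup : Measurable fun q : (P × E3) × (E3 × S2) => uPost q.1.2 q.2.1 q.2.2 :=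
    measurable_uPost'.comp h1
  have hvp : Measurable fun q : (P × E3) × (E3 × S2) => vPost q.1.2 q.2.1 q.2.2 :=
    measurable_vPost'.comp h1
  have hF : ∀ {w : (P × E3) × (E3 × S2) → E3}, Measurable w →
      Measurable fun q => sqrtMax (w q) * f q.1.1 (w q) := fun hw =>
    (measurable_sqrtMax.comp hw).mul (hf.comp (hp.prodMk hw))
  have m1 := measurable_integral_integral (P := P × E3) (G := fun q u ω =>
    collisionKernel γ b (q.2 - u) ω * (sqrtMax (uPost q.2 u ω) * f q.1 (uPost q.2 u ω)) *
      (sqrtMax (vPost q.2 u ω) * f q.1 (vPost q.2 u ω))) ((hB.mul (hF hup)).mul (hF hvp))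
  have m2 := measurable_integral_integral (P := P × E3) (G := fun q u ω =>
    collisionKernel γ b (q.2 - u) ω * (sqrtMax u * f q.1 u) * (sqrtMax q.2 * f q.1 q.2))
      ((hB.mul (hF hu)).mul (hF hv))
  have m0 : Measurable fun q : P × E3 => sqrtMax q.2 := measurable_sqrtMax.comp measurable_snd
  unfold opGamma Qplus Qminus
  exact m0.inv.mul (m1.sub m2)

-- The involution `preToPost` preserves the collision measure and therefore null sets, so changing a
-- function on a null set of velocities is invisible at almost all post-collisional velocities.
omit hk in
lemma ae_post_congr {f g : E3 → ℝ} (hf : Measurable f) (hg : Measurable g) (h : f =ᵐ[volume] g) :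
    ∀ᵐ v : E3, ∀ᵐ u : E3, ∀ᵐ ω ∂sphereMeasure,
      f (uPost v u ω) = g (uPost v u ω) ∧ f (vPost v u ω) = g (vPost v u ω) := by
  have h1 : ∀ᵐ q ∂collisionMeasure, f q.2.2 = g q.2.2 ∧ f q.2.1 = g q.2.1 := by
    have e1 : ∀ᵐ p : E3 × E3, f p.2 = g p.2 ∧ f p.1 = g p.1 :=
      (Measure.quasiMeasurePreserving_snd.ae h).and (Measure.quasiMeasurePreserving_fst.ae h)
    exact Measure.quasiMeasurePreserving_snd.ae e1
  have h2 := measurePreserving_preToPost.quasiMeasurePreserving.ae h1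
  have hset : MeasurableSet {q : E3 × (E3 × S2) |
      f (uPost q.1 q.2.1 q.2.2) = g (uPost q.1 q.2.1 q.2.2) ∧
        f (vPost q.1 q.2.1 q.2.2) = g (vPost q.1 q.2.1 q.2.2)} :=
    (measurableSet_eq_fun (hf.comp measurable_uPost') (hg.comp measurable_uPost')).inter
      (measurableSet_eq_fun (hf.comp measurable_vPost') (hg.comp measurable_vPost'))
  have h3 : ∀ᵐ q ∂((volume : Measure E3).prod partnerMeasure),
      f (uPost q.1 q.2.1 q.2.2) = g (uPost q.1 q.2.1 q.2.2) ∧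
        f (vPost q.1 q.2.1 q.2.2) = g (vPost q.1 q.2.1 q.2.2) := by
    rw [← measurePreserving_regroup.map_eq,
      ae_map_iff measurePreserving_regroup.measurable.aemeasurable hset]
    exact h2
  exact (Measure.ae_ae_of_ae_prod h3).mono fun v hv => Measure.ae_ae_of_ae_prod hv

omit hk in
lemma opK_congr_ae {f g : E3 → ℝ} (hf : Measurable f) (hg : Measurable g) (h : f =ᵐ[volume] g) :
    opK γ b f =ᵐ[volume] opK γ b g := by
  filter_upwards [ae_post_congr hf hg h] with v hv
  unfold opK K1 K2
  congr 1
  · congr 1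
    · refine integral_congr_ae (hv.mono fun u hu => integral_congr_ae (hu.mono fun ω hω => ?_))
      simp only [hω.2]
    · refine integral_congr_ae (hv.mono fun u hu => integral_congr_ae (hu.mono fun ω hω => ?_))
      simp only [hω.1]
  · refine integral_congr_ae (h.mono fun u hu => ?_)
    simp only [hu]

omit hk in
lemma opGamma_congr_ae {f g : E3 → ℝ} (hf : Measurable f) (hg : Measurable g)
    (h : f =ᵐ[volume] g) : opGamma γ b f =ᵐ[volume] opGamma γ b g := by
  filter_upwards [ae_post_congr hf hg h, h] with v hv hv'
  unfold opGamma Qplus Qminus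
  congr 2
  · refine integral_congr_ae (hv.mono fun u hu => integral_congr_ae (hu.mono fun ω hω => ?_))
    simp only [hω.1, hω.2]
  · refine integral_congr_ae (h.mono fun u hu => ?_)
    simp only [hu, hv']

variable {c : ℝ} (hc : 0 ≤ c) {k A : ℝ} {g : E3 → ℝ}

omit hk in
lemma sqrtMax_eq_sqrtLoc (c : ℝ) : sqrtMax = fun v => Real.exp (c / 2) * sqrtLoc c v := by
  funext v
  rw [sqrtLoc_eq, ← mul_assoc, ← Real.exp_add]
  simp

omit hk in
include hc in
lemma sqrtMax_decays {k : ℝ} (hk : 0 < k) :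
    Decays c k (|Real.exp (c / 2)| * locConst k) sqrtMax := by
  rw [sqrtMax_eq_sqrtLoc c]
  exact (sqrtLoc_decays hc hk).const_mul _

lemma collisionFrequency_eq (v : E3) : collisionFrequency γ b v = lossOp γ b sqrtMax v := by
  have hi := integrable_loss hk le_rfl (sqrtMax_decays le_rfl zero_lt_one) zero_le_one v
  unfold collisionFrequency lossOp
  have e : ∀ (u : E3) (ω : S2), collisionKernel γ b (v - u) ω * maxwellian u =
      weightedKernel γ b v (u, ω) * sqrtMax u := by
    intro u ω
    rw [weightedKernel, mul_assoc, sqrtMax_mul_self]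
  simp only [e]
  exact integral_integral_eq (G := fun u ω => weightedKernel γ b v (u, ω) * sqrtMax u) hi

include hc

/-- The decay of g makes all integrals absolutely convergent, so the iterated integrals are
integrals over the product space. -/
lemma opK_eq (hg : Decays c k A g) (h1 : 1 ≤ k) (v : E3) : opK γ b g v =
    gainOp γ b sqrtMax g v + gainOp γ b g sqrtMax v - sqrtMax v * lossOp γ b g v := by
  have hm : Decays c k _ sqrtMax := sqrtMax_decays hc (by linarith : 0 < k)
  unfold opK K1 K2
  simp only [sqrt_maxwellian_mul]
  congr 1
  · congr 1
    · have e : ∀ (u : E3) (ω : S2), collisionKernel γ b (v - u) ω *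
          (sqrtMax u * sqrtMax (uPost v u ω)) * g (vPost v u ω) =
          weightedKernel γ b v (u, ω) * (sqrtMax (uPost v u ω) * g (vPost v u ω)) := by
        intro u ω; rw [weightedKernel]; ring
      simp only [e]
      exact integral_integral_eq (G := fun u ω => weightedKernel γ b v (u, ω) *
        (sqrtMax (uPost v u ω) * g (vPost v u ω))) (integrable_gain hk hc hm hg h1 v)
    · have e : ∀ (u : E3) (ω : S2), collisionKernel γ b (v - u) ω *
          (sqrtMax u * sqrtMax (vPost v u ω)) * g (uPost v u ω) =
          weightedKernel γ b v (u, ω) * (g (uPost v u ω) * sqrtMax (vPost v u ω)) := by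
        intro u ω; rw [weightedKernel]; ring
      simp only [e]
      exact integral_integral_eq (G := fun u ω => weightedKernel γ b v (u, ω) *
        (g (uPost v u ω) * sqrtMax (vPost v u ω))) (integrable_gain hk hc hg hm h1 v)
  · have e : ∀ (u : E3) (ω : S2), collisionKernel γ b (v - u) ω *
        (sqrtMax v * sqrtMax u) * g u = sqrtMax v * (weightedKernel γ b v (u, ω) * g u) := by
      intro u ω; rw [weightedKernel]; ring
    simp only [e, integral_const_mul]
    congr 1
    exact integral_integral_eq (G := fun u ω => weightedKernel γ b v (u, ω) * g u)
      (integrable_loss hk hc hg (by linarith) v)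

lemma opGamma_eq (hg : Decays c k A g) (h1 : 1 ≤ k) (v : E3) :
    opGamma γ b g v = gainOp γ b g g v - g v * lossOp γ b g v := by
  have hpos := (sqrtMax_pos v).ne'
  have e1 : Qplus γ b (fun u => √(maxwellian u) * g u) (fun u => √(maxwellian u) * g u) v =
      sqrtMax v * gainOp γ b g g v := by
    unfold Qplus
    have e : ∀ (u : E3) (ω : S2), collisionKernel γ b (v - u) ω *
        (√(maxwellian (uPost v u ω)) * g (uPost v u ω)) *
          (√(maxwellian (vPost v u ω)) * g (vPost v u ω)) =
        sqrtMax v * (weightedKernel γ b v (u, ω) * (g (uPost v u ω) * g (vPost v u ω))) := by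
      intro u ω
      have := sqrtMax_post v u ω
      rw [weightedKernel]
      change collisionKernel γ b (v - u) ω * (sqrtMax (uPost v u ω) * g (uPost v u ω)) *
        (sqrtMax (vPost v u ω) * g (vPost v u ω)) = _
      linear_combination (collisionKernel γ b (v - u) ω * g (uPost v u ω) * g (vPost v u ω)) * this
    simp only [e, integral_const_mul]
    congr 1
    exact integral_integral_eq (G := fun u ω => weightedKernel γ b v (u, ω) *
      (g (uPost v u ω) * g (vPost v u ω))) (integrable_gain hk hc hg hg h1 v)
  have e2 : Qminus γ b (fun u => √(maxwellian u) * g u) (fun u => √(maxwellian u) * g u) v =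
      sqrtMax v * (g v * lossOp γ b g v) := by
    unfold Qminus
    have e : ∀ (u : E3) (ω : S2), collisionKernel γ b (v - u) ω *
        (√(maxwellian u) * g u) * (√(maxwellian v) * g v) =
        (sqrtMax v * g v) * (weightedKernel γ b v (u, ω) * g u) := by
      intro u ω
      rw [weightedKernel, sqrtMax, sqrtMax]
      ring
    simp only [e, integral_const_mul]
    rw [← mul_assoc]
    congr 1
    exact integral_integral_eq (G := fun u ω => weightedKernel γ b v (u, ω) * g u)
      (integrable_loss hk hc hg (by linarith) v)
  rw [opGamma, e1, e2, ← mul_sub, ← mul_assoc]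
  change (sqrtMax v)⁻¹ * sqrtMax v * _ = _
  rw [inv_mul_cancel₀ hpos, one_mul]

omit hk hc in
lemma lossOp_sqrtLoc_eq (v : E3) :
    lossOp γ b (sqrtLoc c) v = Real.exp (-(c / 2)) * lossOp γ b sqrtMax v := by
  rw [← lossOp_const_mul]
  congr 1
  funext v; exact sqrtLoc_eq c v

/-- The damped form of the equation and the collision operator. -/
lemma opK_add_opGamma_sub (hg : Decays c k A g) (h1 : 1 ≤ k) (v : E3) :
    Real.exp (-c) * opK γ b g v + Real.exp (-c / 2) * opGamma γ b g v -
      Real.exp (-c) * collisionFrequency γ b v * g v =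
    collOp γ b c (fun v => sqrtLoc c v + g v) v := by
  have hm : Decays c k (locConst k) (sqrtLoc c) := sqrtLoc_decays hc (by linarith)
  rw [collOp_eq_src_sub_rate hk hc hg h1, opK_eq hk hc hg h1, opGamma_eq hk hc hg h1,
    collisionFrequency_eq hk]
  unfold collSrc collRate
  rw [lossOp_add hk hc hm hg (by linarith), lossOp_sqrtLoc_eq]
  have hs : sqrtLoc c = fun v => Real.exp (-(c / 2)) * sqrtMax v := funext (sqrtLoc_eq c)
  rw [hs, gainOp_const_mul_left, gainOp_const_mul_right]
  have he : Real.exp (-c) = Real.exp (-(c / 2)) * Real.exp (-(c / 2)) := by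
    rw [← Real.exp_add]; congr 1; ring
  rw [he, neg_div]
  ring

-- The damping in the mild formulation is the collision rate of the zero perturbation, hence
-- nonnegative and covered by the estimates for `collRate`.
omit hc in
lemma damping_eq_collRate (v : E3) :
    Real.exp (-c) * collisionFrequency γ b v = collRate γ b c (fun _ => 0) v := by
  rw [collisionFrequency_eq hk, collRate]
  simp only [add_zero]
  rw [show (fun v => sqrtLoc c v) = sqrtLoc c from rfl, lossOp_sqrtLoc_eq, ← mul_assoc,
    ← Real.exp_add]
  congr 2; ring

end OperatorIdentities

/-! ### Functions along characteristics -/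

/-- The assumptions on the potential. -/
structure AdmissiblePotential (Φ : E3 → ℝ) : Prop where
  contDiff : ContDiff ℝ 3 Φ
  periodic : IsPeriodic Φ
  nonneg : ∀ x, 0 ≤ Φ x

lemma AdmissiblePotential.measurable {Φ : E3 → ℝ} (hΦ : AdmissiblePotential Φ) : Measurable Φ :=
  hΦ.contDiff.continuous.measurable

/-- The values of `G` along the characteristic that starts at `z`. -/
def along (Φ : E3 → ℝ) (G : ℝ → E3 → E3 → ℝ) (z : E3 × E3) (s : ℝ) : ℝ :=
  G s (flow Φ s z).1 (flow Φ s z).2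

/-- Joint measurability of a function of time, position and velocity. -/
abbrev FieldMeasurable (G : ℝ → E3 → E3 → ℝ) : Prop :=
  Measurable fun p : ℝ × E3 × E3 => G p.1 p.2.1 p.2.2

/-- Measurable periodic fields with polynomial decay in the energy. -/
structure PhaseDecays (Φ : E3 → ℝ) (k A : ℝ) (f : ℝ → E3 → E3 → ℝ) : Prop where
  measurable : FieldMeasurable f
  periodic : ∀ t, IsPeriodic (f t)
  bound : ∀ t x v, |f t x v| ≤ A * en (Φ x) v ^ (-(k / 2))

lemma FieldMeasurable.velocity {f : ℝ → E3 → E3 → ℝ} (hf : FieldMeasurable f) (t : ℝ) (x : E3) :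
    Measurable (f t x) :=
  hf.comp (f := fun v => (t, x, v)) (by fun_prop)

lemma FieldMeasurable.phase {f : ℝ → E3 → E3 → ℝ} (hf : FieldMeasurable f) (t : ℝ) :
    Measurable fun z : E3 × E3 => f t z.1 z.2 :=
  hf.comp (f := fun z : E3 × E3 => (t, z)) (by fun_prop)

lemma PhaseDecays.decays {Φ : E3 → ℝ} {k A : ℝ} {f : ℝ → E3 → E3 → ℝ} (hf : PhaseDecays Φ k A f)
    (t : ℝ) (x : E3) : Decays (Φ x) k A (f t x) :=
  ⟨hf.measurable.velocity t x, hf.bound t x⟩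

section Along

variable {Φ : E3 → ℝ} (hΦ : AdmissiblePotential Φ)

include hΦ

/-- Together with `sqrtLoc_flow` this lets weights pass unchanged through time integrals along
characteristics. -/
lemma en_flow (s : ℝ) (z : E3 × E3) :
    en (Φ (flow Φ s z).1) (flow Φ s z).2 = en (Φ z.1) z.2 := by
  unfold en; rw [flow_energy hΦ.contDiff hΦ.periodic]

lemma sqrtLoc_flow (s : ℝ) (z : E3 × E3) :
    sqrtLoc (Φ (flow Φ s z).1) (flow Φ s z).2 = sqrtLoc (Φ z.1) z.2 := by
  unfold sqrtLoc; rw [flow_energy hΦ.contDiff hΦ.periodic]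

lemma measurable_along {G : ℝ → E3 → E3 → ℝ} (hG : FieldMeasurable G) :
    Measurable fun q : (E3 × E3) × ℝ => along Φ G q.1 q.2 := by
  have h1 : Measurable fun q : (E3 × E3) × ℝ => flow Φ q.2 q.1 :=
    (measurable_flow hΦ.contDiff hΦ.periodic).comp
      (g := fun p : ℝ × (E3 × E3) => flow Φ p.1 p.2) measurable_swap
  exact hG.comp (f := fun q : (E3 × E3) × ℝ => (q.2, flow Φ q.2 q.1)) (measurable_snd.prodMk h1)

lemma measurable_along_time {G : ℝ → E3 → E3 → ℝ} (hG : FieldMeasurable G) (z : E3 × E3) :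
    Measurable (along Φ G z) :=
  (measurable_along hΦ hG).comp (f := fun s => (z, s)) (by fun_prop)

lemma IsPeriodic.comp_flow {α : Type*} {h : E3 × E3 → α} (hh : IsPeriodic fun x v => h (x, v))
    (s : ℝ) : IsPeriodic fun x v => h (flow Φ s (x, v)) := by
  intro i x
  funext v
  have h1 : EuclideanSpace.single i (1 : ℝ) = latticeVec (Pi.single i 1) := by
    ext j
    by_cases h : j = i
    · subst h; simp [latticeVec]
    · simp [latticeVec, h]
  have h2 := flow_add_latticeVec hΦ.contDiff hΦ.periodic s (x, v) (Pi.single i 1)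
  rw [Prod.mk_add_mk, add_zero, ← h1] at h2
  have h3 := congrFun (hh i (flow Φ s (x, v)).1) (flow Φ s (x, v)).2
  simp only [h2]
  refine Eq.trans ?_ h3
  congr 1
  simp [Prod.ext_iff]

lemma along_shift {G : ℝ → E3 → E3 → ℝ} (hG : ∀ t, IsPeriodic (G t)) (i : Fin 3) (x v : E3) :
    along Φ G (x + EuclideanSpace.single i 1, v) = along Φ G (x, v) := by
  funext s
  exact congrFun (IsPeriodic.comp_flow hΦ (h := fun z => G s z.1 z.2) (hG s) s i x) v

lemma intervalIntegrable_along {G : ℝ → E3 → E3 → ℝ} (hG : FieldMeasurable G) {Q p : ℝ}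
    (hb : ∀ s x v, |G s x v| ≤ Q * en (Φ x) v ^ p) (z : E3 × E3) (a b : ℝ) :
    IntervalIntegrable (along Φ G z) volume a b := by
  refine (intervalIntegrable_const (c := Q * en (Φ z.1) z.2 ^ p)).mono_fun
    (measurable_along_time hΦ hG z).aestronglyMeasurable (Eventually.of_forall fun s => ?_)
  rw [Real.norm_eq_abs]
  refine (hb s _ _).trans ?_
  rw [en_flow hΦ]
  exact le_abs_self _

end Along

/-! ### The fields entering the equation -/

/-- The source term as a field. -/
def srcField (γ : ℝ) (b : ℝ → ℝ) (Φ : E3 → ℝ) (f : ℝ → E3 → E3 → ℝ) (s : ℝ) (x v : E3) : ℝ :=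
  collSrc γ b (Φ x) (f s x) v

/-- The collision rate as a field. -/
def rateField (γ : ℝ) (b : ℝ → ℝ) (Φ : E3 → ℝ) (f : ℝ → E3 → E3 → ℝ) (s : ℝ) (x v : E3) : ℝ :=
  collRate γ b (Φ x) (f s x) v

/-- The collision operator as a field. -/
def collField (γ : ℝ) (b : ℝ → ℝ) (Φ : E3 → ℝ) (f : ℝ → E3 → E3 → ℝ) (s : ℝ) (x v : E3) : ℝ :=
  collOp γ b (Φ x) (fun v => sqrtLoc (Φ x) v + f s x v) v

/-- The damping coefficient as a field. -/
def dampField (γ : ℝ) (b : ℝ → ℝ) (Φ : E3 → ℝ) (_s : ℝ) (x v : E3) : ℝ :=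
  Real.exp (-Φ x) * collisionFrequency γ b v

/-- The linear term of the damped equation as a field. -/
def linField (γ : ℝ) (b : ℝ → ℝ) (Φ : E3 → ℝ) (f : ℝ → E3 → E3 → ℝ) (s : ℝ) (x v : E3) : ℝ :=
  Real.exp (-Φ x) * opK γ b (f s x) v

/-- The quadratic term of the damped equation as a field. -/
def quadField (γ : ℝ) (b : ℝ → ℝ) (Φ : E3 → ℝ) (f : ℝ → E3 → E3 → ℝ) (s : ℝ) (x v : E3) : ℝ :=
  Real.exp (-Φ x / 2) * opGamma γ b (f s x) v

section Fields

variable {γ : ℝ} {b : ℝ → ℝ} {Cb : ℝ} (hk : AdmissibleKernel γ b Cb)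
  {Φ : E3 → ℝ} (hΦ : AdmissiblePotential Φ) {f : ℝ → E3 → E3 → ℝ} {k A : ℝ}

include hk hΦ

omit hk in
lemma fieldMeasurable_sqrtLoc : FieldMeasurable fun _ x v => sqrtLoc (Φ x) v := by
  have := hΦ.measurable
  unfold FieldMeasurable sqrtLoc
  fun_prop

omit hk in
lemma measurable_en : Measurable fun z : E3 × E3 => en (Φ z.1) z.2 := by
  have := hΦ.measurable
  unfold en; fun_prop

omit hk hΦ in
lemma fieldMeasurable_regroup {g : ℝ → E3 → E3 → ℝ} :
    FieldMeasurable g ↔ Measurable fun q : (ℝ × E3) × E3 => g q.1.1 q.1.2 q.2 := by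
  constructor
  · intro h
    exact h.comp (f := fun q : (ℝ × E3) × E3 => (q.1.1, q.1.2, q.2)) (by fun_prop)
  · intro h
    exact h.comp (f := fun p : ℝ × E3 × E3 => ((p.1, p.2.1), p.2.2)) (by fun_prop)

omit hk in
lemma measurable_exp_half : Measurable fun q : (ℝ × E3) × E3 => Real.exp (-(Φ q.1.2 / 2)) := by
  have := hΦ.measurable
  fun_prop

lemma fieldMeasurable_coll {h : ℝ → E3 → E3 → ℝ} (hh : FieldMeasurable h) :
    FieldMeasurable fun s x v => collOp γ b (Φ x) (h s x) v := by
  have h1 := fieldMeasurable_regroup.1 hh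
  refine fieldMeasurable_regroup.2 ?_
  unfold collOp
  exact (measurable_exp_half hΦ).mul
    ((measurable_gainOp (P := ℝ × E3) (f := fun q => h q.1 q.2) (g := fun q => h q.1 q.2)
      hk h1 h1).sub
      (h1.mul (measurable_lossOp (P := ℝ × E3) (f := fun q => h q.1 q.2) hk h1)))

lemma fieldMeasurable_collField (hf : FieldMeasurable f) :
    FieldMeasurable (collField γ b Φ f) :=
  fieldMeasurable_coll hk hΦ (h := fun s x v => sqrtLoc (Φ x) v + f s x v)
    ((fieldMeasurable_sqrtLoc hΦ).add hf)

lemma fieldMeasurable_rateField (hf : FieldMeasurable f) :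
    FieldMeasurable (rateField γ b Φ f) := by
  have h1 := (fieldMeasurable_regroup (g := fun s x v => sqrtLoc (Φ x) v + f s x v)).1
    ((fieldMeasurable_sqrtLoc hΦ).add hf)
  refine fieldMeasurable_regroup.2 ?_
  unfold rateField collRate
  exact (measurable_exp_half hΦ).mul (measurable_lossOp (P := ℝ × E3)
    (f := fun q v => sqrtLoc (Φ q.2) v + f q.1 q.2 v) hk h1)

lemma fieldMeasurable_srcField (hf : FieldMeasurable f) :
    FieldMeasurable (srcField γ b Φ f) := by
  have h1 := fieldMeasurable_regroup.1 hf
  have h2 := fieldMeasurable_regroup.1 (fieldMeasurable_sqrtLoc hΦ)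
  have m1 := measurable_gainOp (P := ℝ × E3) (f := fun q v => sqrtLoc (Φ q.2) v)
    (g := fun q => f q.1 q.2) hk h2 h1
  have m2 := measurable_gainOp (P := ℝ × E3) (f := fun q => f q.1 q.2)
    (g := fun q v => sqrtLoc (Φ q.2) v) hk h1 h2
  have m3 := measurable_gainOp (P := ℝ × E3) (f := fun q => f q.1 q.2)
    (g := fun q => f q.1 q.2) hk h1 h1
  have m4 := measurable_lossOp (P := ℝ × E3) (f := fun q => f q.1 q.2) hk h1
  refine fieldMeasurable_regroup.2 ?_
  unfold srcField collSrc
  exact (measurable_exp_half hΦ).mul (((m1.add m2).add m3).sub (h2.mul m4))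

lemma fieldMeasurable_linField (hf : FieldMeasurable f) : FieldMeasurable (linField γ b Φ f) := by
  have h1 := fieldMeasurable_regroup.1 hf
  have := hΦ.measurable
  refine fieldMeasurable_regroup.2 ?_
  exact (by fun_prop : Measurable fun q : (ℝ × E3) × E3 => Real.exp (-Φ q.1.2)).mul
    (measurable_opK (P := ℝ × E3) (f := fun q => f q.1 q.2) hk h1)

lemma fieldMeasurable_quadField (hf : FieldMeasurable f) :
    FieldMeasurable (quadField γ b Φ f) := by
  have h1 := fieldMeasurable_regroup.1 hf
  have := hΦ.measurable
  refine fieldMeasurable_regroup.2 ?_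
  exact (by fun_prop : Measurable fun q : (ℝ × E3) × E3 => Real.exp (-Φ q.1.2 / 2)).mul
    (measurable_opGamma (P := ℝ × E3) (f := fun q => f q.1 q.2) hk h1)

omit hΦ in
lemma dampField_eq : dampField γ b Φ = rateField γ b Φ fun _ _ _ => 0 := by
  funext s x v
  exact damping_eq_collRate hk v

lemma fieldMeasurable_dampField : FieldMeasurable (dampField γ b Φ) := by
  rw [dampField_eq hk]
  exact fieldMeasurable_rateField hk hΦ measurable_const

omit hk in
lemma fields_periodic (hf : ∀ t, IsPeriodic (f t)) (t : ℝ) :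
    IsPeriodic (srcField γ b Φ f t) ∧ IsPeriodic (rateField γ b Φ f t) ∧
      IsPeriodic (collField γ b Φ f t) ∧ IsPeriodic (dampField γ b Φ t) ∧
      IsPeriodic (linField γ b Φ f t) ∧ IsPeriodic (quadField γ b Φ f t) := by
  refine ⟨?_, ?_, ?_, ?_, ?_, ?_⟩ <;> intro i x <;> funext v <;>
    simp only [srcField, rateField, collField, dampField, linField, quadField, hΦ.periodic i x,
      hf t i x]

variable (hf : PhaseDecays Φ k A f) (h1 : 1 ≤ k)

include hf h1

lemma collField_eq (s : ℝ) (x v : E3) : collField γ b Φ f s x v =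
    srcField γ b Φ f s x v - rateField γ b Φ f s x v * f s x v :=
  collOp_eq_src_sub_rate hk (hΦ.nonneg x) (hf.decays s x) h1 v

lemma collField_eq_damped (s : ℝ) (x v : E3) : collField γ b Φ f s x v =
    linField γ b Φ f s x v + quadField γ b Φ f s x v - dampField γ b Φ s x v * f s x v :=
  (opK_add_opGamma_sub hk (hΦ.nonneg x) (hf.decays s x) h1 v).symm

lemma quadField_eq (s : ℝ) (x v : E3) : quadField γ b Φ f s x v =
    collOp γ b (Φ x) (f s x) v := by
  rw [quadField, opGamma_eq hk (hΦ.nonneg x) (hf.decays s x) h1, collOp, neg_div]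

omit hf in
lemma abs_dampField_le (s : ℝ) (x v : E3) :
    |dampField γ b Φ s x v| ≤ 2 * lossConst Cb * (locConst k + 0) * en (Φ x) v ^ (1 / 2 : ℝ) := by
  rw [dampField_eq hk]
  exact abs_collRate_le hk (hΦ.nonneg x) Decays.zero h1 v

lemma abs_srcField_le (s : ℝ) (x v : E3) :
    |srcField γ b Φ f s x v| ≤ srcConst Cb k * (A * (1 + A)) * en (Φ x) v ^ (-(k / 2)) :=
  abs_collSrc_le hk (hΦ.nonneg x) (hf.decays s x) h1 v

lemma abs_rateField_le (s : ℝ) (x v : E3) :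
    |rateField γ b Φ f s x v| ≤ 2 * lossConst Cb * (locConst k + A) * en (Φ x) v ^ (1 / 2 : ℝ) :=
  abs_collRate_le hk (hΦ.nonneg x) (hf.decays s x) h1 v

omit hk in
lemma decays_total (s : ℝ) (x : E3) :
    Decays (Φ x) k (locConst k + A) (fun v => sqrtLoc (Φ x) v + f s x v) :=
  (sqrtLoc_decays (hΦ.nonneg x) (by linarith)).add (hf.decays s x)

lemma abs_collField_le (s : ℝ) (x v : E3) :
    |collField γ b Φ f s x v| ≤ collConst Cb k * (locConst k + A) ^ 2 * en (Φ x) v ^ (1 / 2 : ℝ) :=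
  abs_collOp_le hk (hΦ.nonneg x) (decays_total hΦ hf h1 s x) h1 v

lemma abs_quadField_le (s : ℝ) (x v : E3) :
    |quadField γ b Φ f s x v| ≤ collConst Cb k * A ^ 2 * en (Φ x) v ^ (1 / 2 : ℝ) := by
  rw [quadField_eq hk hΦ hf h1]
  exact abs_collOp_le hk (hΦ.nonneg x) (hf.decays s x) h1 v

/-- The damped identity is solved for the linear term, so `opK` needs no estimate of its own. Only
integrability along characteristics is at stake. -/
lemma abs_linField_le (s : ℝ) (x v : E3) :
    |linField γ b Φ f s x v| ≤ (collConst Cb k * (locConst k + A) ^ 2 + collConst Cb k * A ^ 2 +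
      2 * lossConst Cb * (locConst k + 0) * A) * en (Φ x) v ^ (1 / 2 : ℝ) := by
  have e := collField_eq_damped hk hΦ hf h1 s x v
  have b1 := abs_collField_le hk hΦ hf h1 s x v
  have b2 := abs_quadField_le hk hΦ hf h1 s x v
  have b3 := abs_dampField_le hk hΦ h1 s x v
  have b4 := (hf.decays s x).abs_le (hΦ.nonneg x) (by linarith) v
  have hA := (hf.decays s x).nonneg (hΦ.nonneg x)
  have e2 : linField γ b Φ f s x v = collField γ b Φ f s x v - quadField γ b Φ f s x v +
      dampField γ b Φ s x v * f s x v := by rw [e]; ring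
  rw [e2]
  have b5 : |dampField γ b Φ s x v * f s x v| ≤
      2 * lossConst Cb * (locConst k + 0) * en (Φ x) v ^ (1 / 2 : ℝ) * A := by
    rw [abs_mul]
    exact mul_le_mul b3 b4 (abs_nonneg _) ((abs_nonneg _).trans b3)
  refine (abs_add_le _ _).trans ?_
  have := abs_sub (collField γ b Φ f s x v) (quadField γ b Φ f s x v)
  nlinarith

end Fields

/-! ### The mild formulation along characteristics -/

/-- The right hand side of the damped equation along the characteristic through `z`. -/
def dampedRHS (γ : ℝ) (b : ℝ → ℝ) (Φ : E3 → ℝ) (f₀ : E3 → E3 → ℝ) (f : ℝ → E3 → E3 → ℝ)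
    (z : E3 × E3) (t : ℝ) : ℝ :=
  Real.exp (-∫ τ in (0 : ℝ)..t, along Φ (dampField γ b Φ) z τ) * (f₀ z.1 z.2 +
    ∫ s in (0 : ℝ)..t, Real.exp (∫ τ in (0 : ℝ)..s, along Φ (dampField γ b Φ) z τ) *
      (along Φ (linField γ b Φ f) z s + along Φ (quadField γ b Φ f) z s))

section Mild

variable {γ : ℝ} {b : ℝ → ℝ} {Cb : ℝ} (hk : AdmissibleKernel γ b Cb)
  {Φ : E3 → ℝ} (hΦ : AdmissiblePotential Φ) {f₀ : E3 → E3 → ℝ} {f : ℝ → E3 → E3 → ℝ} {k A : ℝ}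

include hk hΦ

omit hk in
lemma characteristic_flow (t s : ℝ) (z : E3 × E3) :
    characteristic Φ t (flow Φ t z).1 (flow Φ t z).2 s = flow Φ s z := by
  rw [characteristic_eq_flow hΦ.contDiff hΦ.periodic, ← flow_add hΦ.contDiff hΦ.periodic]
  simp

variable (hf : PhaseDecays Φ k A f) (h1 : 1 ≤ k)

include hf h1

lemma intervalIntegrable_fields (z : E3 × E3) (c d : ℝ) :
    IntervalIntegrable (along Φ (dampField γ b Φ) z) volume c d ∧
    IntervalIntegrable (along Φ (linField γ b Φ f) z) volume c d ∧
    IntervalIntegrable (along Φ (quadField γ b Φ f) z) volume c d ∧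
    IntervalIntegrable (along Φ (collField γ b Φ f) z) volume c d ∧
    IntervalIntegrable (along Φ (srcField γ b Φ f) z) volume c d ∧
    IntervalIntegrable (along Φ (rateField γ b Φ f) z) volume c d :=
  ⟨intervalIntegrable_along hΦ (fieldMeasurable_dampField hk hΦ) (abs_dampField_le hk hΦ h1) z c d,
    intervalIntegrable_along hΦ (fieldMeasurable_linField hk hΦ hf.measurable)
      (abs_linField_le hk hΦ hf h1) z c d,
    intervalIntegrable_along hΦ (fieldMeasurable_quadField hk hΦ hf.measurable)
      (abs_quadField_le hk hΦ hf h1) z c d,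
    intervalIntegrable_along hΦ (fieldMeasurable_collField hk hΦ hf.measurable)
      (abs_collField_le hk hΦ hf h1) z c d,
    intervalIntegrable_along hΦ (fieldMeasurable_srcField hk hΦ hf.measurable)
      (abs_srcField_le hk hΦ hf h1) z c d,
    intervalIntegrable_along hΦ (fieldMeasurable_rateField hk hΦ hf.measurable)
      (abs_rateField_le hk hΦ hf h1) z c d⟩

/-- Parametrizing the endpoint as w = flow t z makes the characteristic through w at time t equal to
s ↦ flow s z. The foot point z then no longer depends on t, and the formula becomes an integrating
factor formula in t. -/
lemma mild_rhs_eq {t : ℝ} (ht : 0 ≤ t) (z w : E3 × E3) (hw : w = flow Φ t z) :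
    Real.exp (-∫ τ in (0 : ℝ)..t, damping γ b Φ t w.1 w.2 τ) *
          f₀ (charX Φ t w.1 w.2 0) (charV Φ t w.1 w.2 0) +
      (∫ s in (0 : ℝ)..t,
        Real.exp (-(∫ τ in s..t, damping γ b Φ t w.1 w.2 τ) - Φ (charX Φ t w.1 w.2 s)) *
          opK γ b (f s (charX Φ t w.1 w.2 s)) (charV Φ t w.1 w.2 s)) +
      ∫ s in (0 : ℝ)..t,
        Real.exp (-(∫ τ in s..t, damping γ b Φ t w.1 w.2 τ) - Φ (charX Φ t w.1 w.2 s) / 2) *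
          opGamma γ b (f s (charX Φ t w.1 w.2 s)) (charV Φ t w.1 w.2 s) =
    dampedRHS γ b Φ f₀ f z t := by
  subst hw
  obtain ⟨iD, iL, iQ, -⟩ := intervalIntegrable_fields hk hΦ hf h1 z 0 t
  have htt : t ∈ Icc 0 t := ⟨ht, le_rfl⟩
  have eD : ∀ τ, damping γ b Φ t (flow Φ t z).1 (flow Φ t z).2 τ =
      along Φ (dampField γ b Φ) z τ := by
    intro τ
    simp only [damping, charX, charV, characteristic_flow hΦ, along, dampField]
  have eL : ∀ s, Real.exp (-(∫ τ in s..t, along Φ (dampField γ b Φ) z τ) - Φ (flow Φ s z).1) *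
      opK γ b (f s (flow Φ s z).1) (flow Φ s z).2 =
      Real.exp (-∫ τ in s..t, along Φ (dampField γ b Φ) z τ) * along Φ (linField γ b Φ f) z s := by
    intro s
    rw [sub_eq_add_neg, Real.exp_add, along, linField]; ring
  have eQ : ∀ s, Real.exp (-(∫ τ in s..t, along Φ (dampField γ b Φ) z τ) - Φ (flow Φ s z).1 / 2) *
      opGamma γ b (f s (flow Φ s z).1) (flow Φ s z).2 =
      Real.exp (-∫ τ in s..t, along Φ (dampField γ b Φ) z τ) *
        along Φ (quadField γ b Φ f) z s := by
    intro s
    rw [sub_eq_add_neg, Real.exp_add, along, quadField, neg_div]; ring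
  simp only [eD]
  simp only [charX, charV, characteristic_flow hΦ, flow_zero hΦ.contDiff hΦ.periodic, eL, eQ]
  have d1 := duhamel_two_time (y₀ := f₀ z.1 z.2) (S := along Φ (linField γ b Φ f) z) iD htt
  have d2 := duhamel_two_time (y₀ := 0) (S := along Φ (quadField γ b Φ f) z) iD htt
  rw [mul_zero, zero_add, zero_add] at d2
  rw [← d1, ← d2, dampedRHS, ← mul_add, add_assoc, ← intervalIntegral.integral_add
    (intervalIntegrable_exp_mul iD iL) (intervalIntegrable_exp_mul iD iQ)]
  simp only [mul_add]

/-- A mild solution satisfies the damped equation along almost every characteristic. -/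
lemma mild_iff (hp₀ : IsPeriodic f₀) {T : ℝ} :
    IsMildSolution γ b Φ T f₀ f ↔
      ∀ t ∈ Icc 0 T, ∀ᵐ z ∂phaseMeasure, along Φ f z t = dampedRHS γ b Φ f₀ f z t := by
  have hper : ∀ t, IsPeriodic fun x v => along Φ f (x, v) t = dampedRHS γ b Φ f₀ f (x, v) t := by
    intro t i x
    funext v
    have fp := fun t => fields_periodic (γ := γ) (b := b) hΦ hf.periodic t
    simp only [dampedRHS]
    rw [along_shift hΦ hf.periodic, along_shift hΦ (fun t => (fp t).2.2.2.1),
      along_shift hΦ (fun t => (fp t).2.2.2.2.1), along_shift hΦ (fun t => (fp t).2.2.2.2.2),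
      hp₀ i x]
  have hpt : ∀ t z, along Φ f (flow Φ (-t) z) t = f t z.1 z.2 := by
    intro t z
    rw [along, flow_flow_neg hΦ.contDiff hΦ.periodic]
  constructor
  · intro h t ht
    have h2 : ∀ᵐ z ∂phaseMeasure, along Φ f (flow Φ (-t) z) t =
        dampedRHS γ b Φ f₀ f (flow Φ (-t) z) t := by
      filter_upwards [h.mild t ht] with z hz
      rw [hpt, ← mild_rhs_eq hk hΦ hf h1 ht.1 _ z
        (flow_flow_neg hΦ.contDiff hΦ.periodic t z).symm]
      exact hz
    -- The exceptional set at time t is carried to the foot points by the flow, which preserves null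
    -- sets.
    have h3 := ae_phase_flow hΦ.contDiff hΦ.periodic
      (P := fun z => along Φ f (flow Φ (-t) z) t = dampedRHS γ b Φ f₀ f (flow Φ (-t) z) t)
      (IsPeriodic.comp_flow hΦ (h := fun z => along Φ f z t = dampedRHS γ b Φ f₀ f z t)
        (hper t) (-t)) h2 t
    filter_upwards [h3] with z hz
    rwa [flow_neg_flow hΦ.contDiff hΦ.periodic] at hz
  · intro h
    refine ⟨hf.measurable, hf.periodic, fun t ht => ?_⟩
    filter_upwards [ae_phase_flow hΦ.contDiff hΦ.periodic (hper t) (h t ht) (-t)] with z hz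
    rw [hpt] at hz
    rw [hz, ← mild_rhs_eq hk hΦ hf h1 ht.1 _ z
        (flow_flow_neg hΦ.contDiff hΦ.periodic t z).symm]

end Mild

/-! ### Integrated form of the equation -/

/-- Joint measurability in the parameter and the endpoint: both orientations of the integral are
written as integrals over the whole line of indicators depending measurably on the endpoint. -/
lemma measurable_primitive {Z : Type*} [MeasurableSpace Z] {G : Z → ℝ → ℝ}
    (hG : Measurable fun q : Z × ℝ => G q.1 q.2) :
    Measurable fun q : Z × ℝ => ∫ s in (0 : ℝ)..q.2, G q.1 s := by
  have key : ∀ S : Set ((Z × ℝ) × ℝ), MeasurableSet S →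
      Measurable fun q : Z × ℝ => ∫ s, S.indicator (fun r => G r.1.1 r.2) (q, s) := by
    intro S hS
    refine (StronglyMeasurable.integral_prod_right (ν := (volume : Measure ℝ))
      (f := fun (q : Z × ℝ) (s : ℝ) => S.indicator (fun r => G r.1.1 r.2) (q, s)) ?_).measurable
    refine Measurable.stronglyMeasurable ?_
    exact (hG.comp (f := fun r : (Z × ℝ) × ℝ => (r.1.1, r.2)) (by fun_prop)).indicator hS
  have m1 := key {r | 0 < r.2 ∧ r.2 ≤ r.1.2}
    ((measurableSet_lt measurable_const measurable_snd).inter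
      (measurableSet_le measurable_snd (measurable_snd.comp measurable_fst)))
  have m2 := key {r | r.1.2 < r.2 ∧ r.2 ≤ 0}
    ((measurableSet_lt (measurable_snd.comp measurable_fst) measurable_snd).inter
      (measurableSet_le measurable_snd measurable_const))
  convert m1.sub m2 using 2 with q
  simp only [intervalIntegral]
  rw [← integral_indicator measurableSet_Ioc, ← integral_indicator measurableSet_Ioc]
  rfl

section IntegralForm

variable {γ : ℝ} {b : ℝ → ℝ} {Cb : ℝ} (hk : AdmissibleKernel γ b Cb)
  {Φ : E3 → ℝ} (hΦ : AdmissiblePotential Φ) {f₀ f₀' : E3 → E3 → ℝ} {f f' : ℝ → E3 → E3 → ℝ}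
  {k A T : ℝ}

include hk hΦ

lemma measurable_dampedRHS (hm₀ : Measurable fun z : E3 × E3 => f₀ z.1 z.2)
    (hf : FieldMeasurable f) :
    Measurable fun q : (E3 × E3) × ℝ => dampedRHS γ b Φ f₀ f q.1 q.2 := by
  have m1 := measurable_primitive (measurable_along hΦ (fieldMeasurable_dampField hk hΦ))
  have m2 := measurable_along hΦ (fieldMeasurable_linField hk hΦ hf)
  have m3 := measurable_along hΦ (fieldMeasurable_quadField hk hΦ hf)
  have m4 := measurable_primitive (G := fun z s =>
    Real.exp (∫ τ in (0 : ℝ)..s, along Φ (dampField γ b Φ) z τ) *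
      (along Φ (linField γ b Φ f) z s + along Φ (quadField γ b Φ f) z s))
      (m1.exp.mul (m2.add m3))
  exact m1.neg.exp.mul ((hm₀.comp measurable_fst).add m4)

section Integrated

variable (hf : PhaseDecays Φ k A f) (h1 : 1 ≤ k)

include hf h1

/-- On a given characteristic a mild solution may agree with the right side only for almost every
time. That suffices under the integral, and `dampedRHS` then satisfies the integrated equation at
every time. -/
lemma dampedRHS_eq_integral {z : E3 × E3}
    (hz : ∀ᵐ s, s ∈ Icc 0 T → along Φ f z s = dampedRHS γ b Φ f₀ f z s) :
    ∀ t ∈ Icc 0 T, dampedRHS γ b Φ f₀ f z t =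
      f₀ z.1 z.2 + ∫ s in (0 : ℝ)..t, along Φ (collField γ b Φ f) z s := by
  intro t ht
  obtain ⟨iD, iL, iQ, -⟩ := intervalIntegrable_fields hk hΦ hf h1 z 0 T
  rw [integral_of_duhamel (y := dampedRHS γ b Φ f₀ f z) (y₀ := f₀ z.1 z.2) iD (iL.add iQ)
    (fun t _ => rfl) t ht]
  congr 1
  apply intervalIntegral.integral_congr_ae
  filter_upwards [hz] with s hs hst
  rw [uIoc_of_le ht.1] at hst
  rw [← hs ⟨hst.1.le, hst.2.trans ht.2⟩]
  exact (collField_eq_damped hk hΦ hf h1 s _ _).symm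

lemma dampedRHS_of_integral {z : E3 × E3} (hz : ∀ t ∈ Icc 0 T, along Φ f z t =
      f₀ z.1 z.2 + ∫ s in (0 : ℝ)..t, along Φ (collField γ b Φ f) z s) :
    ∀ t ∈ Icc 0 T, along Φ f z t = dampedRHS γ b Φ f₀ f z t := by
  obtain ⟨iD, iL, iQ, iC, -⟩ := intervalIntegrable_fields hk hΦ hf h1 z 0 T
  have e : along Φ (collField γ b Φ f) z = fun s => (along Φ (linField γ b Φ f) z s +
      along Φ (quadField γ b Φ f) z s) - along Φ (dampField γ b Φ) z s * along Φ f z s := by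
    funext s
    exact collField_eq_damped hk hΦ hf h1 s _ _
  rw [e] at hz iC
  exact duhamel_of_integral (S := fun s => along Φ (linField γ b Φ f) z s +
      along Φ (quadField γ b Φ f) z s) iD iC hz

end Integrated

-- K and Γ at (x, v) involve f at the same x and at other velocities. Fubini gives agreement in v
-- for almost every x, which is what `opK_congr_ae` and `opGamma_congr_ae` require.
omit hk in
lemma ae_fields_congr (hm : FieldMeasurable f) (hm' : FieldMeasurable f')
    (hp : ∀ t, IsPeriodic (f t)) (hp' : ∀ t, IsPeriodic (f' t)) {s : ℝ}
    (h : ∀ᵐ z ∂phaseMeasure, f s z.1 z.2 = f' s z.1 z.2) (hk : AdmissibleKernel γ b Cb) (r : ℝ) :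
    ∀ᵐ z ∂phaseMeasure,
      opK γ b (f s (flow Φ r z).1) (flow Φ r z).2 = opK γ b (f' s (flow Φ r z).1) (flow Φ r z).2 ∧
      opGamma γ b (f s (flow Φ r z).1) (flow Φ r z).2 =
        opGamma γ b (f' s (flow Φ r z).1) (flow Φ r z).2 := by
  have hx : ∀ᵐ x ∂((volume : Measure E3).restrict unitCube), f s x =ᵐ[volume] f' s x :=
    Measure.ae_ae_of_ae_prod h
  have hmK : ∀ g : ℝ → E3 → E3 → ℝ, FieldMeasurable g →
      Measurable (fun z : E3 × E3 => opK γ b (g s z.1) z.2) ∧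
      Measurable (fun z : E3 × E3 => opGamma γ b (g s z.1) z.2) := fun g hg =>
    ⟨measurable_opK (P := E3) (f := fun x => g s x) hk (hg.phase s),
      measurable_opGamma (P := E3) (f := fun x => g s x) hk (hg.phase s)⟩
  have h2 : ∀ᵐ z ∂phaseMeasure, opK γ b (f s z.1) z.2 = opK γ b (f' s z.1) z.2 ∧
      opGamma γ b (f s z.1) z.2 = opGamma γ b (f' s z.1) z.2 := by
    refine (Measure.ae_prod_iff_ae_ae
      ((measurableSet_eq_fun (hmK f hm).1 (hmK f' hm').1).inter
        (measurableSet_eq_fun (hmK f hm).2 (hmK f' hm').2))).2 ?_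
    filter_upwards [hx] with x hx
    exact (opK_congr_ae (hm.velocity s x) (hm'.velocity s x) hx).and
      (opGamma_congr_ae (hm.velocity s x) (hm'.velocity s x) hx)
  refine ae_phase_flow hΦ.contDiff hΦ.periodic (P := fun z =>
    opK γ b (f s z.1) z.2 = opK γ b (f' s z.1) z.2 ∧
      opGamma γ b (f s z.1) z.2 = opGamma γ b (f' s z.1) z.2) ?_ h2 r
  intro i x
  simp only [hp s i x, hp' s i x]

/-- Being a mild solution does not depend on the choice of representatives. -/
lemma mild_congr (h : IsMildSolution γ b Φ T f₀ f) (hm' : FieldMeasurable f')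
    (hp' : ∀ t, IsPeriodic (f' t)) (hp₀ : IsPeriodic f₀) (hp₀' : IsPeriodic f₀')
    (h₀ : ∀ᵐ z ∂phaseMeasure, f₀ z.1 z.2 = f₀' z.1 z.2)
    (hff : ∀ t ∈ Icc 0 T, ∀ᵐ z ∂phaseMeasure, f t z.1 z.2 = f' t z.1 z.2) :
    IsMildSolution γ b Φ T f₀' f' := by
  refine ⟨hm', hp', fun t ht => ?_⟩
  have hflow : Measurable fun q : ℝ × (E3 × E3) => flow Φ (q.1 - t) q.2 :=
    (measurable_flow hΦ.contDiff hΦ.periodic).comp (g := fun p : ℝ × (E3 × E3) => flow Φ p.1 p.2)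
      (f := fun q : ℝ × (E3 × E3) => (q.1 - t, q.2)) (by fun_prop)
  have hmeas : ∀ {G : ℝ → E3 → E3 → ℝ}, FieldMeasurable G → Measurable fun q : ℝ × (E3 × E3) =>
      G q.1 (flow Φ (q.1 - t) q.2).1 (flow Φ (q.1 - t) q.2).2 := fun hG =>
    hG.comp (measurable_fst.prodMk hflow)
  have hK : ∀ g : ℝ → E3 → E3 → ℝ, FieldMeasurable g →
      FieldMeasurable fun s x v => opK γ b (g s x) v := fun g hg =>
    fieldMeasurable_regroup.2 (measurable_opK (P := ℝ × E3) (f := fun p => g p.1 p.2) hk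
      (fieldMeasurable_regroup.1 hg))
  have hG : ∀ g : ℝ → E3 → E3 → ℝ, FieldMeasurable g →
      FieldMeasurable fun s x v => opGamma γ b (g s x) v := fun g hg =>
    fieldMeasurable_regroup.2 (measurable_opGamma (P := ℝ × E3) (f := fun p => g p.1 p.2) hk
      (fieldMeasurable_regroup.1 hg))
  -- Agreement holds for each s off a null set that depends on s; Fubini converts this into
  -- agreement at almost all s along almost every characteristic.
  have hae : ∀ᵐ z ∂phaseMeasure, ∀ᵐ s ∂((volume : Measure ℝ).restrict (Icc 0 T)),
      opK γ b (f s (flow Φ (s - t) z).1) (flow Φ (s - t) z).2 =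
        opK γ b (f' s (flow Φ (s - t) z).1) (flow Φ (s - t) z).2 ∧
      opGamma γ b (f s (flow Φ (s - t) z).1) (flow Φ (s - t) z).2 =
        opGamma γ b (f' s (flow Φ (s - t) z).1) (flow Φ (s - t) z).2 := by
    have hset : MeasurableSet {q : ℝ × (E3 × E3) |
        opK γ b (f q.1 (flow Φ (q.1 - t) q.2).1) (flow Φ (q.1 - t) q.2).2 =
          opK γ b (f' q.1 (flow Φ (q.1 - t) q.2).1) (flow Φ (q.1 - t) q.2).2 ∧
        opGamma γ b (f q.1 (flow Φ (q.1 - t) q.2).1) (flow Φ (q.1 - t) q.2).2 =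
          opGamma γ b (f' q.1 (flow Φ (q.1 - t) q.2).1) (flow Φ (q.1 - t) q.2).2} :=
      (measurableSet_eq_fun (hmeas (hK f h.measurable)) (hmeas (hK f' hm'))).inter
        (measurableSet_eq_fun (hmeas (hG f h.measurable)) (hmeas (hG f' hm')))
    refine (Measure.ae_ae_comm (p := fun s z =>
        opK γ b (f s (flow Φ (s - t) z).1) (flow Φ (s - t) z).2 =
          opK γ b (f' s (flow Φ (s - t) z).1) (flow Φ (s - t) z).2 ∧
        opGamma γ b (f s (flow Φ (s - t) z).1) (flow Φ (s - t) z).2 =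
          opGamma γ b (f' s (flow Φ (s - t) z).1) (flow Φ (s - t) z).2) hset).1 ?_
    refine (ae_restrict_iff' measurableSet_Icc).2 (Eventually.of_forall fun s hs => ?_)
    exact ae_fields_congr hΦ h.measurable hm' h.periodic hp' (hff s hs) hk (s - t)
  have h₀' : ∀ᵐ z ∂phaseMeasure, f₀ (flow Φ (0 - t) z).1 (flow Φ (0 - t) z).2 =
      f₀' (flow Φ (0 - t) z).1 (flow Φ (0 - t) z).2 :=
    ae_phase_flow hΦ.contDiff hΦ.periodic (P := fun z => f₀ z.1 z.2 = f₀' z.1 z.2)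
      (fun i x => by simp only [hp₀ i x, hp₀' i x]) h₀ (0 - t)
  filter_upwards [h.mild t ht, hae, h₀', hff t ht] with z hz hzae hz0 hzt
  rw [← hzt, hz]
  rw [ae_restrict_iff' measurableSet_Icc] at hzae
  simp only [charX, charV, characteristic_eq_flow hΦ.contDiff hΦ.periodic]
  rw [hz0]
  congr 1
  · congr 1
    apply intervalIntegral.integral_congr_ae
    filter_upwards [hzae] with s hs hst
    rw [uIoc_of_le ht.1] at hst
    rw [(hs ⟨hst.1.le, hst.2.trans ht.2⟩).1]
  · apply intervalIntegral.integral_congr_ae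
    filter_upwards [hzae] with s hs hst
    rw [uIoc_of_le ht.1] at hst
    rw [(hs ⟨hst.1.le, hst.2.trans ht.2⟩).2]

end IntegralForm

/-! ### Uniqueness -/

section Uniqueness

variable {γ : ℝ} {b : ℝ → ℝ} {Cb : ℝ} (hk : AdmissibleKernel γ b Cb)
  {Φ : E3 → ℝ} (hΦ : AdmissiblePotential Φ) {f₀ : E3 → E3 → ℝ} {f f' : ℝ → E3 → E3 → ℝ}
  {k A T : ℝ}

include hk hΦ

/-- The definition gives each t and almost every z. Exchanging the quantifiers by joint
measurability allows one to argue on a single characteristic. -/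
lemma ae_time_of_mild (hm₀ : Measurable fun z : E3 × E3 => f₀ z.1 z.2) (hp₀ : IsPeriodic f₀)
    (hf : PhaseDecays Φ k A f) (h1 : 1 ≤ k) (h : IsMildSolution γ b Φ T f₀ f) :
    ∀ᵐ z ∂phaseMeasure, ∀ᵐ s, s ∈ Icc 0 T → along Φ f z s = dampedRHS γ b Φ f₀ f z s := by
  have h2 := (mild_iff hk hΦ hf h1 hp₀).1 h
  have h3 : ∀ᵐ z ∂phaseMeasure, ∀ᵐ s ∂((volume : Measure ℝ).restrict (Icc 0 T)),
      along Φ f z s = dampedRHS γ b Φ f₀ f z s := by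
    refine (Measure.ae_ae_comm (p := fun z s => along Φ f z s = dampedRHS γ b Φ f₀ f z s)
      (measurableSet_eq_fun (measurable_along hΦ hf.measurable)
      (measurable_dampedRHS hk hΦ hm₀ hf.measurable))).2 ?_
    exact (ae_restrict_iff' measurableSet_Icc).2 (Eventually.of_forall h2)
  filter_upwards [h3] with z hz
  exact (ae_restrict_iff' measurableSet_Icc).1 hz

/-- One step of the comparison of a mild solution with a nonnegative solution. -/
lemma compare_step (hm₀ : Measurable fun z : E3 × E3 => f₀ z.1 z.2) (hp₀ : IsPeriodic f₀)
    (hf : PhaseDecays Φ (k + 1) A f) (h1 : 1 ≤ k)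
    (hpos : ∀ s x v, 0 ≤ sqrtLoc (Φ x) v + f s x v)
    (hfi : ∀ z : E3 × E3, ∀ t ∈ Icc 0 T, along Φ f z t =
      f₀ z.1 z.2 + ∫ s in (0 : ℝ)..t, along Φ (collField γ b Φ f) z s)
    (hf' : PhaseDecays Φ (k + 1) A f') (h' : IsMildSolution γ b Φ T f₀ f')
    {D : ℝ → ℝ} (hD : Continuous D)
    (hd : ∀ s x v, |f s x v - f' s x v| ≤ D s * en (Φ x) v ^ (-(k / 2))) :
    ∀ t ∈ Icc 0 T, ∀ᵐ z ∂phaseMeasure, |f t z.1 z.2 - f' t z.1 z.2| ≤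
      (∫ s in (0 : ℝ)..t, srcConst Cb k * (1 + A) * D s) * en (Φ z.1) z.2 ^ (-(k / 2)) := by
  intro t ht
  have hk1 : 1 ≤ k + 1 := by linarith
  have h2 := ae_time_of_mild hk hΦ hm₀ hp₀ hf' hk1 h'
  have h3 := (mild_iff hk hΦ hf' hk1 hp₀).1 h' t ht
  have key : ∀ᵐ z ∂phaseMeasure, |along Φ f z t - along Φ f' z t| ≤
      (∫ s in (0 : ℝ)..t, srcConst Cb k * (1 + A) * D s) * en (Φ z.1) z.2 ^ (-(k / 2)) := by
    filter_upwards [h2, h3] with z hz hzt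
    rw [hzt, ← intervalIntegral.integral_mul_const]
    obtain ⟨-, -, -, iC, -, iR⟩ := intervalIntegrable_fields hk hΦ hf hk1 z 0 T
    obtain ⟨-, -, -, iC', -⟩ := intervalIntegrable_fields hk hΦ hf' hk1 z 0 T
    have e : along Φ (collField γ b Φ f) z = fun s => along Φ (srcField γ b Φ f) z s -
        along Φ (rateField γ b Φ f) z s * along Φ f z s := by
      funext s; exact collField_eq hk hΦ hf hk1 s _ _
    -- `dampedRHS` stands in for f' as the unknown, because it solves the integrated equation at
    -- every time and equals f' at almost every time.
    have e' : (fun s => along Φ (srcField γ b Φ f') z s - along Φ (rateField γ b Φ f') z s *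
        dampedRHS γ b Φ f₀ f' z s)
          =ᵐ[volume.restrict (Icc 0 T)] along Φ (collField γ b Φ f') z := by
      rw [EventuallyEq, ae_restrict_iff' measurableSet_Icc]
      filter_upwards [hz] with s hs hsT
      rw [← hs hsT]
      exact (collField_eq hk hΦ hf' hk1 s _ _).symm
    have hT : (0 : ℝ) ≤ T := ht.1.trans ht.2
    have hy := hfi z
    rw [e] at hy iC
    -- The damping is the rate of f, which is nonnegative by `hpos`; nothing is assumed about the
    -- sign of the density of f'.
    refine abs_sub_le_of_integral (y₀ := f₀ z.1 z.2) iR (fun s _ => ?_) iC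
      (S₂ := along Φ (srcField γ b Φ f') z)
      (a₂ := along Φ (rateField γ b Φ f') z) (T := T) ?_ hy ?_ ht ?_ ?_
    · exact collRate_nonneg hk (hpos s _) _
    · refine iC'.congr_ae ?_
      rw [uIoc_of_le hT]
      exact EventuallyEq.symm (ae_restrict_of_ae_restrict_of_subset Ioc_subset_Icc_self e')
    · intro r hr
      rw [dampedRHS_eq_integral hk hΦ hf' hk1 hz r hr]
      congr 1
      apply intervalIntegral.integral_congr_ae
      rw [EventuallyEq, ae_restrict_iff' measurableSet_Icc] at e'
      filter_upwards [e'] with s hs hsr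
      rw [uIoc_of_le hr.1] at hsr
      exact (hs ⟨hsr.1.le, hsr.2.trans hr.2⟩).symm
    · exact Continuous.intervalIntegrable (by fun_prop) _ _
    · filter_upwards [hz] with s hs hsT
      rw [← hs hsT]
      have hx := hΦ.nonneg (flow Φ s z).1
      have := abs_src_rate_sub_le hk hx (hf.decays s _) (hf'.decays s _)
        (D := D s) ⟨(hf.decays s _).measurable.sub (hf'.decays s _).measurable, hd s _⟩ h1
        (y := along Φ f' z s) (flow Φ s z).2 (hf'.bound s _ _)
      rw [en_flow hΦ] at this
      exact this
  have hper : IsPeriodic fun x v => |along Φ f (x, v) t - along Φ f' (x, v) t| ≤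
      (∫ s in (0 : ℝ)..t, srcConst Cb k * (1 + A) * D s) * en (Φ x) v ^ (-(k / 2)) := by
    intro i x
    funext v
    simp only [along_shift hΦ hf.periodic, along_shift hΦ hf'.periodic, hΦ.periodic i x]
  filter_upwards [ae_phase_flow hΦ.contDiff hΦ.periodic hper key (-t)] with z hz
  simp only [along, flow_flow_neg hΦ.contDiff hΦ.periodic, en_flow hΦ] at hz
  exact hz

/-- Iterating `compare_step` improves the bound on the difference by a factor 1/2 each time,
whatever the length of the interval and the size A, thanks to an exponential weight in time. -/
lemma mild_unique (hm₀ : Measurable fun z : E3 × E3 => f₀ z.1 z.2) (hp₀ : IsPeriodic f₀)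
    (hf : PhaseDecays Φ (k + 1) A f) (h1 : 1 ≤ k)
    (hpos : ∀ s x v, 0 ≤ sqrtLoc (Φ x) v + f s x v)
    (hfi : ∀ z : E3 × E3, ∀ t ∈ Icc 0 T, along Φ f z t =
      f₀ z.1 z.2 + ∫ s in (0 : ℝ)..t, along Φ (collField γ b Φ f) z s)
    (h' : IsMildSolution γ b Φ T f₀ f')
    (hb' : ∀ t ∈ Icc 0 T, ∀ᵐ z ∂phaseMeasure,
      |f' t z.1 z.2| ≤ A * en (Φ z.1) z.2 ^ (-((k + 1) / 2))) :
    ∀ t ∈ Icc 0 T, ∀ᵐ z ∂phaseMeasure, f' t z.1 z.2 = f t z.1 z.2 := by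
  have hA : 0 ≤ A := (hf.decays 0 0).nonneg (hΦ.nonneg 0)
  set K := srcConst Cb k * (1 + A) with hK
  have hK0 : 0 ≤ K := mul_nonneg (srcConst_nonneg Cb (by linarith)) (by linarith)
  -- The rate 2K is chosen so that D (n+1) has derivative K·D n: integrating K·D n gains the factor
  -- 1/2.
  let D : ℕ → ℝ → ℝ := fun n s => 2 * A * (Real.exp (2 * K * s) / 2 ^ n)
  have hDc : ∀ n, Continuous (D n) := fun n => by fun_prop
  have hD0 : ∀ n s, 0 ≤ D n s := fun n s => by positivity
  have main : ∀ n : ℕ, ∀ t ∈ Icc 0 T, ∀ᵐ z ∂phaseMeasure,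
      |f t z.1 z.2 - f' t z.1 z.2| ≤ D n t * en (Φ z.1) z.2 ^ (-(k / 2)) := by
    intro n
    induction n with
    | zero =>
      intro t ht
      filter_upwards [hb' t ht] with z hz
      have h2 := hf.bound t z.1 z.2
      have h3 : en (Φ z.1) z.2 ^ (-((k + 1) / 2)) ≤ en (Φ z.1) z.2 ^ (-(k / 2)) :=
        Real.rpow_le_rpow_of_exponent_le (one_le_en (hΦ.nonneg _) _) (by linarith)
      have h4 : (1 : ℝ) ≤ Real.exp (2 * K * t) :=
        Real.one_le_exp (mul_nonneg (by positivity) ht.1)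
      have h5 : 0 ≤ en (Φ z.1) z.2 ^ (-(k / 2)) := Real.rpow_nonneg (en_pos (hΦ.nonneg _) _).le _
      calc |f t z.1 z.2 - f' t z.1 z.2| ≤ |f t z.1 z.2| + |f' t z.1 z.2| := abs_sub _ _
        _ ≤ 2 * A * en (Φ z.1) z.2 ^ (-((k + 1) / 2)) := by linarith
        _ ≤ 2 * A * en (Φ z.1) z.2 ^ (-(k / 2)) := by gcongr
        _ ≤ D 0 t * en (Φ z.1) z.2 ^ (-(k / 2)) := by
          refine mul_le_mul_of_nonneg_right ?_ h5
          simp only [D, pow_zero, div_one]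
          exact le_mul_of_one_le_right (by positivity) h4
    | succ n ih =>
      -- The bounds on f' hold only almost everywhere, while `compare_step` needs them everywhere.
      -- Replacing f' by f off this set changes it on a null set at each time in [0, T] and
      -- preserves periodicity.
      let good : Set (ℝ × E3 × E3) := {p | p.1 ∈ Icc 0 T ∧
        |f' p.1 p.2.1 p.2.2| ≤ A * en (Φ p.2.1) p.2.2 ^ (-((k + 1) / 2)) ∧
        |f p.1 p.2.1 p.2.2 - f' p.1 p.2.1 p.2.2| ≤ D n p.1 * en (Φ p.2.1) p.2.2 ^ (-(k / 2))}
      have hen : Measurable fun p : ℝ × E3 × E3 => en (Φ p.2.1) p.2.2 :=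
        (measurable_en hΦ).comp measurable_snd
      have hgood : MeasurableSet good := by
        refine (measurable_fst measurableSet_Icc).inter (MeasurableSet.inter ?_ ?_)
        · exact measurableSet_le (continuous_abs.measurable.comp h'.measurable)
            ((hen.pow_const _).const_mul A)
        · exact measurableSet_le
            (continuous_abs.measurable.comp (hf.measurable.sub h'.measurable))
            (((hDc n).measurable.comp measurable_fst).mul (hen.pow_const _))
      classical
      let g : ℝ → E3 → E3 → ℝ := fun t x v => if (t, x, v) ∈ good then f' t x v else f t x v
      have hg : PhaseDecays Φ (k + 1) A g := by
        refine ⟨Measurable.ite hgood h'.measurable hf.measurable, fun t i x => ?_, fun t x v => ?_⟩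
        · funext v
          simp only [g, good, mem_ofPred_eq, hΦ.periodic i x, hf.periodic t i x,
            h'.periodic t i x]
        · by_cases hm : (t, x, v) ∈ good
          · simp only [g, if_pos hm]; exact hm.2.1
          · simp only [g, if_neg hm]; exact hf.bound t x v
      have hgd : ∀ s x v, |f s x v - g s x v| ≤ D n s * en (Φ x) v ^ (-(k / 2)) := by
        intro s x v
        by_cases hm : (s, x, v) ∈ good
        · simp only [g, if_pos hm]; exact hm.2.2
        · simp only [g, if_neg hm, sub_self, abs_zero]
          exact mul_nonneg (hD0 n s) (Real.rpow_nonneg (en_pos (hΦ.nonneg _) _).le _)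
      have hgf : ∀ t ∈ Icc 0 T, ∀ᵐ z ∂phaseMeasure, f' t z.1 z.2 = g t z.1 z.2 := by
        intro t ht
        filter_upwards [hb' t ht, ih t ht] with z hz1 hz2
        have hm : (t, z.1, z.2) ∈ good := ⟨ht, hz1, hz2⟩
        simp only [g, if_pos hm]
      have hgm := mild_congr hk hΦ h' hg.measurable hg.periodic hp₀ hp₀
        (Eventually.of_forall fun _ => rfl) hgf
      intro t ht
      filter_upwards [compare_step hk hΦ hm₀ hp₀ hf h1 hpos hfi hg hgm (hDc n) hgd t ht,
        hgf t ht] with z hz hz'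
      rw [hz']
      refine hz.trans (mul_le_mul_of_nonneg_right ?_
        (Real.rpow_nonneg (en_pos (hΦ.nonneg _) _).le _))
      have hder : ∀ s : ℝ, HasDerivAt (D (n + 1)) (K * D n s) s := by
        intro s
        have e1 : HasDerivAt (fun s : ℝ => Real.exp (2 * K * s))
            (Real.exp (2 * K * s) * (2 * K)) s := by
          have := ((hasDerivAt_id s).const_mul (2 * K)).exp
          simpa using this
        have e2 := (e1.div_const (2 ^ (n + 1))).const_mul (2 * A)
        have e3 : 2 * A * (Real.exp (2 * K * s) * (2 * K) / 2 ^ (n + 1)) = K * D n s := by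
          simp only [D]
          rw [pow_succ]
          field_simp
        rwa [e3] at e2
      rw [intervalIntegral.integral_eq_sub_of_hasDerivAt (fun s _ => hder s)
        (Continuous.intervalIntegrable (by fun_prop) _ _)]
      linarith [hD0 (n + 1) 0]
  intro t ht
  have hall := ae_all_iff.2 fun n => main n t ht
  filter_upwards [hall] with z hz
  have hlim : Tendsto (fun n : ℕ => D n t * en (Φ z.1) z.2 ^ (-(k / 2))) atTop (nhds 0) := by
    have h2 : Tendsto (fun n : ℕ => Real.exp (2 * K * t) * (1 / 2 : ℝ) ^ n) atTop
        (nhds (Real.exp (2 * K * t) * 0)) :=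
      (tendsto_pow_atTop_nhds_zero_of_lt_one (by norm_num) (by norm_num)).const_mul _
    have h3 := (h2.const_mul (2 * A)).mul_const (en (Φ z.1) z.2 ^ (-(k / 2)))
    simp only [mul_zero, zero_mul] at h3
    refine h3.congr fun n => ?_
    simp only [D]
    rw [one_div, inv_pow, div_eq_mul_inv (Real.exp _)]
  have h0 : |f t z.1 z.2 - f' t z.1 z.2| ≤ 0 := ge_of_tendsto' hlim hz
  linarith [abs_nonpos_iff.1 h0]

end Uniqueness

/-! ### Existence -/

/-- The solution of the linear equation with collision rate and source determined by `f`. -/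
def iterRHS (γ : ℝ) (b : ℝ → ℝ) (Φ : E3 → ℝ) (f₀ : E3 → E3 → ℝ) (f : ℝ → E3 → E3 → ℝ)
    (z : E3 × E3) (t : ℝ) : ℝ :=
  Real.exp (-∫ τ in (0 : ℝ)..t, along Φ (rateField γ b Φ f) z τ) * (f₀ z.1 z.2 +
    ∫ s in (0 : ℝ)..t, Real.exp (∫ τ in (0 : ℝ)..s, along Φ (rateField γ b Φ f) z τ) *
      along Φ (srcField γ b Φ f) z s)

/-- The nearest point of `[0, T]`. -/
def clampTime (T t : ℝ) : ℝ := max 0 (min T t)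

lemma clampTime_mem {T : ℝ} (hT : 0 ≤ T) (t : ℝ) : clampTime T t ∈ Icc 0 T :=
  ⟨le_max_left _ _, max_le hT (min_le_left _ _)⟩

lemma clampTime_of_mem {T t : ℝ} (ht : t ∈ Icc 0 T) : clampTime T t = t := by
  rw [clampTime, min_eq_right ht.2, max_eq_right ht.1]

lemma measurable_clampTime (T : ℝ) : Measurable (clampTime T) := by
  unfold clampTime; fun_prop

/-- The iteration map. -/
def iterStep (γ : ℝ) (b : ℝ → ℝ) (Φ : E3 → ℝ) (f₀ : E3 → E3 → ℝ) (T : ℝ) (f : ℝ → E3 → E3 → ℝ)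
    (t : ℝ) (x v : E3) : ℝ :=
  iterRHS γ b Φ f₀ f (flow Φ (-clampTime T t) (x, v)) (clampTime T t)

/-- The class of functions in which the iteration takes place. -/
structure IterClass (Φ : E3 → ℝ) (k A : ℝ) (f : ℝ → E3 → E3 → ℝ) : Prop where
  decays : PhaseDecays Φ k A f
  nonneg : ∀ s x v, 0 ≤ sqrtLoc (Φ x) v + f s x v

section Iteration

variable {γ : ℝ} {b : ℝ → ℝ} {Cb : ℝ} (hk : AdmissibleKernel γ b Cb)
  {Φ : E3 → ℝ} (hΦ : AdmissiblePotential Φ) {f₀ : E3 → E3 → ℝ} {f g : ℝ → E3 → E3 → ℝ}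
  {k N T : ℝ}

include hk hΦ

-- Clamping extends the iterate beyond [0, T] by its values at the endpoints, so that bounds valid
-- for all times can be demanded; within [0, T] nothing changes.
omit hk in
lemma along_iterStep {t : ℝ} (ht : t ∈ Icc 0 T) (z : E3 × E3) :
    along Φ (iterStep γ b Φ f₀ T f) z t = iterRHS γ b Φ f₀ f z t := by
  unfold along iterStep
  rw [clampTime_of_mem ht]
  simp only [Prod.mk.eta]
  rw [flow_neg_flow hΦ.contDiff hΦ.periodic]

lemma measurable_iterStep (hm₀ : Measurable fun z : E3 × E3 => f₀ z.1 z.2)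
    (hf : FieldMeasurable f) : FieldMeasurable (iterStep γ b Φ f₀ T f) := by
  have m1 := measurable_primitive (measurable_along hΦ (fieldMeasurable_rateField hk hΦ hf))
  have m2 := measurable_along hΦ (fieldMeasurable_srcField hk hΦ hf)
  have m4 := measurable_primitive (G := fun z s =>
    Real.exp (∫ τ in (0 : ℝ)..s, along Φ (rateField γ b Φ f) z τ) *
      along Φ (srcField γ b Φ f) z s) (m1.exp.mul m2)
  have m5 : Measurable fun q : (E3 × E3) × ℝ => iterRHS γ b Φ f₀ f q.1 q.2 :=
    m1.neg.exp.mul ((hm₀.comp measurable_fst).add m4)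
  have m6 : Measurable fun p : ℝ × (E3 × E3) => clampTime T p.1 :=
    (measurable_clampTime T).comp measurable_fst
  have m7 : Measurable fun p : ℝ × (E3 × E3) => flow Φ (-clampTime T p.1) p.2 :=
    (measurable_flow hΦ.contDiff hΦ.periodic).comp (g := fun p : ℝ × (E3 × E3) => flow Φ p.1 p.2)
      (f := fun p : ℝ × (E3 × E3) => (-clampTime T p.1, p.2)) (m6.neg.prodMk measurable_snd)
  have m8 : ∀ {H : E3 × E3 → ℝ → ℝ}, (Measurable fun q : (E3 × E3) × ℝ => H q.1 q.2) →
      Measurable fun p : ℝ × (E3 × E3) => H (flow Φ (-clampTime T p.1) p.2) (clampTime T p.1) :=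
    fun hH => hH.comp (m7.prodMk m6)
  exact m8 m5

omit hk in
lemma iterStep_periodic (hp₀ : IsPeriodic f₀) (hp : ∀ t, IsPeriodic (f t)) (t : ℝ) :
    IsPeriodic (iterStep γ b Φ f₀ T f t) := by
  refine IsPeriodic.comp_flow hΦ (h := fun z => iterRHS γ b Φ f₀ f z (clampTime T t)) ?_ _
  intro i x
  funext v
  have fp := fun t => fields_periodic (γ := γ) (b := b) hΦ hp t
  simp only [iterRHS]
  rw [along_shift hΦ (fun t => (fp t).1), along_shift hΦ (fun t => (fp t).2.1), hp₀ i x]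

variable (h1 : 1 ≤ k) (hf : IterClass Φ (k + 1) (2 * N) f) (hg : IterClass Φ (k + 1) (2 * N) g)
  (hm₀ : Measurable fun z : E3 × E3 => f₀ z.1 z.2) (hp₀ : IsPeriodic f₀)
  (hb₀ : ∀ x v, |f₀ x v| ≤ N * en (Φ x) v ^ (-((k + 1) / 2)))
  (hn₀ : ∀ x v, 0 ≤ sqrtLoc (Φ x) v + f₀ x v)
  (hT : 0 ≤ T) (hT₁ : T * (srcConst Cb (k + 1) * (2 * N * (1 + 2 * N))) ≤ N)
  (hT₂ : T * (srcConst Cb k * (1 + 2 * N)) ≤ 1 / 2)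

include h1 hf

omit hΦ h1 in
lemma rate_along_nonneg (z : E3 × E3) (s : ℝ) : 0 ≤ along Φ (rateField γ b Φ f) z s :=
  collRate_nonneg hk (hf.nonneg s _) _

lemma iterRHS_integral (z : E3 × E3) : ∀ t ∈ Icc 0 T, iterRHS γ b Φ f₀ f z t = f₀ z.1 z.2 +
    ∫ s in (0 : ℝ)..t, (along Φ (srcField γ b Φ f) z s -
      along Φ (rateField γ b Φ f) z s * iterRHS γ b Φ f₀ f z s) := by
  obtain ⟨-, -, -, -, iS, iR⟩ := intervalIntegrable_fields hk hΦ hf.decays (by linarith) z 0 T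
  exact integral_of_duhamel iR iS fun t _ => rfl

include hb₀ hT hT₁

-- The rate is nonnegative and can be dropped. The datum contributes N, and the source, bounded in
-- the same weight, contributes at most another N on [0, T].
omit hT in
lemma abs_iterRHS_le (z : E3 × E3) {t : ℝ} (ht : t ∈ Icc 0 T) :
    |iterRHS γ b Φ f₀ f z t| ≤ 2 * N * en (Φ z.1) z.2 ^ (-((k + 1) / 2)) := by
  obtain ⟨-, -, -, -, iS, iR⟩ := intervalIntegrable_fields hk hΦ hf.decays (by linarith) z 0 T
  set e := en (Φ z.1) z.2 ^ (-((k + 1) / 2)) with he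
  have he0 : 0 ≤ e := Real.rpow_nonneg (en_pos (hΦ.nonneg _) _).le _
  set M := srcConst Cb (k + 1) * (2 * N * (1 + 2 * N)) with hM
  have hb : ∀ s, |along Φ (srcField γ b Φ f) z s| ≤ M * e := by
    intro s
    have := abs_srcField_le hk hΦ hf.decays (by linarith) s (flow Φ s z).1 (flow Φ s z).2
    rw [en_flow hΦ] at this
    exact this
  have h2 := abs_duhamel_le (y₀ := f₀ z.1 z.2) iR (fun s _ => rate_along_nonneg hk hf z s) ht
    (c := fun _ => M * e) intervalIntegrable_const (Eventually.of_forall fun s _ => hb s)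
  refine h2.trans ?_
  rw [intervalIntegral.integral_const, sub_zero, smul_eq_mul]
  have hMe : 0 ≤ M * e := (abs_nonneg _).trans (hb 0)
  have h3 : t * (M * e) ≤ T * (M * e) := mul_le_mul_of_nonneg_right ht.2 hMe
  have h4 : T * M * e ≤ N * e := mul_le_mul_of_nonneg_right hT₁ he0
  have h5 := hb₀ z.1 z.2
  calc _ ≤ N * e + T * (M * e) := add_le_add h5 h3
    _ = N * e + T * M * e := by ring
    _ ≤ N * e + N * e := by linarith
    _ = _ := by ring

-- With m = √μ_E constant along the characteristic, m + f solves the damped equation with source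
-- gain(h,h) ≥ 0 and nonnegative datum, where h is the previous nonnegative iterate.
omit hb₀ hT hT₁ in
include hn₀ in
lemma iterRHS_nonneg (z : E3 × E3) {t : ℝ} (ht : t ∈ Icc 0 T) :
    0 ≤ sqrtLoc (Φ z.1) z.2 + iterRHS γ b Φ f₀ f z t := by
  obtain ⟨-, -, -, -, iS, iR⟩ := intervalIntegrable_fields hk hΦ hf.decays (by linarith) z 0 T
  set m := sqrtLoc (Φ z.1) z.2 with hm
  -- The constant m solves the linear equation with source rate·m; adding the two formulas turns the
  -- source into rate·m + S, which is the gain term.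
  have hconst := duhamel_of_integral (a := along Φ (rateField γ b Φ f) z)
    (S := fun s => along Φ (rateField γ b Φ f) z s * m) (y := fun _ => m) (y₀ := m) (T := T) iR
    (by simp) (by simp) t ht
  have iR' : IntervalIntegrable (fun s => along Φ (rateField γ b Φ f) z s * m) volume 0 t :=
    (intervalIntegrable_of_mem iR ht).mul_const m
  have e : m + iterRHS γ b Φ f₀ f z t =
      Real.exp (-∫ τ in (0 : ℝ)..t, along Φ (rateField γ b Φ f) z τ) * ((m + f₀ z.1 z.2) +
    ∫ s in (0 : ℝ)..t, Real.exp (∫ τ in (0 : ℝ)..s, along Φ (rateField γ b Φ f) z τ) *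
      (along Φ (rateField γ b Φ f) z s * m + along Φ (srcField γ b Φ f) z s)) := by
    simp only [mul_add (Real.exp (∫ τ in (0 : ℝ).._, along Φ (rateField γ b Φ f) z τ))]
    rw [intervalIntegral.integral_add
      (intervalIntegrable_exp_mul (intervalIntegrable_of_mem iR ht) iR')
      (intervalIntegrable_exp_mul (intervalIntegrable_of_mem iR ht)
        (intervalIntegrable_of_mem iS ht)), iterRHS]
    linear_combination hconst
  rw [e]
  refine mul_nonneg (Real.exp_pos _).le (add_nonneg (hn₀ _ _) ?_)
  refine intervalIntegral.integral_nonneg ht.1 fun s _ => mul_nonneg (Real.exp_pos _).le ?_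
  set w := flow Φ s z with hw
  have h2 := collOp_eq_src_sub_rate hk (hΦ.nonneg w.1) (hf.decays.decays s w.1) (by linarith) w.2
  have h3 : along Φ (rateField γ b Φ f) z s * m + along Φ (srcField γ b Φ f) z s =
      Real.exp (-(Φ w.1 / 2)) * gainOp γ b (fun v => sqrtLoc (Φ w.1) v + f s w.1 v)
        (fun v => sqrtLoc (Φ w.1) v + f s w.1 v) w.2 := by
    have hmw : m = sqrtLoc (Φ w.1) w.2 := (sqrtLoc_flow hΦ s z).symm
    change collRate γ b (Φ w.1) (f s w.1) w.2 * m + collSrc γ b (Φ w.1) (f s w.1) w.2 = _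
    rw [hmw]
    rw [collOp] at h2
    have h4 : collRate γ b (Φ w.1) (f s w.1) w.2 = Real.exp (-(Φ w.1 / 2)) *
      lossOp γ b (fun v => sqrtLoc (Φ w.1) v + f s w.1 v) w.2 := rfl
    rw [h4] at h2 ⊢
    linarith
  rw [h3]
  exact mul_nonneg (Real.exp_pos _).le (gainOp_nonneg hk (hf.nonneg s _) _)

include hm₀ hp₀ hn₀ in
lemma iterStep_class : IterClass Φ (k + 1) (2 * N) (iterStep γ b Φ f₀ T f) := by
  refine ⟨⟨measurable_iterStep hk hΦ hm₀ hf.decays.measurable,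
    iterStep_periodic hΦ hp₀ hf.decays.periodic, fun t x v => ?_⟩, fun t x v => ?_⟩
  · have := abs_iterRHS_le hk hΦ h1 hf hb₀ hT₁ (flow Φ (-clampTime T t) (x, v))
      (clampTime_mem hT t)
    rwa [en_flow hΦ] at this
  · have := iterRHS_nonneg hk hΦ h1 hf hn₀ (flow Φ (-clampTime T t) (x, v)) (clampTime_mem hT t)
    rwa [sqrtLoc_flow hΦ] at this

include hg hT₂

/-- The two outputs have the same datum. Their difference is damped by the rate of f and driven by
the source bounded in `abs_src_rate_sub_le`; hT₂ makes the time integral at most half the input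
difference. -/
lemma iterStep_contract {D : ℝ}
    (hd : ∀ s x v, |f s x v - g s x v| ≤ D * en (Φ x) v ^ (-(k / 2))) (t : ℝ) (x v : E3) :
    |iterStep γ b Φ f₀ T f t x v - iterStep γ b Φ f₀ T g t x v| ≤
      D / 2 * en (Φ x) v ^ (-(k / 2)) := by
  have ht := clampTime_mem hT t
  set z := flow Φ (-clampTime T t) (x, v) with hz
  have hez : en (Φ x) v = en (Φ z.1) z.2 := (en_flow hΦ _ (x, v)).symm
  obtain ⟨-, -, -, -, iS, iR⟩ := intervalIntegrable_fields hk hΦ hf.decays (by linarith) z 0 T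
  obtain ⟨-, -, -, -, iS', iR'⟩ := intervalIntegrable_fields hk hΦ hg.decays (by linarith) z 0 T
  set e := en (Φ z.1) z.2 ^ (-(k / 2)) with he
  have he0 : 0 ≤ e := Real.rpow_nonneg (en_pos (hΦ.nonneg _) _).le _
  have hD : 0 ≤ D := nonneg_of_mul_nonneg_left ((abs_nonneg _).trans (hd 0 0 0))
    (Real.rpow_pos_of_pos (en_pos (hΦ.nonneg _) _) _)
  have cont : ∀ F, IterClass Φ (k + 1) (2 * N) F →
      ContinuousOn (iterRHS γ b Φ f₀ F z) (uIcc 0 T) := by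
    intro F hF
    obtain ⟨-, -, -, -, iS, iR⟩ := intervalIntegrable_fields hk hΦ hF.decays (by linarith) z 0 T
    refine ContinuousOn.mul ?_ (ContinuousOn.add continuousOn_const ?_)
    · exact ((iR.absolutelyContinuousOnInterval_intervalIntegral
        left_mem_uIcc).continuousOn.neg).rexp
    · exact ((intervalIntegrable_exp_mul iR iS).absolutelyContinuousOnInterval_intervalIntegral
        left_mem_uIcc).continuousOn
  have key := abs_sub_le_of_integral (y₀ := f₀ z.1 z.2) iR
    (fun s _ => rate_along_nonneg hk hf z s) (iS.sub (iR.mul_continuousOn (cont f hf)))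
    (iS'.sub (iR'.mul_continuousOn (cont g hg)))
    (iterRHS_integral hk hΦ h1 hf z) (iterRHS_integral hk hΦ h1 hg z) ht
    (c := fun _ => srcConst Cb k * (1 + 2 * N) * D * e) intervalIntegrable_const
    (Eventually.of_forall fun s hs => by
      have h2 := abs_iterRHS_le hk hΦ h1 hg hb₀ hT₁ z hs
      rw [← en_flow hΦ s z] at h2
      have := abs_src_rate_sub_le hk (hΦ.nonneg _) (hf.decays.decays s (flow Φ s z).1)
        (hg.decays.decays s _) (D := D)
        ⟨(hf.decays.decays s _).measurable.sub (hg.decays.decays s _).measurable, hd s _⟩ h1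
        (y := iterRHS γ b Φ f₀ g z s) (flow Φ s z).2 h2
      rw [en_flow hΦ] at this
      exact this)
  rw [hez]
  refine key.trans ?_
  rw [intervalIntegral.integral_const, sub_zero, smul_eq_mul]
  have hN : 0 ≤ 2 * N := (hf.decays.decays 0 0).nonneg (hΦ.nonneg 0)
  have hC : 0 ≤ srcConst Cb k * (1 + 2 * N) :=
    mul_nonneg (srcConst_nonneg Cb (by linarith)) (by linarith)
  calc clampTime T t * (srcConst Cb k * (1 + 2 * N) * D * e)
      ≤ T * (srcConst Cb k * (1 + 2 * N) * D * e) :=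
        mul_le_mul_of_nonneg_right ht.2 (by positivity)
    _ = T * (srcConst Cb k * (1 + 2 * N)) * (D * e) := by ring
    _ ≤ 1 / 2 * (D * e) := mul_le_mul_of_nonneg_right hT₂ (by positivity)
    _ = _ := by ring

end Iteration

/-- Existence of a nonnegative solution of the integrated equation. -/
lemma exists_integral_solution {γ : ℝ} {b : ℝ → ℝ} {Cb : ℝ} (hk : AdmissibleKernel γ b Cb)
    {Φ : E3 → ℝ} (hΦ : AdmissiblePotential Φ) {f₀ : E3 → E3 → ℝ} {k N T : ℝ} (h1 : 1 ≤ k)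
    (hm₀ : Measurable fun z : E3 × E3 => f₀ z.1 z.2) (hp₀ : IsPeriodic f₀)
    (hb₀ : ∀ x v, |f₀ x v| ≤ N * en (Φ x) v ^ (-((k + 1) / 2)))
    (hn₀ : ∀ x v, 0 ≤ sqrtLoc (Φ x) v + f₀ x v)
    (hT : 0 ≤ T) (hT₁ : T * (srcConst Cb (k + 1) * (2 * N * (1 + 2 * N))) ≤ N)
    (hT₂ : T * (srcConst Cb k * (1 + 2 * N)) ≤ 1 / 2) :
    ∃ f : ℝ → E3 → E3 → ℝ, IterClass Φ (k + 1) (2 * N) f ∧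
      ∀ z : E3 × E3, ∀ t ∈ Icc 0 T, along Φ f z t =
        f₀ z.1 z.2 + ∫ s in (0 : ℝ)..t, along Φ (collField γ b Φ f) z s := by
  have hN : 0 ≤ N := nonneg_of_mul_nonneg_left ((abs_nonneg _).trans (hb₀ 0 0))
    (Real.rpow_pos_of_pos (en_pos (hΦ.nonneg _) _) _)
  let Ψ := iterStep γ b Φ f₀ T
  let F : ℕ → ℝ → E3 → E3 → ℝ := fun n => Ψ^[n] fun _ _ _ => 0
  have hFs : ∀ n, F (n + 1) = Ψ (F n) := fun n => Function.iterate_succ_apply' Ψ n _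
  have hF : ∀ n, IterClass Φ (k + 1) (2 * N) (F n) := by
    intro n
    induction n with
    | zero =>
      refine ⟨⟨measurable_const, fun t i x => rfl, fun t x v => ?_⟩, fun t x v => ?_⟩
      · simp only [F, Function.iterate_zero, id_eq, abs_zero]
        exact mul_nonneg (by linarith) (Real.rpow_nonneg (en_pos (hΦ.nonneg _) _).le _)
      · simpa [F] using (sqrtLoc_pos (Φ x) v).le
    | succ n ih =>
      rw [hFs]
      exact iterStep_class hk hΦ h1 ih hm₀ hp₀ hb₀ hn₀ hT hT₁
  have hdiff : ∀ n t x v, |F n t x v - F (n + 1) t x v| ≤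
      2 * N / 2 ^ n * en (Φ x) v ^ (-(k / 2)) := by
    intro n
    induction n with
    | zero =>
      intro t x v
      have h2 := (hF 1).decays.bound t x v
      have h3 : en (Φ x) v ^ (-((k + 1) / 2)) ≤ en (Φ x) v ^ (-(k / 2)) :=
        Real.rpow_le_rpow_of_exponent_le (one_le_en (hΦ.nonneg _) _) (by linarith)
      have h4 : F 0 t x v = 0 := rfl
      rw [h4, zero_sub, abs_neg, pow_zero, div_one]
      exact h2.trans (mul_le_mul_of_nonneg_left h3 (by linarith))
    | succ n ih =>
      intro t x v
      have := iterStep_contract hk hΦ h1 (hF n) (hF (n + 1)) hb₀ hT hT₁ hT₂ ih t x v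
      rw [hFs, hFs (n + 1)]
      refine this.trans (le_of_eq ?_)
      rw [pow_succ]
      field_simp
  have hcs : ∀ t x v, CauchySeq fun n => F n t x v := by
    intro t x v
    refine cauchySeq_of_le_geometric (1 / 2) (2 * N * en (Φ x) v ^ (-(k / 2))) (by norm_num) ?_
    intro n
    rw [Real.dist_eq]
    refine (hdiff n t x v).trans (le_of_eq ?_)
    rw [one_div, inv_pow]
    ring
  let f : ℝ → E3 → E3 → ℝ := fun t x v => limUnder atTop fun n => F n t x v
  have hlim : ∀ t x v, Tendsto (fun n => F n t x v) atTop (nhds (f t x v)) := fun t x v =>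
    (hcs t x v).tendsto_limUnder
  have hfd : ∀ n t x v, |f t x v - F n t x v| ≤ 4 * N / 2 ^ n * en (Φ x) v ^ (-(k / 2)) := by
    intro n t x v
    have := dist_le_of_le_geometric_of_tendsto (1 / 2) (2 * N * en (Φ x) v ^ (-(k / 2)))
      (by norm_num) (f := fun n => F n t x v) (fun n => by
        rw [Real.dist_eq]
        refine (hdiff n t x v).trans (le_of_eq ?_)
        rw [one_div, inv_pow]
        ring) (hlim t x v) n
    rw [dist_comm, Real.dist_eq] at this
    refine this.trans (le_of_eq ?_)
    rw [one_div, inv_pow]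
    ring
  -- The limit is only controlled in the weaker weight k, but the bounds and the sign defining the
  -- class survive pointwise limits, so the decay k + 1 is recovered.
  have hf : IterClass Φ (k + 1) (2 * N) f := by
    refine ⟨⟨?_, fun t i x => ?_, fun t x v => ?_⟩, fun t x v => ?_⟩
    · exact measurable_of_tendsto_metrizable (fun n => (hF n).decays.measurable)
        (tendsto_pi_nhds.2 fun p => hlim p.1 p.2.1 p.2.2)
    · funext v
      simp only [f, (hF _).decays.periodic t i x]
    · exact le_of_tendsto' ((continuous_abs.tendsto _).comp (hlim t x v))
        fun n => (hF n).decays.bound t x v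
    · exact ge_of_tendsto' ((hlim t x v).const_add _) fun n => (hF n).nonneg t x v
  -- The contraction estimate between the limit and the iterates gives the fixed point equation
  -- directly, without passing to the limit inside the collision integrals.
  have hfix : ∀ t x v, f t x v = Ψ f t x v := by
    intro t x v
    refine tendsto_nhds_unique ((hlim t x v).comp (tendsto_add_atTop_nat 1)) ?_
    rw [tendsto_iff_dist_tendsto_zero]
    have h3 : Tendsto (fun n : ℕ => 2 * N * en (Φ x) v ^ (-(k / 2)) * (1 / 2 : ℝ) ^ n) atTop
        (nhds (2 * N * en (Φ x) v ^ (-(k / 2)) * 0)) :=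
      (tendsto_pow_atTop_nhds_zero_of_lt_one (by norm_num) (by norm_num)).const_mul _
    rw [mul_zero] at h3
    refine squeeze_zero (fun n => dist_nonneg) (fun n => ?_) h3
    have := iterStep_contract hk hΦ h1 hf (hF n) hb₀ hT hT₁ hT₂ (hfd n) t x v
    rw [Function.comp_apply, hFs, dist_comm, Real.dist_eq]
    refine this.trans (le_of_eq ?_)
    rw [one_div, inv_pow]
    ring
  refine ⟨f, hf, fun z t ht => ?_⟩
  have hal : ∀ s ∈ Icc 0 T, along Φ f z s = iterRHS γ b Φ f₀ f z s := by
    intro s hs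
    rw [← along_iterStep hΦ hs]
    exact hfix s _ _
  rw [hal t ht, iterRHS_integral hk hΦ h1 hf z t ht]
  congr 1
  apply intervalIntegral.integral_congr
  intro s hs
  rw [uIcc_of_le ht.1] at hs
  simp only
  rw [← hal s ⟨hs.1, hs.2.trans ht.2⟩]
  exact (collField_eq hk hΦ hf.decays (by linarith) s _ _).symm

/-! ### The weak form of the collision operator -/

/-- Polynomial factors in the energy cost half of the Gaussian exponent. The bound is uniform in c,
hence in the position. -/
lemma sqrtLoc_mul_rpow_le {c : ℝ} (hc : 0 ≤ c) {p : ℝ} (hp : 0 < p) (v : E3) :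
    sqrtLoc c v * en c v ^ p ≤ locConst (2 * p) * Real.exp (-(1 / 8 * ‖v‖ ^ 2)) := by
  have h := sqrtLoc_le_exp hc v (k := 2 * p) (by positivity)
  rw [mul_div_cancel_left₀ p (by norm_num)] at h
  refine h.trans (mul_le_mul_of_nonneg_left ?_ (locConst_nonneg (by positivity)))
  rw [Real.exp_le_exp, en]
  linarith

lemma MeasurePreserving.integral_comp_measurable {X : Type*} [MeasurableSpace X] {μ : Measure X}
    {T : X → X} (hT : MeasurePreserving T μ μ) {J : X → ℝ} (hJ : Measurable J) :
    ∫ x, J (T x) ∂μ = ∫ x, J x ∂μ := by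
  conv_rhs => rw [← hT.map_eq]
  exact (integral_map hT.measurable.aemeasurable hJ.aestronglyMeasurable).symm

/-- The symmetric collision weight `B(v - u, ω) √μ(u) √μ(v)` at `(ω, v, u)`. -/
def symKernel (γ : ℝ) (b : ℝ → ℝ) (q : S2 × E3 × E3) : ℝ :=
  sqrtMax q.2.1 * weightedKernel γ b q.2.1 (q.2.2, q.1)

lemma symKernel_exchange (γ : ℝ) (b : ℝ → ℝ) (q : S2 × E3 × E3) :
    symKernel γ b (exchange q) = symKernel γ b q := by
  simp only [symKernel, exchange, weightedKernel, collisionKernel_swap]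
  ring

/-- The product √μ(u)√μ(v) is a collision invariant and the kernel keeps its angle, so the weight is
invariant under both involutions. -/
lemma symKernel_preToPost (γ : ℝ) (b : ℝ → ℝ) (q : S2 × E3 × E3) :
    symKernel γ b (preToPost q) = symKernel γ b q := by
  have := sqrtMax_post q.2.1 q.2.2 q.1
  simp only [symKernel, preToPost, weightedKernel, collisionKernel_post]
  linear_combination collisionKernel γ b (q.2.1 - q.2.2) q.1 * this

/-- The difference of the products of `h` after and before the collision. -/
def collDiff (h : E3 → ℝ) (q : S2 × E3 × E3) : ℝ :=
  h (uPost q.2.1 q.2.2 q.1) * h (vPost q.2.1 q.2.2 q.1) - h q.2.2 * h q.2.1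

lemma collDiff_exchange (h : E3 → ℝ) (q : S2 × E3 × E3) :
    collDiff h (exchange q) = collDiff h q := by
  simp only [collDiff, exchange, vPost_swap, uPost_swap]
  ring

lemma collDiff_preToPost (h : E3 → ℝ) (q : S2 × E3 × E3) :
    collDiff h (preToPost q) = -collDiff h q := by
  simp only [collDiff, preToPost, vPost_post, uPost_post]
  ring

section WeakForm

variable {γ : ℝ} {b : ℝ → ℝ} {Cb : ℝ} (hk : AdmissibleKernel γ b Cb) {c : ℝ} (hc : 0 ≤ c)
  {k A Q : ℝ} {h φ : E3 → ℝ}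

include hk

lemma measurable_symKernel : Measurable (symKernel γ b) := by
  have hr : Measurable fun q : S2 × E3 × E3 => (q.2.1, (q.2.2, q.1)) := by fun_prop
  have h1 : Measurable fun q : S2 × E3 × E3 => q.2.1 := by fun_prop
  have h2 : Measurable fun q : S2 × E3 × E3 => weightedKernel γ b q.2.1 (q.2.2, q.1) :=
    (measurable_weightedKernel hk).comp
      (g := fun r : E3 × (E3 × S2) => weightedKernel γ b r.1 r.2)
      (f := fun q : S2 × E3 × E3 => (q.2.1, (q.2.2, q.1))) hr
  have h3 : Measurable fun q : S2 × E3 × E3 => sqrtMax q.2.1 := measurable_sqrtMax.comp h1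
  unfold symKernel
  exact h3.mul h2

lemma symKernel_nonneg (q : S2 × E3 × E3) : 0 ≤ symKernel γ b q :=
  mul_nonneg (sqrtMax_pos _).le (weightedKernel_nonneg hk _ _)

include hc

/-- Admits test functions growing like the energy. The bound obtained depends on c, but only
integrability at fixed position is used. -/
lemma integrable_en_mul_symKernel :
    Integrable (fun q : S2 × E3 × E3 => en c q.2.1 * symKernel γ b q) collisionMeasure := by
  have hm : Measurable fun r : E3 × (E3 × S2) =>
      en c r.1 * (sqrtMax r.1 * weightedKernel γ b r.1 r.2) := by
    have h1 : Measurable fun r : E3 × (E3 × S2) => en c r.1 := by unfold en; fun_prop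
    exact h1.mul ((measurable_sqrtMax.comp measurable_fst).mul (measurable_weightedKernel hk))
  have hmaj := fun v => (exists_loss_majorant Cb).choose_spec.2 γ b hk v
  have hL := lossConst_nonneg Cb
  have hint : Integrable (fun r : E3 × (E3 × S2) =>
      en c r.1 * (sqrtMax r.1 * weightedKernel γ b r.1 r.2))
      ((volume : Measure E3).prod partnerMeasure) := by
    rw [integrable_prod_iff hm.aestronglyMeasurable]
    refine ⟨Eventually.of_forall fun v => ((hmaj v).1.const_mul (sqrtMax v)).const_mul (en c v), ?_⟩
    refine ((integrable_exp_neg_mul_norm_sq (c := 1 / 8) (by norm_num)).const_mul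
      (2 * lossConst Cb * Real.exp (c / 2) * locConst (2 * (3 / 2)))).mono'
      hm.stronglyMeasurable.norm.integral_prod_right'.aestronglyMeasurable
      (Eventually.of_forall fun v => ?_)
    have he := en_pos hc v
    have hs := sqrtMax_pos v
    rw [Real.norm_eq_abs, abs_of_nonneg (integral_nonneg fun _ => norm_nonneg _)]
    have e1 : ∀ p : E3 × S2, ‖en c v * (sqrtMax v * weightedKernel γ b v p)‖ =
        en c v * sqrtMax v * weightedKernel γ b v p := by
      intro p
      rw [Real.norm_eq_abs, abs_of_nonneg (mul_nonneg he.le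
        (mul_nonneg hs.le (weightedKernel_nonneg hk v p)))]
      ring
    simp only [e1, integral_const_mul]
    have h2 := one_add_norm_le_en hc v
    have h3 := sqrtLoc_mul_rpow_le hc (p := 3 / 2) (by norm_num) v
    have h4 : en c v * en c v ^ (1 / 2 : ℝ) = en c v ^ (3 / 2 : ℝ) := by
      nth_rewrite 1 [← Real.rpow_one (en c v)]
      rw [← Real.rpow_add he]; norm_num
    calc en c v * sqrtMax v * ∫ p, weightedKernel γ b v p ∂partnerMeasure
        ≤ en c v * sqrtMax v * (lossConst Cb * (1 + ‖v‖)) := by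
          gcongr; exact (hmaj v).2
      _ ≤ en c v * sqrtMax v * (lossConst Cb * (2 * en c v ^ (1 / 2 : ℝ))) := by gcongr
      _ = 2 * lossConst Cb * sqrtMax v * (en c v * en c v ^ (1 / 2 : ℝ)) := by ring
      _ = 2 * lossConst Cb * Real.exp (c / 2) * (sqrtLoc c v * en c v ^ (3 / 2 : ℝ)) := by
          rw [h4, congrFun (sqrtMax_eq_sqrtLoc c) v]; ring
      _ ≤ 2 * lossConst Cb * Real.exp (c / 2) *
          (locConst (2 * (3 / 2)) * Real.exp (-(1 / 8 * ‖v‖ ^ 2))) := by gcongr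
      _ = _ := by ring
  exact (measurePreserving_regroup.integrable_comp hint.aestronglyMeasurable).2 hint

variable (hh : Decays c k A h) (h1 : 1 ≤ k) (hφ : Measurable φ) (hφb : ∀ v, |φ v| ≤ Q * en c v)

include hh h1 hφ hφb

omit hk hφb hφ in
lemma abs_collDiff_le (q : S2 × E3 × E3) : |collDiff h q| ≤ 2 * A ^ 2 := by
  have hb := hh.abs_le hc (by linarith)
  have hA := hh.nonneg hc
  have p : ∀ x y, |h x * h y| ≤ A * A := fun x y => by
    rw [abs_mul]; exact mul_le_mul (hb x) (hb y) (abs_nonneg _) hA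
  refine (abs_sub _ _).trans ?_
  have := p (uPost q.2.1 q.2.2 q.1) (vPost q.2.1 q.2.2 q.1)
  have := p q.2.2 q.2.1
  nlinarith

lemma integrable_weak : Integrable (fun q : S2 × E3 × E3 =>
    φ q.2.1 * (symKernel γ b q * collDiff h q)) collisionMeasure := by
  have hm : Measurable fun q : S2 × E3 × E3 => φ q.2.1 * (symKernel γ b q * collDiff h q) := by
    have m1 : Measurable fun q : S2 × E3 × E3 => q.2.1 := by fun_prop
    have m2 : Measurable fun q : S2 × E3 × E3 => q.2.2 := by fun_prop
    exact (hφ.comp m1).mul ((measurable_symKernel hk).mul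
      (((hh.measurable.comp measurable_uPost).mul (hh.measurable.comp measurable_vPost)).sub
        ((hh.measurable.comp m2).mul (hh.measurable.comp m1))))
  refine ((integrable_en_mul_symKernel hk hc).const_mul (Q * (2 * A ^ 2))).mono'
    hm.aestronglyMeasurable (Eventually.of_forall fun q => ?_)
  rw [Real.norm_eq_abs, abs_mul, abs_mul, abs_of_nonneg (symKernel_nonneg hk q)]
  have hs := symKernel_nonneg hk q
  calc |φ q.2.1| * (symKernel γ b q * |collDiff h q|)
      ≤ (Q * en c q.2.1) * (symKernel γ b q * (2 * A ^ 2)) := by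
        have := (abs_nonneg _).trans (hφb q.2.1)
        gcongr
        · exact hφb _
        · exact abs_collDiff_le hc hh h1 q
    _ = _ := by ring

/-- The weak form of the collision operator. -/
lemma weak_form : 4 * ∫ v, φ v * (sqrtLoc c v * collOp γ b c h v) =
    Real.exp (-c) * ∫ q, symKernel γ b q * (collDiff h q *
      (φ q.2.1 + φ q.2.2 - φ (vPost q.2.1 q.2.2 q.1) - φ (uPost q.2.1 q.2.2 q.1)))
        ∂collisionMeasure := by
  set J : S2 × E3 × E3 → ℝ := fun q => φ q.2.1 * (symKernel γ b q * collDiff h q) with hJ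
  have hi : Integrable J collisionMeasure := integrable_weak hk hc hh h1 hφ hφb
  have hm : Measurable J := by
    have m1 : Measurable fun q : S2 × E3 × E3 => q.2.1 := by fun_prop
    have m2 : Measurable fun q : S2 × E3 × E3 => q.2.2 := by fun_prop
    exact (hφ.comp m1).mul ((measurable_symKernel hk).mul
      (((hh.measurable.comp measurable_uPost).mul (hh.measurable.comp measurable_vPost)).sub
        ((hh.measurable.comp m2).mul (hh.measurable.comp m1))))
  have mp := measurePreserving_preToPost
  have me := measurePreserving_exchange
  have i2 : Integrable (fun q => J (exchange q)) collisionMeasure :=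
    me.integrable_comp_of_integrable hi
  have i3 : Integrable (fun q => J (preToPost q)) collisionMeasure :=
    mp.integrable_comp_of_integrable hi
  have i4 : Integrable (fun q => J (exchange (preToPost q))) collisionMeasure :=
    mp.integrable_comp_of_integrable i2
  have e2 : ∫ q, J (exchange q) ∂collisionMeasure = ∫ q, J q ∂collisionMeasure :=
    MeasurePreserving.integral_comp_measurable me hm
  have e3 : ∫ q, J (preToPost q) ∂collisionMeasure = ∫ q, J q ∂collisionMeasure :=
    MeasurePreserving.integral_comp_measurable mp hm
  have e4 : ∫ q, J (exchange (preToPost q)) ∂collisionMeasure = ∫ q, J q ∂collisionMeasure := by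
    rw [← e2]
    exact MeasurePreserving.integral_comp_measurable mp (hm.comp me.measurable)
  have hsum : ∫ q, symKernel γ b q * (collDiff h q *
      (φ q.2.1 + φ q.2.2 - φ (vPost q.2.1 q.2.2 q.1) - φ (uPost q.2.1 q.2.2 q.1)))
        ∂collisionMeasure = 4 * ∫ q, J q ∂collisionMeasure := by
    -- The four terms are the images of J under the group generated by the two involutions;
    -- `collDiff` is even under exchange and odd under the collision, which produces the signs.
    have : ∀ q, symKernel γ b q * (collDiff h q *
      (φ q.2.1 + φ q.2.2 - φ (vPost q.2.1 q.2.2 q.1) - φ (uPost q.2.1 q.2.2 q.1))) =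
        J q + J (exchange q) + (J (preToPost q) + J (exchange (preToPost q))) := by
      intro q
      simp only [hJ, symKernel_exchange, symKernel_preToPost, collDiff_exchange,
        collDiff_preToPost]
      simp only [exchange, preToPost]
      ring
    simp only [this]
    have s1 : ∫ q, (J q + J (exchange q)) ∂collisionMeasure = _ := integral_add hi i2
    have s2 : ∫ q, (J (preToPost q) + J (exchange (preToPost q))) ∂collisionMeasure = _ :=
      integral_add i3 i4
    have s3 : ∫ q, (J q + J (exchange q) + (J (preToPost q) + J (exchange (preToPost q))))
      ∂collisionMeasure = _ := integral_add (hi.add i2) (i3.add i4)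
    rw [s3]
    change ∫ q, (J q + J (exchange q)) ∂collisionMeasure +
      ∫ q, (J (preToPost q) + J (exchange (preToPost q))) ∂collisionMeasure = _
    rw [s1, s2, e2, e3, e4]
    ring
  rw [hsum]
  set J' : E3 × (E3 × S2) → ℝ := fun r => φ r.1 * (sqrtMax r.1 * (weightedKernel γ b r.1 r.2 *
    (h (uPost r.1 r.2.1 r.2.2) * h (vPost r.1 r.2.1 r.2.2)) -
      h r.1 * (weightedKernel γ b r.1 r.2 * h r.2.1))) with hJ'
  -- Regrouping the variables as v and (u, ω) identifies the integral over the partner with gain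
  -- minus loss.
  have hJJ : ∀ q : S2 × E3 × E3, J q = J' (q.2.1, (q.2.2, q.1)) := by
    intro q
    simp only [hJ, hJ', symKernel, collDiff]
    ring
  have hm' : Measurable J' := by
    have : J' = fun r : E3 × (E3 × S2) => J (r.2.2, (r.1, r.2.1)) := by
      funext r; rw [hJJ]
    rw [this]
    exact hm.comp (by fun_prop)
  have hi' : Integrable J' ((volume : Measure E3).prod partnerMeasure) := by
    refine (measurePreserving_regroup.integrable_comp hm'.aestronglyMeasurable).1 ?_
    exact hi.congr (Eventually.of_forall hJJ)
  have hIJ : ∫ q, J q ∂collisionMeasure = ∫ v, φ v * (sqrtMax v *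
      (gainOp γ b h h v - h v * lossOp γ b h v)) := by
    simp only [hJJ]
    have := integral_map (μ := collisionMeasure) measurePreserving_regroup.measurable.aemeasurable
      (f := J') hm'.aestronglyMeasurable
    rw [← this, measurePreserving_regroup.map_eq, integral_prod _ hi']
    congr 1
    funext v
    simp only [hJ', integral_const_mul]
    rw [integral_sub (integrable_gain hk hc hh hh h1 v)
      ((integrable_loss hk hc hh (by linarith) v).const_mul _), integral_const_mul]
    rfl
  rw [hIJ, ← integral_const_mul, ← integral_const_mul, ← integral_const_mul]
  congr 1
  funext v
  rw [collOp, sqrtLoc_eq]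
  have he : Real.exp (-c) = Real.exp (-(c / 2)) * Real.exp (-(c / 2)) := by
    rw [← Real.exp_add]; congr 1; ring
  rw [he]
  ring

lemma integral_collOp_eq_zero (hinv : ∀ v u ω, φ (vPost v u ω) + φ (uPost v u ω) = φ v + φ u) :
    ∫ v, φ v * (sqrtLoc c v * collOp γ b c h v) = 0 := by
  have h2 := weak_form hk hc hh h1 hφ hφb
  have h3 : ∀ q : S2 × E3 × E3, symKernel γ b q * (collDiff h q *
      (φ q.2.1 + φ q.2.2 - φ (vPost q.2.1 q.2.2 q.1) - φ (uPost q.2.1 q.2.2 q.1))) = 0 := by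
    intro q
    have := hinv q.2.1 q.2.2 q.1
    rw [show φ q.2.1 + φ q.2.2 - φ (vPost q.2.1 q.2.2 q.1) - φ (uPost q.2.1 q.2.2 q.1) = 0 by
      linarith]
    ring
  simp only [h3, integral_zero, mul_zero] at h2
  linarith

lemma integral_collOp_nonpos (hle : ∀ q : S2 × E3 × E3, collDiff h q *
      (φ q.2.1 + φ q.2.2 - φ (vPost q.2.1 q.2.2 q.1) - φ (uPost q.2.1 q.2.2 q.1)) ≤ 0) :
    ∫ v, φ v * (sqrtLoc c v * collOp γ b c h v) ≤ 0 := by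
  have h2 := weak_form hk hc hh h1 hφ hφb
  have h3 : ∫ q, symKernel γ b q * (collDiff h q *
      (φ q.2.1 + φ q.2.2 - φ (vPost q.2.1 q.2.2 q.1) - φ (uPost q.2.1 q.2.2 q.1)))
        ∂collisionMeasure ≤ 0 :=
    integral_nonpos fun q => mul_nonpos_of_nonneg_of_nonpos (symKernel_nonneg hk q) (hle q)
  have h4 := mul_nonpos_of_nonneg_of_nonpos (Real.exp_pos (-c)).le h3
  linarith

/-- Entropy production is nonpositive. -/
lemma entropy_production_nonpos (hpos : ∀ v, 0 < h v)
    (hlog : ∀ v, φ v = Real.log (sqrtLoc c v * h v) + 1) :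
    ∫ v, φ v * (sqrtLoc c v * collOp γ b c h v) ≤ 0 := by
  refine integral_collOp_nonpos hk hc hh h1 hφ hφb fun q => ?_
  set u := q.2.2
  set v := q.2.1
  set ω := q.1
  have hp := sqrtLoc_post c v u ω
  have hl : ∀ w, φ w = Real.log (sqrtLoc c w) + Real.log (h w) + 1 := fun w => by
    rw [hlog, Real.log_mul (sqrtLoc_pos c w).ne' (hpos w).ne']
  have hs : Real.log (sqrtLoc c (uPost v u ω)) + Real.log (sqrtLoc c (vPost v u ω)) =
      Real.log (sqrtLoc c u) + Real.log (sqrtLoc c v) := by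
    rw [← Real.log_mul (sqrtLoc_pos c _).ne' (sqrtLoc_pos c _).ne', hp,
      Real.log_mul (sqrtLoc_pos c _).ne' (sqrtLoc_pos c _).ne']
  -- The logarithm of √μ_E is a collision invariant and the constants cancel, so only the logarithms
  -- of h remain.
  have e : φ v + φ u - φ (vPost v u ω) - φ (uPost v u ω) =
      Real.log (h u * h v) - Real.log (h (uPost v u ω) * h (vPost v u ω)) := by
    rw [Real.log_mul (hpos u).ne' (hpos v).ne', Real.log_mul (hpos _).ne' (hpos _).ne', hl, hl, hl,
      hl]
    linarith
  rw [e]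
  have hx : 0 < h u * h v := mul_pos (hpos _) (hpos _)
  have hy : 0 < h (uPost v u ω) * h (vPost v u ω) := mul_pos (hpos _) (hpos _)
  change (h (uPost v u ω) * h (vPost v u ω) - h u * h v) * _ ≤ 0
  -- Monotonicity of the logarithm: (X - Y)(log Y - log X) ≤ 0.
  rcases le_total (h u * h v) (h (uPost v u ω) * h (vPost v u ω)) with hle | hle
  · exact mul_nonpos_of_nonneg_of_nonpos (sub_nonneg.2 hle)
      (sub_nonpos.2 (Real.log_le_log hx hle))
  · exact mul_nonpos_of_nonpos_of_nonneg (sub_nonpos.2 hle)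
      (sub_nonneg.2 (Real.log_le_log hy hle))

end WeakForm

/-! ### Integration over phase space -/

lemma sqrtLoc_le_one {c : ℝ} (hc : 0 ≤ c) (v : E3) : sqrtLoc c v ≤ 1 := by
  rw [sqrtLoc, Real.exp_le_one_iff]
  have := sq_nonneg ‖v‖
  linarith

instance : IsFiniteMeasure ((volume : Measure E3).restrict unitCube) := by
  refine isFiniteMeasure_restrict.2 (ne_of_lt ?_)
  refine Bornology.IsBounded.measure_lt_top (isBounded_iff_forall_norm_le.2 ⟨√3, fun x hx => ?_⟩)
  rw [EuclideanSpace.norm_eq]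
  refine Real.sqrt_le_sqrt ?_
  calc ∑ i, ‖x i‖ ^ 2 ≤ ∑ _i : Fin 3, (1 : ℝ) := by
        refine Finset.sum_le_sum fun i _ => ?_
        have := hx i
        rw [Real.norm_eq_abs, sq_abs]
        nlinarith [this.1, this.2]
    _ = 3 := by simp

/-- The Gaussian majorant. -/
def gaussMaj (v : E3) : ℝ := Real.exp (-(1 / 8 * ‖v‖ ^ 2))

lemma gaussMaj_pos (v : E3) : 0 < gaussMaj v := Real.exp_pos _

lemma gaussMaj_le_one (v : E3) : gaussMaj v ≤ 1 := by
  rw [gaussMaj, Real.exp_le_one_iff]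
  have := sq_nonneg ‖v‖
  linarith

lemma integrable_gaussMaj : Integrable gaussMaj :=
  integrable_exp_neg_mul_norm_sq (by norm_num)

lemma integrable_phase_gaussMaj :
    Integrable (fun z : E3 × E3 => gaussMaj z.2) phaseMeasure :=
  integrable_gaussMaj.comp_snd _

lemma integrable_phase_of_le {G : E3 × E3 → ℝ} (hG : Measurable G) {C : ℝ}
    (hb : ∀ z, |G z| ≤ C * gaussMaj z.2) : Integrable G phaseMeasure :=
  (integrable_phase_gaussMaj.const_mul C).mono' hG.aestronglyMeasurable
    (Eventually.of_forall hb)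

lemma integrable_of_le_gaussMaj {G : E3 → ℝ} (hG : Measurable G) {C : ℝ}
    (hb : ∀ v, |G v| ≤ C * gaussMaj v) : Integrable G :=
  (integrable_gaussMaj.const_mul C).mono' hG.aestronglyMeasurable (Eventually.of_forall hb)

section Swap

variable {Φ : E3 → ℝ} (hΦ : AdmissiblePotential Φ)

include hΦ

/-- Trades energy weights for one Gaussian in v that does not depend on x, so the torus contributes
only its finite volume. -/
lemma le_gaussMaj_of_le {C p r : ℝ} (hp : 0 < p) {x v : E3}
    (h : |r| ≤ C * (sqrtLoc (Φ x) v * en (Φ x) v ^ p)) :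
    |r| ≤ |C| * locConst (2 * p) * gaussMaj v := by
  have h2 := sqrtLoc_mul_rpow_le (hΦ.nonneg x) hp v
  have h3 : 0 ≤ sqrtLoc (Φ x) v * en (Φ x) v ^ p :=
    mul_nonneg (sqrtLoc_pos _ _).le (Real.rpow_nonneg (en_pos (hΦ.nonneg _) _).le _)
  calc |r| ≤ C * (sqrtLoc (Φ x) v * en (Φ x) v ^ p) := h
    _ ≤ |C| * (sqrtLoc (Φ x) v * en (Φ x) v ^ p) :=
        mul_le_mul_of_nonneg_right (le_abs_self C) h3
    _ ≤ |C| * (locConst (2 * p) * Real.exp (-(1 / 8 * ‖v‖ ^ 2))) :=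
        mul_le_mul_of_nonneg_left h2 (abs_nonneg C)
    _ = _ := by rw [gaussMaj]; ring

/-- Integration over phase space of a quantity accumulated along characteristics. -/
lemma integral_accumulated {G : ℝ → E3 → E3 → ℝ} (hG : FieldMeasurable G)
    (hper : ∀ t, IsPeriodic (G t)) {C p : ℝ} (hp : 0 < p)
    (hb : ∀ s x v, |G s x v| ≤ C * (sqrtLoc (Φ x) v * en (Φ x) v ^ p)) {t : ℝ} (ht : 0 ≤ t) :
    Integrable (fun z => ∫ s in (0 : ℝ)..t, along Φ G z s) phaseMeasure ∧
    ∫ z, (∫ s in (0 : ℝ)..t, along Φ G z s) ∂phaseMeasure =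
      ∫ s in (0 : ℝ)..t, ∫ z : E3 × E3, G s z.1 z.2 ∂phaseMeasure := by
  have hint : Integrable (fun q : (E3 × E3) × ℝ => along Φ G q.1 q.2)
      (phaseMeasure.prod (volume.restrict (Ioc 0 t))) := by
    have h1 : Integrable (fun q : (E3 × E3) × ℝ => |C| * locConst (2 * p) * gaussMaj q.1.2)
        (phaseMeasure.prod (volume.restrict (Ioc 0 t))) :=
      (integrable_phase_gaussMaj.const_mul _).comp_fst _
    refine h1.mono' (measurable_along hΦ hG).aestronglyMeasurable
      (Eventually.of_forall fun q => ?_)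
    have h2 := hb q.2 (flow Φ q.2 q.1).1 (flow Φ q.2 q.1).2
    rw [en_flow hΦ, sqrtLoc_flow hΦ] at h2
    exact le_gaussMaj_of_le hΦ hp h2
  constructor
  · have := hint.integral_prod_left
    simpa only [intervalIntegral.integral_of_le ht] using this
  · simp only [intervalIntegral.integral_of_le ht]
    -- After Fubini each time slice is an integral along the flow, which Liouville's theorem
    -- replaces by the integral over phase space.
    rw [integral_integral_swap hint]
    congr 1
    funext s
    exact integral_phase_flow hΦ.contDiff hΦ.periodic s (h := fun z => G s z.1 z.2) (hG.phase s)
      (hper s)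

end Swap

/-! ### Conservation laws -/

section Conservation

variable {γ : ℝ} {b : ℝ → ℝ} {Cb : ℝ} (hk : AdmissibleKernel γ b Cb)
  {Φ : E3 → ℝ} (hΦ : AdmissiblePotential Φ) {f₀ : E3 → E3 → ℝ} {f : ℝ → E3 → E3 → ℝ} {k A T : ℝ}
  (hf : PhaseDecays Φ k A f) (h1 : 1 ≤ k)

include hk hΦ hf h1

omit hk in
lemma integrable_moment {φ : E3 → E3 → ℝ} (hφ : Measurable fun z : E3 × E3 => φ z.1 z.2) {Q : ℝ}
    (hφb : ∀ x v, |φ x v| ≤ Q * en (Φ x) v) (t : ℝ) :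
    Integrable (fun z : E3 × E3 => φ z.1 z.2 * (sqrtLoc (Φ z.1) z.2 * f t z.1 z.2))
      phaseMeasure := by
  have hA := (hf.decays t 0).nonneg (hΦ.nonneg 0)
  refine integrable_phase_of_le (C := |Q * A| * locConst (2 * 1))
    (hφ.mul (((fieldMeasurable_sqrtLoc hΦ).phase t).mul (hf.measurable.phase t))) fun z => ?_
  refine le_gaussMaj_of_le hΦ (x := z.1) one_pos ?_
  have hb := (hf.decays t z.1).abs_le (hΦ.nonneg _) (by linarith) z.2
  have hs := sqrtLoc_pos (Φ z.1) z.2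
  rw [abs_mul, abs_mul, abs_of_pos hs, Real.rpow_one]
  calc |φ z.1 z.2| * (sqrtLoc (Φ z.1) z.2 * |f t z.1 z.2|)
      ≤ (Q * en (Φ z.1) z.2) * (sqrtLoc (Φ z.1) z.2 * A) := by
        have := (abs_nonneg _).trans (hφb z.1 z.2)
        gcongr
        exact hφb _ _
    _ = _ := by ring

/-- A function that is constant along characteristics and additively conserved in collisions changes
neither by transport nor, on integration in velocity at each fixed x, by the collision operator. -/
lemma moment_conserved {φ : E3 → E3 → ℝ} (hφ : Measurable fun z : E3 × E3 => φ z.1 z.2) {Q : ℝ}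
    (hφb : ∀ x v, |φ x v| ≤ Q * en (Φ x) v) (hφp : IsPeriodic φ)
    (hflow : ∀ s z, φ (flow Φ s z).1 (flow Φ s z).2 = φ z.1 z.2)
    (hinv : ∀ x v u ω, φ x (vPost v u ω) + φ x (uPost v u ω) = φ x v + φ x u)
    (hfi : ∀ z : E3 × E3, ∀ t ∈ Icc 0 T, along Φ f z t =
      f₀ z.1 z.2 + ∫ s in (0 : ℝ)..t, along Φ (collField γ b Φ f) z s) {t : ℝ} (ht : t ∈ Icc 0 T) :
    ∫ z : E3 × E3, φ z.1 z.2 * (sqrtLoc (Φ z.1) z.2 * f t z.1 z.2) ∂phaseMeasure =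
      ∫ z : E3 × E3, φ z.1 z.2 * (sqrtLoc (Φ z.1) z.2 * f 0 z.1 z.2) ∂phaseMeasure := by
  have h0 : ∀ z : E3 × E3, f 0 z.1 z.2 = f₀ z.1 z.2 := by
    intro z
    have := hfi z 0 ⟨le_rfl, ht.1.trans ht.2⟩
    simpa [along, flow_zero hΦ.contDiff hΦ.periodic] using this
  let G : ℝ → E3 → E3 → ℝ := fun s x v => φ x v * (sqrtLoc (Φ x) v * collField γ b Φ f s x v)
  have hφm : FieldMeasurable fun _ x v => φ x v := hφ.comp measurable_snd
  have hGm : FieldMeasurable G :=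
    hφm.mul ((fieldMeasurable_sqrtLoc hΦ).mul (fieldMeasurable_collField hk hΦ hf.measurable))
  have hGp : ∀ t, IsPeriodic (G t) := by
    intro t i x
    funext v
    have h2 := (fields_periodic (γ := γ) (b := b) hΦ hf.periodic t).2.2.1 i x
    simp only [G, hφp i x, hΦ.periodic i x, h2]
  have hGb : ∀ s x v, |G s x v| ≤ (Q * (collConst Cb k * (locConst k + A) ^ 2)) *
      (sqrtLoc (Φ x) v * en (Φ x) v ^ (3 / 2 : ℝ)) := by
    intro s x v
    have h2 := abs_collField_le hk hΦ hf h1 s x v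
    have he := en_pos (hΦ.nonneg x) v
    have h4 : en (Φ x) v * en (Φ x) v ^ (1 / 2 : ℝ) = en (Φ x) v ^ (3 / 2 : ℝ) := by
      nth_rewrite 1 [← Real.rpow_one (en (Φ x) v)]
      rw [← Real.rpow_add he]; norm_num
    have hs := sqrtLoc_pos (Φ x) v
    rw [abs_mul, abs_mul, abs_of_pos hs, ← h4]
    calc |φ x v| * (sqrtLoc (Φ x) v * |collField γ b Φ f s x v|)
        ≤ (Q * en (Φ x) v) * (sqrtLoc (Φ x) v *
          (collConst Cb k * (locConst k + A) ^ 2 * en (Φ x) v ^ (1 / 2 : ℝ))) := by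
          have := (abs_nonneg _).trans (hφb x v)
          gcongr
          exact hφb _ _
      _ = _ := by ring
  obtain ⟨iG, eG⟩ := integral_accumulated hΦ hGm hGp (p := 3 / 2) (by norm_num) hGb ht.1
  have hzero : ∀ s, ∫ z : E3 × E3, G s z.1 z.2 ∂phaseMeasure = 0 := by
    intro s
    have hi : Integrable (fun z : E3 × E3 => G s z.1 z.2) phaseMeasure :=
      integrable_phase_of_le (hGm.phase s) fun z =>
        le_gaussMaj_of_le hΦ (by norm_num) (hGb s z.1 z.2)
    rw [phaseMeasure, integral_prod _ hi]
    have : ∀ x, ∫ v, G s x v = 0 := fun x =>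
      integral_collOp_eq_zero hk (hΦ.nonneg x) (decays_total hΦ hf h1 s x) h1
        (hφm.velocity s x) (hφb x) (hinv x)
    simp only [this, integral_zero]
  simp only [hzero, intervalIntegral.integral_zero] at eG
  have hpt : ∀ z, φ (flow Φ t z).1 (flow Φ t z).2 * (sqrtLoc (Φ (flow Φ t z).1) (flow Φ t z).2 *
      f t (flow Φ t z).1 (flow Φ t z).2) = φ z.1 z.2 * (sqrtLoc (Φ z.1) z.2 * f 0 z.1 z.2) +
        ∫ s in (0 : ℝ)..t, along Φ G z s := by
    intro z
    have e1 : ∀ s, along Φ G z s = φ z.1 z.2 * sqrtLoc (Φ z.1) z.2 *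
        along Φ (collField γ b Φ f) z s := by
      intro s
      simp only [along, G, hflow, sqrtLoc_flow hΦ]
      ring
    have e2 := hfi z t ht
    simp only [e1, intervalIntegral.integral_const_mul]
    rw [hflow, sqrtLoc_flow hΦ, h0]
    simp only [along] at e2 ⊢
    rw [e2]
    ring
  have i0 := integrable_moment hΦ hf h1 hφ hφb 0
  have hL := integral_phase_flow hΦ.contDiff hΦ.periodic t
    (h := fun z => φ z.1 z.2 * (sqrtLoc (Φ z.1) z.2 * f t z.1 z.2))
    (hφ.mul (((fieldMeasurable_sqrtLoc hΦ).phase t).mul (hf.measurable.phase t)))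
    (fun i x => by funext v; simp only [hφp i x, hΦ.periodic i x, hf.periodic t i x])
  rw [← hL]
  simp only [hpt]
  rw [integral_add i0 iG, eG, add_zero]

end Conservation

/-! ### The entropy inequality -/

/-- For small y the logarithm is at most of size 2/√y, for large y of size y, so |y log y| ≤ 2√y +
y². The hypothesis with E² allows for the square root. -/
lemma abs_mul_log_le {y R E : ℝ} (hy : 0 ≤ y) (hR : 0 ≤ R) (hE : 0 ≤ E) (hE1 : E ≤ 1)
    (hyR : y ≤ R * E ^ 2) : |y * Real.log y| ≤ (2 * √R + R ^ 2) * E := by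
  have hsq : √y ≤ √R * E := by
    rw [← Real.sqrt_sq hE, ← Real.sqrt_mul hR]
    exact Real.sqrt_le_sqrt hyR
  have h1 : |y * Real.log y| ≤ 2 * √y + y ^ 2 := by
    rw [abs_mul, abs_of_nonneg hy]
    rcases hy.eq_or_lt with h0 | h0
    · rw [← h0]; simp
    · have hs := Real.sqrt_pos.2 h0
      have hl : Real.log y = 2 * Real.log (√y) := by
        rw [Real.log_sqrt h0.le]; ring
      have hlow : -(2 / √y) ≤ Real.log y := by
        have := Real.one_sub_inv_le_log_of_pos hs
        rw [hl, div_eq_mul_inv]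
        linarith
      have hup : Real.log y ≤ y := Real.log_le_self h0.le
      have hyy : y * (2 / √y) = 2 * √y := by
        have : y = √y * √y := (Real.mul_self_sqrt h0.le).symm
        field_simp
        nlinarith
      have habs : |Real.log y| ≤ 2 / √y + y := by
        have : 0 ≤ 2 / √y := by positivity
        rw [abs_le]; constructor <;> linarith
      calc y * |Real.log y| ≤ y * (2 / √y + y) := mul_le_mul_of_nonneg_left habs h0.le
        _ = 2 * √y + y ^ 2 := by rw [mul_add, hyy]; ring
  have h2 : y ^ 2 ≤ R ^ 2 * E := by
    calc y ^ 2 ≤ (R * E ^ 2) ^ 2 := by gcongr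
      _ = R ^ 2 * (E * E ^ 3) := by ring
      _ ≤ R ^ 2 * (E * 1) := by
          gcongr
          exact pow_le_one₀ hE hE1
      _ = _ := by ring
  calc _ ≤ 2 * √y + y ^ 2 := h1
    _ ≤ 2 * (√R * E) + R ^ 2 * E := by linarith
    _ = _ := by ring

lemma sqrtLoc_le_gaussMaj_sq {c : ℝ} (hc : 0 ≤ c) (v : E3) : sqrtLoc c v ≤ gaussMaj v ^ 2 := by
  rw [sqrtLoc, gaussMaj, ← Real.exp_nat_mul, Real.exp_le_exp]
  push_cast
  linarith

/-- The regularized density. -/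
def regDensity (Φ : E3 → ℝ) (δ : ℝ) (f : ℝ → E3 → E3 → ℝ) (t : ℝ) (x v : E3) : ℝ :=
  sqrtLoc (Φ x) v * (sqrtLoc (Φ x) v + f t x v + δ * sqrtLoc (Φ x) v)

section Entropy

variable {γ : ℝ} {b : ℝ → ℝ} {Cb : ℝ} (hk : AdmissibleKernel γ b Cb)
  {Φ : E3 → ℝ} (hΦ : AdmissiblePotential Φ) {f₀ : E3 → E3 → ℝ} {f : ℝ → E3 → E3 → ℝ} {k A T : ℝ}
  (hf : IterClass Φ k A f) (h1 : 1 ≤ k)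

include hk hΦ hf h1

omit hk in
lemma regDensity_le {δ : ℝ} (hδ1 : δ ≤ 1) (t : ℝ) (x v : E3) :
    regDensity Φ δ f t x v ≤ (2 + A) * sqrtLoc (Φ x) v := by
  have hb := (abs_le.1 ((hf.decays.decays t x).abs_le (hΦ.nonneg x) (by linarith) v)).2
  have hs := sqrtLoc_pos (Φ x) v
  have hs1 := sqrtLoc_le_one (hΦ.nonneg x) v
  have : sqrtLoc (Φ x) v + f t x v + δ * sqrtLoc (Φ x) v ≤ 2 + A := by nlinarith
  rw [regDensity, mul_comm]
  exact mul_le_mul_of_nonneg_right this hs.le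

-- Positivity of F leaves at least δμ_E, which bounds the logarithm from below.
omit hk hΦ h1 in
lemma le_regDensity (δ : ℝ) (t : ℝ) (x v : E3) :
    δ * sqrtLoc (Φ x) v ^ 2 ≤ regDensity Φ δ f t x v := by
  have hs := sqrtLoc_pos (Φ x) v
  have := mul_nonneg hs.le (hf.nonneg t x v)
  rw [regDensity]
  nlinarith

-- Since log(δμ_E) = log δ - |v|²/2 - Φ, the logarithm grows at most like the energy and is an
-- admissible test function in the weak form; the constant degenerates only logarithmically in δ.
omit hk in
lemma abs_log_regDensity_le {δ : ℝ} (hδ : 0 < δ) (hδ1 : δ ≤ 1) (t : ℝ) (x v : E3) :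
    |Real.log (regDensity Φ δ f t x v) + 1| ≤ (4 + A + |Real.log δ|) * en (Φ x) v := by
  have hA := (hf.decays.decays t x).nonneg (hΦ.nonneg x)
  have hs := sqrtLoc_pos (Φ x) v
  have hs1 := sqrtLoc_le_one (hΦ.nonneg x) v
  have hlow := le_regDensity hf δ t x v
  have hup := regDensity_le hΦ hf h1 hδ1 t x v
  have hpos : 0 < δ * sqrtLoc (Φ x) v ^ 2 := by positivity
  have he := one_le_en (hΦ.nonneg x) v
  have l1 : Real.log (regDensity Φ δ f t x v) ≤ 2 + A :=
    (Real.log_le_self (hpos.le.trans hlow)).trans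
      (hup.trans (mul_le_of_le_one_right (by linarith) hs1))
  have l2 : Real.log δ - en (Φ x) v ≤ Real.log (regDensity Φ δ f t x v) := by
    have h2 := Real.log_le_log hpos hlow
    rw [Real.log_mul hδ.ne' (by positivity), Real.log_pow] at h2
    have h3 : Real.log (sqrtLoc (Φ x) v) = -((‖v‖ ^ 2 / 2 + Φ x) / 2) := Real.log_exp _
    rw [h3] at h2
    push_cast at h2
    unfold en
    linarith
  have l3 := neg_abs_le (Real.log δ)
  have l4 := abs_nonneg (Real.log δ)
  rw [abs_le]
  constructor <;> nlinarith

omit hk h1 in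
lemma fieldMeasurable_regDensity (δ : ℝ) : FieldMeasurable (regDensity Φ δ f) := by
  have m := fieldMeasurable_sqrtLoc hΦ
  exact m.mul ((m.add hf.decays.measurable).add (m.const_mul δ))

-- The majorant does not depend on δ and includes δ = 0, so it also serves as dominating function
-- for δ → 0.
omit hk in
lemma integrable_entropy {δ : ℝ} (hδ : 0 ≤ δ) (hδ1 : δ ≤ 1) (t : ℝ) :
    (∀ z : E3 × E3, |regDensity Φ δ f t z.1 z.2 * Real.log (regDensity Φ δ f t z.1 z.2)| ≤
      (2 * √(2 + A) + (2 + A) ^ 2) * gaussMaj z.2) ∧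
    Integrable (fun z : E3 × E3 => regDensity Φ δ f t z.1 z.2 *
      Real.log (regDensity Φ δ f t z.1 z.2)) phaseMeasure := by
  have hb : ∀ z : E3 × E3, |regDensity Φ δ f t z.1 z.2 * Real.log (regDensity Φ δ f t z.1 z.2)| ≤
      (2 * √(2 + A) + (2 + A) ^ 2) * gaussMaj z.2 := by
    intro z
    have hA := (hf.decays.decays t z.1).nonneg (hΦ.nonneg z.1)
    refine abs_mul_log_le ?_ (by linarith) (gaussMaj_pos _).le (gaussMaj_le_one _) ?_
    · exact (by positivity : 0 ≤ δ * sqrtLoc (Φ z.1) z.2 ^ 2).trans (le_regDensity hf δ t z.1 z.2)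
    · exact (regDensity_le hΦ hf h1 hδ1 t z.1 z.2).trans
        (mul_le_mul_of_nonneg_left (sqrtLoc_le_gaussMaj_sq (hΦ.nonneg _) _) (by linarith))
  have hm := (fieldMeasurable_regDensity hΦ hf δ).phase t
  exact ⟨hb, integrable_phase_of_le (hm.mul hm.log) hb⟩

/-- The constant in the error of the regularized entropy inequality. -/
def entropyConst (Cb k A : ℝ) : ℝ :=
  collConst Cb k * (2 * locConst k + A) * locConst k * locConst (2 * (3 / 2)) *
    (∫ v, gaussMaj v) * ((volume : Measure E3).restrict unitCube).real univ

/-- Along characteristics F + δμ_E has the same derivative as F, because μ_E is constant there. The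
entropy production is that of F tested against log(F + δμ_E) + 1, which has a sign up to an error
linear in δ times the size of the logarithm. -/
lemma regularized_entropy_le {δ : ℝ} (hδ : 0 < δ) (hδ1 : δ ≤ 1)
    (hfi : ∀ z : E3 × E3, ∀ t ∈ Icc 0 T, along Φ f z t =
      f₀ z.1 z.2 + ∫ s in (0 : ℝ)..t, along Φ (collField γ b Φ f) z s) {t : ℝ} (ht : t ∈ Icc 0 T) :
    ∫ z : E3 × E3, regDensity Φ δ f t z.1 z.2 * Real.log (regDensity Φ δ f t z.1 z.2)
        ∂phaseMeasure ≤
      ∫ z : E3 × E3, regDensity Φ δ f 0 z.1 z.2 * Real.log (regDensity Φ δ f 0 z.1 z.2)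
        ∂phaseMeasure + t * (entropyConst Cb k A * (δ * (4 + A + |Real.log δ|))) := by
  have hA := (hf.decays.decays 0 0).nonneg (hΦ.nonneg 0)
  have hloc : 0 ≤ locConst k := locConst_nonneg (by linarith)
  have hCC := collConst_nonneg Cb k
  set Q := 4 + A + |Real.log δ| with hQ
  have hQ0 : 0 ≤ Q := by positivity
  have hreg := fieldMeasurable_regDensity hΦ hf δ
  let φ : ℝ → E3 → E3 → ℝ := fun s x v => Real.log (regDensity Φ δ f s x v) + 1
  have hφm : FieldMeasurable φ := hreg.log.add measurable_const
  have hφb : ∀ s x v, |φ s x v| ≤ Q * en (Φ x) v := abs_log_regDensity_le hΦ hf h1 hδ hδ1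
  let G : ℝ → E3 → E3 → ℝ := fun s x v => φ s x v * (sqrtLoc (Φ x) v * collField γ b Φ f s x v)
  have hGm : FieldMeasurable G := hφm.mul
    ((fieldMeasurable_sqrtLoc hΦ).mul (fieldMeasurable_collField hk hΦ hf.decays.measurable))
  have hGp : ∀ t, IsPeriodic (G t) := by
    intro t i x
    funext v
    have h2 := (fields_periodic (γ := γ) (b := b) hΦ hf.decays.periodic t).2.2.1 i x
    simp only [G, φ, regDensity, hΦ.periodic i x, hf.decays.periodic t i x, h2]
  have h32 : ∀ x v, en (Φ x) v * en (Φ x) v ^ (1 / 2 : ℝ) = en (Φ x) v ^ (3 / 2 : ℝ) := by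
    intro x v
    nth_rewrite 1 [← Real.rpow_one (en (Φ x) v)]
    rw [← Real.rpow_add (en_pos (hΦ.nonneg x) v)]; norm_num
  have hprod : ∀ (s : ℝ) (x v : E3) (r C : ℝ), |r| ≤ C * en (Φ x) v ^ (1 / 2 : ℝ) →
      |φ s x v * (sqrtLoc (Φ x) v * r)| ≤
        Q * C * (sqrtLoc (Φ x) v * en (Φ x) v ^ (3 / 2 : ℝ)) := by
    intro s x v r C hr
    have hs := sqrtLoc_pos (Φ x) v
    rw [abs_mul, abs_mul, abs_of_pos hs, ← h32]
    calc |φ s x v| * (sqrtLoc (Φ x) v * |r|)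
        ≤ (Q * en (Φ x) v) * (sqrtLoc (Φ x) v * (C * en (Φ x) v ^ (1 / 2 : ℝ))) := by
          have := (abs_nonneg _).trans (hφb s x v)
          gcongr
          exact hφb _ _ _
      _ = _ := by ring
  have hGb : ∀ s x v, |G s x v| ≤ (Q * (collConst Cb k * (locConst k + A) ^ 2)) *
      (sqrtLoc (Φ x) v * en (Φ x) v ^ (3 / 2 : ℝ)) := fun s x v =>
    hprod s x v _ _ (abs_collField_le hk hΦ hf.decays h1 s x v)
  obtain ⟨iG, eG⟩ := integral_accumulated hΦ hGm hGp (p := 3 / 2) (by norm_num) hGb ht.1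
  have hinner : ∀ s x, ∫ v, G s x v ≤
      Q * (collConst Cb k * (2 * locConst k + A) * (δ * locConst k)) *
        locConst (2 * (3 / 2)) * ∫ v, gaussMaj v := by
    intro s x
    have hx := hΦ.nonneg x
    have hm : Decays (Φ x) k (locConst k) (sqrtLoc (Φ x)) := sqrtLoc_decays hx (by linarith)
    have d1 : Decays (Φ x) k (2 * locConst k + A) (fun v => sqrtLoc (Φ x) v + f s x v) :=
      (hm.add (hf.decays.decays s x)).mono_const hx (by linarith)
    have dδ : Decays (Φ x) k (δ * locConst k) (fun v => δ * sqrtLoc (Φ x) v) := by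
      have := hm.const_mul δ
      rwa [abs_of_pos hδ] at this
    have d2 : Decays (Φ x) k (2 * locConst k + A)
        (fun v => sqrtLoc (Φ x) v + f s x v + δ * sqrtLoc (Φ x) v) :=
      ((hm.add (hf.decays.decays s x)).add dδ).mono_const hx (by nlinarith)
    have dd : Decays (Φ x) k (δ * locConst k) (fun v => (sqrtLoc (Φ x) v + f s x v) -
        (sqrtLoc (Φ x) v + f s x v + δ * sqrtLoc (Φ x) v)) := by
      refine ⟨d1.measurable.sub d2.measurable, fun v => ?_⟩
      have := dδ.bound v
      rwa [sub_add_cancel_left, abs_neg]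
    -- Here operator and logarithm belong to the same regularized density, so the production
    -- inequality applies to g₂; g₃ is the difference of the operators at F and F + δμ_E, of order
    -- δ.
    let g₂ : E3 → ℝ := fun v => φ s x v * (sqrtLoc (Φ x) v * collOp γ b (Φ x)
      (fun v => sqrtLoc (Φ x) v + f s x v + δ * sqrtLoc (Φ x) v) v)
    let g₃ : E3 → ℝ := fun v => φ s x v * (sqrtLoc (Φ x) v * (collField γ b Φ f s x v -
      collOp γ b (Φ x) (fun v => sqrtLoc (Φ x) v + f s x v + δ * sqrtLoc (Φ x) v) v))
    have mc : Measurable (collOp γ b (Φ x)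
        (fun v => sqrtLoc (Φ x) v + f s x v + δ * sqrtLoc (Φ x) v)) :=
      (fieldMeasurable_coll hk hΦ
        (h := fun s x v => sqrtLoc (Φ x) v + f s x v + δ * sqrtLoc (Φ x) v)
        (((fieldMeasurable_sqrtLoc hΦ).add hf.decays.measurable).add
          ((fieldMeasurable_sqrtLoc hΦ).const_mul δ))).velocity s x
    have b2 : ∀ v, |g₂ v| ≤ _ := fun v => le_gaussMaj_of_le hΦ (by norm_num)
      (hprod s x v _ _ (abs_collOp_le hk hx d2 h1 v))
    have b3' : ∀ v, |g₃ v| ≤ Q * (collConst Cb k * (2 * locConst k + A) * (δ * locConst k)) *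
        (sqrtLoc (Φ x) v * en (Φ x) v ^ (3 / 2 : ℝ)) := fun v =>
      hprod s x v _ _ (abs_collOp_sub_le hk hx d1 d2 dd h1 v)
    have b3 : ∀ v, |g₃ v| ≤ Q * (collConst Cb k * (2 * locConst k + A) * (δ * locConst k)) *
        locConst (2 * (3 / 2)) * gaussMaj v := by
      intro v
      have := le_gaussMaj_of_le hΦ (by norm_num) (b3' v)
      have hn : 0 ≤ Q * (collConst Cb k * (2 * locConst k + A) * (δ * locConst k)) := by
        positivity
      rwa [abs_of_nonneg hn] at this
    have i2 : Integrable g₂ := integrable_of_le_gaussMaj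
      ((hφm.velocity s x).mul ((measurable_sqrtLoc _).mul mc)) b2
    have i3 : Integrable g₃ := integrable_of_le_gaussMaj
      ((hφm.velocity s x).mul ((measurable_sqrtLoc _).mul
        (((fieldMeasurable_collField hk hΦ hf.decays.measurable).velocity s x).sub mc))) b3
    have e : ∀ v, G s x v = g₂ v + g₃ v := fun v => by simp only [G, g₂, g₃]; ring
    simp only [e]
    rw [integral_add i2 i3]
    have n2 : ∫ v, g₂ v ≤ 0 := by
      refine entropy_production_nonpos hk hx d2 h1 (hφm.velocity s x) (hφb s x) (fun v => ?_)
        (fun v => rfl)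
      have := hf.nonneg s x v
      have := mul_pos hδ (sqrtLoc_pos (Φ x) v)
      linarith
    have n3 : ∫ v, g₃ v ≤ Q * (collConst Cb k * (2 * locConst k + A) * (δ * locConst k)) *
        locConst (2 * (3 / 2)) * ∫ v, gaussMaj v := by
      rw [← integral_const_mul]
      exact integral_mono i3 (integrable_gaussMaj.const_mul _) fun v => (le_abs_self _).trans (b3 v)
    linarith
  have houter : ∀ s, ∫ z : E3 × E3, G s z.1 z.2 ∂phaseMeasure ≤
      entropyConst Cb k A * (δ * Q) := by
    intro s
    have hi : Integrable (fun z : E3 × E3 => G s z.1 z.2) phaseMeasure :=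
      integrable_phase_of_le (hGm.phase s) fun z =>
        le_gaussMaj_of_le hΦ (by norm_num) (hGb s z.1 z.2)
    rw [phaseMeasure, integral_prod _ hi]
    refine (integral_mono hi.integral_prod_left (integrable_const _) (hinner s)).trans
      (le_of_eq ?_)
    rw [integral_const, smul_eq_mul, entropyConst]
    ring
  have htime : ∫ s in (0 : ℝ)..t, ∫ z : E3 × E3, G s z.1 z.2 ∂phaseMeasure ≤
      t * (entropyConst Cb k A * (δ * Q)) := by
    have hint : IntervalIntegrable (fun s => ∫ z : E3 × E3, G s z.1 z.2 ∂phaseMeasure)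
        volume 0 t := by
      refine (intervalIntegrable_const (c := ∫ z : E3 × E3,
        |Q * (collConst Cb k * (locConst k + A) ^ 2)| * locConst (2 * (3 / 2)) * gaussMaj z.2
          ∂phaseMeasure)).mono_fun ?_ (Eventually.of_forall fun s => ?_)
      · exact (StronglyMeasurable.integral_prod_right (ν := phaseMeasure)
          (f := fun s (z : E3 × E3) => G s z.1 z.2)
          hGm.stronglyMeasurable).aestronglyMeasurable
      · refine (norm_integral_le_of_norm_le (integrable_phase_gaussMaj.const_mul _)
          (Eventually.of_forall fun z =>
            le_gaussMaj_of_le hΦ (by norm_num) (hGb s z.1 z.2))).trans (le_abs_self _)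
    have := intervalIntegral.integral_mono_on ht.1 hint
      (intervalIntegrable_const (c := entropyConst Cb k A * (δ * Q))) fun s _ => houter s
    rwa [intervalIntegral.integral_const, sub_zero, smul_eq_mul] at this
  have hpt : ∀ z, regDensity Φ δ f t (flow Φ t z).1 (flow Φ t z).2 *
      Real.log (regDensity Φ δ f t (flow Φ t z).1 (flow Φ t z).2) =
      regDensity Φ δ f 0 z.1 z.2 * Real.log (regDensity Φ δ f 0 z.1 z.2) +
        ∫ s in (0 : ℝ)..t, along Φ G z s := by
    intro z
    set m := sqrtLoc (Φ z.1) z.2 with hm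
    have hm0 : 0 < m := sqrtLoc_pos _ _
    obtain ⟨-, -, -, iC, -⟩ := intervalIntegrable_fields hk hΦ hf.decays h1 z 0 t
    have hf0 : along Φ f z 0 = f₀ z.1 z.2 := by
      simpa using hfi z 0 ⟨le_rfl, ht.1.trans ht.2⟩
    have hy : ∀ s ∈ Icc 0 T, along Φ (regDensity Φ δ f) z s =
        regDensity Φ δ f 0 z.1 z.2 + ∫ r in (0 : ℝ)..s, m * along Φ (collField γ b Φ f) z r := by
      intro s hs
      have e1 := hfi z s hs
      rw [← hf0] at e1
      rw [intervalIntegral.integral_const_mul]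
      simp only [along, regDensity, sqrtLoc_flow hΦ, flow_zero hΦ.contDiff hΦ.periodic] at e1 ⊢
      rw [e1]
      ring
    -- On each characteristic the regularized density stays in a compact interval of positive
    -- numbers, where y log y is continuously differentiable, so the chain rule applies.
    have hrange : ∀ s ∈ uIcc 0 t, regDensity Φ δ f 0 z.1 z.2 +
        ∫ r in (0 : ℝ)..s, m * along Φ (collField γ b Φ f) z r ∈
          Icc (δ * m ^ 2) ((2 + A) * m) := by
      intro s hs
      rw [uIcc_of_le ht.1] at hs
      rw [← hy s ⟨hs.1, hs.2.trans ht.2⟩]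
      have l1 := le_regDensity hf δ s (flow Φ s z).1 (flow Φ s z).2
      have l2 := regDensity_le hΦ hf h1 hδ1 s (flow Φ s z).1 (flow Φ s z).2
      rw [sqrtLoc_flow hΦ] at l1 l2
      exact ⟨l1, l2⟩
    have hlow : 0 < δ * m ^ 2 := by positivity
    have chain := comp_primitive_sub (φ := fun y => y * Real.log y)
      (φ' := fun y => Real.log y + 1) (iC.const_mul m)
      (by
        refine ContDiffOn.mul contDiffOn_id (ContDiffOn.log contDiffOn_id fun y hy => ?_)
        exact (hlow.trans_le hy.1).ne')
      (fun y hy => Real.hasDerivAt_mul_log (hlow.trans_le hy.1).ne') hrange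
    rw [← hy t ht] at chain
    rw [sub_eq_iff_eq_add] at chain
    change along Φ (regDensity Φ δ f) z t * Real.log (along Φ (regDensity Φ δ f) z t) = _
    rw [chain, add_comm]
    congr 1
    apply intervalIntegral.integral_congr
    intro s hs
    rw [uIcc_of_le ht.1] at hs
    simp only
    rw [← hy s ⟨hs.1, hs.2.trans ht.2⟩]
    simp only [along, G, φ, sqrtLoc_flow hΦ]
    rfl
  have hL := integral_phase_flow hΦ.contDiff hΦ.periodic t
    (h := fun z => regDensity Φ δ f t z.1 z.2 * Real.log (regDensity Φ δ f t z.1 z.2))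
    ((hreg.phase t).mul (hreg.phase t).log)
    (fun i x => by
      funext v; simp only [regDensity, hΦ.periodic i x, hf.decays.periodic t i x])
  rw [← hL]
  simp only [hpt]
  rw [integral_add (integrable_entropy hΦ hf h1 hδ.le hδ1 0).2 iG, eG]
  linarith

/-- The entropy does not increase. -/
lemma entropy_le (hfi : ∀ z : E3 × E3, ∀ t ∈ Icc 0 T, along Φ f z t =
      f₀ z.1 z.2 + ∫ s in (0 : ℝ)..t, along Φ (collField γ b Φ f) z s) {t : ℝ} (ht : t ∈ Icc 0 T) :
    ∫ z : E3 × E3, regDensity Φ 0 f t z.1 z.2 * Real.log (regDensity Φ 0 f t z.1 z.2)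
        ∂phaseMeasure ≤
      ∫ z : E3 × E3, regDensity Φ 0 f 0 z.1 z.2 * Real.log (regDensity Φ 0 f 0 z.1 z.2)
        ∂phaseMeasure := by
  let d : ℕ → ℝ := fun n => 1 / ((n : ℝ) + 1)
  have hd0 : ∀ n, 0 < d n := fun n => by positivity
  have hd1 : ∀ n, d n ≤ 1 := fun n => by
    simp only [d]
    rw [div_le_one (by positivity)]
    linarith [Nat.cast_nonneg (α := ℝ) n]
  have hdl : Tendsto d atTop (nhds 0) := tendsto_one_div_add_atTop_nhds_zero_nat
  have hlim : ∀ r : ℝ, Tendsto (fun n => ∫ z : E3 × E3, regDensity Φ (d n) f r z.1 z.2 *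
      Real.log (regDensity Φ (d n) f r z.1 z.2) ∂phaseMeasure) atTop
      (nhds (∫ z : E3 × E3, regDensity Φ 0 f r z.1 z.2 *
        Real.log (regDensity Φ 0 f r z.1 z.2) ∂phaseMeasure)) := by
    intro r
    refine tendsto_integral_of_dominated_convergence
      (fun z => (2 * √(2 + A) + (2 + A) ^ 2) * gaussMaj z.2)
      (fun n => (integrable_entropy hΦ hf h1 (hd0 n).le (hd1 n) r).2.aestronglyMeasurable)
      (integrable_phase_gaussMaj.const_mul _)
      (fun n => Eventually.of_forall (integrable_entropy hΦ hf h1 (hd0 n).le (hd1 n) r).1)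
      (Eventually.of_forall fun z => ?_)
    have hc : Continuous fun δ => regDensity Φ δ f r z.1 z.2 := by unfold regDensity; fun_prop
    exact ((Real.continuous_mul_log.comp hc).tendsto 0).comp hdl
  -- The error vanishes because δ log δ → 0; continuity of y log y at 0 expresses this with the
  -- convention 0 log 0 = 0.
  have herr : Tendsto (fun n => t * (entropyConst Cb k A * (d n * (4 + A + |Real.log (d n)|))))
      atTop (nhds 0) := by
    have hc : Continuous fun δ : ℝ =>
        t * (entropyConst Cb k A * (δ * (4 + A) + |δ * Real.log δ|)) := by
      have := Real.continuous_mul_log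
      fun_prop
    have h2 := (hc.tendsto 0).comp hdl
    simp only [zero_mul, abs_zero, add_zero, mul_zero] at h2
    refine h2.congr fun n => ?_
    simp only [Function.comp_apply]
    rw [abs_mul, abs_of_pos (hd0 n)]
    ring
  have h3 := le_of_tendsto_of_tendsto' (hlim t) ((hlim 0).add herr) fun n =>
    regularized_entropy_le hk hΦ hf h1 (hd0 n) (hd1 n) hfi ht
  simpa using h3

end Entropy

/-! ### The local existence theorem -/

lemma localMaxwellian_eq (Φ : E3 → ℝ) (x v : E3) :
    localMaxwellian Φ x v = sqrtLoc (Φ x) v * sqrtLoc (Φ x) v := by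
  rw [localMaxwellian, sqrtLoc, ← Real.exp_add]
  congr 1; ring

lemma sqrt_localMaxwellian (Φ : E3 → ℝ) (x v : E3) :
    √(localMaxwellian Φ x v) = sqrtLoc (Φ x) v := by
  rw [localMaxwellian_eq, Real.sqrt_mul_self (sqrtLoc_pos _ _).le]

lemma density_eq (Φ : E3 → ℝ) (f : E3 → E3 → ℝ) (x v : E3) :
    density Φ f x v = sqrtLoc (Φ x) v * (sqrtLoc (Φ x) v + f x v) := by
  rw [density, sqrt_localMaxwellian, localMaxwellian_eq]; ring

lemma density_nonneg_iff (Φ : E3 → ℝ) (f : E3 → E3 → ℝ) (x v : E3) :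
    0 ≤ density Φ f x v ↔ 0 ≤ sqrtLoc (Φ x) v + f x v := by
  rw [density_eq]
  exact mul_nonneg_iff_of_pos_left (sqrtLoc_pos _ _)

lemma density_sub (Φ : E3 → ℝ) (f : E3 → E3 → ℝ) (x v : E3) :
    density Φ f x v - localMaxwellian Φ x v = sqrtLoc (Φ x) v * f x v := by
  rw [density, sqrt_localMaxwellian]; ring

lemma regDensity_zero (Φ : E3 → ℝ) (f : ℝ → E3 → E3 → ℝ) (t : ℝ) (x v : E3) :
    regDensity Φ 0 f t x v = density Φ (f t) x v := by
  rw [regDensity, density_eq]; ring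

lemma weight_eq (β : ℝ) (Φ : E3 → ℝ) (x v : E3) : weight β Φ x v = en (Φ x) v ^ (β / 2) := rfl

/-! ### From essential weighted norms to pointwise decay. -/

section Final

variable {Φ : E3 → ℝ} (hΦ : AdmissiblePotential Φ) {β N : ℝ} {g : E3 → E3 → ℝ}

include hΦ

lemma abs_weight_mul_le_iff (x v : E3) : |weight β Φ x v * g x v| ≤ N ↔
    |g x v| ≤ N * en (Φ x) v ^ (-(β / 2)) := by
  have he := en_pos (hΦ.nonneg x) v
  have hw : 0 < en (Φ x) v ^ (β / 2) := Real.rpow_pos_of_pos he _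
  rw [weight_eq, abs_mul, abs_of_pos hw, Real.rpow_neg he.le, ← div_eq_mul_inv, le_div_iff₀ hw,
    mul_comm]

lemma ae_abs_le_of_weightedNorm_le (hN : 0 ≤ N) (h : weightedNorm β Φ g ≤ ENNReal.ofReal N) :
    ∀ᵐ z ∂phaseMeasure, |g z.1 z.2| ≤ N * en (Φ z.1) z.2 ^ (-(β / 2)) := by
  rw [weightedNorm, eLpNorm_exponent_top] at h
  filter_upwards [ae_le_eLpNormEssSup (f := fun z : E3 × E3 => weight β Φ z.1 z.2 * g z.1 z.2)
    (μ := phaseMeasure)] with z hz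
  have h2 := hz.trans h
  rw [Real.enorm_eq_ofReal_abs, ENNReal.ofReal_le_ofReal_iff hN] at h2
  exact (abs_weight_mul_le_iff hΦ _ _).1 h2

lemma weightedNorm_le (h : ∀ x v, |g x v| ≤ N * en (Φ x) v ^ (-(β / 2))) :
    weightedNorm β Φ g ≤ ENNReal.ofReal N := by
  rw [weightedNorm, eLpNorm_exponent_top]
  exact eLpNormEssSup_le_of_ae_bound
    (Eventually.of_forall fun z => (abs_weight_mul_le_iff hΦ _ _).2 (h z.1 z.2))

lemma sameMoment_of_conserved {γ : ℝ} {b : ℝ → ℝ} {Cb k A T : ℝ} (hk : AdmissibleKernel γ b Cb)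
    {f₀ f₁ : E3 → E3 → ℝ} {f : ℝ → E3 → E3 → ℝ} (hf : PhaseDecays Φ k A f) (h1 : 1 ≤ k)
    (hfi : ∀ z : E3 × E3, ∀ t ∈ Icc 0 T, along Φ f z t =
      f₁ z.1 z.2 + ∫ s in (0 : ℝ)..t, along Φ (collField γ b Φ f) z s)
    (h₀ : ∀ᵐ z ∂phaseMeasure, f₀ z.1 z.2 = f 0 z.1 z.2)
    {φ : E3 → E3 → ℝ} (hφ : Measurable fun z : E3 × E3 => φ z.1 z.2) {Q : ℝ}
    (hφb : ∀ x v, |φ x v| ≤ Q * en (Φ x) v) (hφp : IsPeriodic φ)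
    (hflow : ∀ s z, φ (flow Φ s z).1 (flow Φ s z).2 = φ z.1 z.2)
    (hinv : ∀ x v u ω, φ x (vPost v u ω) + φ x (uPost v u ω) = φ x v + φ x u)
    {t : ℝ} (ht : t ∈ Icc 0 T) :
    SameMoment Φ φ (density Φ (f t)) (density Φ f₀) := by
  have hae : (fun z : E3 × E3 => φ z.1 z.2 * (sqrtLoc (Φ z.1) z.2 * f 0 z.1 z.2))
      =ᵐ[phaseMeasure] fun z => φ z.1 z.2 * (sqrtLoc (Φ z.1) z.2 * f₀ z.1 z.2) := by
    filter_upwards [h₀] with z hz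
    rw [hz]
  unfold SameMoment
  simp only [density_sub]
  refine ⟨integrable_moment hΦ hf h1 hφ hφb t, (integrable_moment hΦ hf h1 hφ hφb 0).congr hae, ?_⟩
  rw [← integral_congr_ae hae]
  exact moment_conserved hk hΦ hf h1 hφ hφb hφp hflow hinv hfi ht

end Final

end

end BoltzmannPotential

/-! ### Assembly: choice of constants and of representatives. -/

theorem mainTheorem2 (β γ M Cb : ℝ) (hβ : 4 ≤ β) (hγ₀ : 0 ≤ γ) (hγ₁ : γ ≤ 1) :
    ∃ C : ℝ, 1 ≤ C ∧
      ∀ b : ℝ → ℝ, Measurable b →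
      (∀ θ ∈ Set.Icc 0 Real.pi, 0 ≤ b θ ∧ b θ ≤ Cb * |Real.cos θ|) →
      ∀ Φ : E3 → ℝ,
      ContDiff ℝ 3 Φ → IsPeriodic Φ → (∀ x, 0 ≤ Φ x) →
      c3Norm Φ ≤ M →
      ∀ f₀ : E3 → E3 → ℝ,
      Measurable (fun z : E3 × E3 => f₀ z.1 z.2) →
      IsPeriodic f₀ →
      (∀ᵐ z ∂phaseMeasure, 0 ≤ density Φ f₀ z.1 z.2) →
      weightedNorm β Φ f₀ < ⊤ →
      ∀ T₀ : ℝ, T₀ = (8 * C * (1 + (weightedNorm β Φ f₀).toReal))⁻¹ →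
      ∃ f : ℝ → E3 → E3 → ℝ,
        -- existence of a nonnegative solution with the weighted bound
        IsMildSolution γ b Φ T₀ f₀ f ∧
        (∀ t ∈ Set.Icc 0 T₀, ∀ᵐ z ∂phaseMeasure,
          0 ≤ density Φ (f t) z.1 z.2) ∧
        (∀ t ∈ Set.Icc 0 T₀, weightedNorm β Φ (f t) ≤
          2 * weightedNorm β Φ f₀) ∧
        -- uniqueness among mild solutions that are bounded in the weighted norm
        (∀ f' : ℝ → E3 → E3 → ℝ,
          IsMildSolution γ b Φ T₀ f₀ f' →
          (⨆ t ∈ Set.Icc 0 T₀, weightedNorm β Φ (f' t)) < ⊤ →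
          ∀ t ∈ Set.Icc 0 T₀, ∀ᵐ z ∂phaseMeasure,
            f' t z.1 z.2 = f t z.1 z.2) ∧
        -- mass
        (∀ t ∈ Set.Icc 0 T₀, SameMoment Φ (fun _ _ => 1)
          (density Φ (f t)) (density Φ f₀)) ∧
        -- energy
        (∀ t ∈ Set.Icc 0 T₀, SameMoment Φ (fun x v => ‖v‖ ^ 2 / 2 + Φ x)
          (density Φ (f t)) (density Φ f₀)) ∧
        -- degenerate momentum
        (∀ e ∈ degenerateSubspace Φ, ∀ t ∈ Set.Icc 0 T₀,
          SameMoment Φ (fun _ v => inner ℝ e v)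
            (density Φ (f t)) (density Φ f₀)) ∧
        -- entropy inequality
        (HasEntropy (density Φ f₀) ∧
          HasEntropy (localMaxwellian Φ) ∧
          ∀ t ∈ Set.Icc 0 T₀, HasEntropy (density Φ (f t)) ∧
            entropy (density Φ (f t)) -
                entropy (localMaxwellian Φ) ≤
              entropy (density Φ f₀) -
                entropy (localMaxwellian Φ)) := by
  -- The solution lives in the weight β = k + 1, the contraction in the weight k.
  obtain ⟨k, rfl⟩ : ∃ k, β = k + 1 := ⟨β - 1, by ring⟩
  have h1 : 1 ≤ k := by linarith
  have h1' : 1 ≤ k + 1 := by linarith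
  -- One constant for both weights: k + 1 for the invariance of the ball of radius 2N, k for the
  -- contraction.
  set C := max 1 (max (srcConst Cb (k + 1)) (srcConst Cb k)) with hC
  have hC1 : 1 ≤ C := le_max_left _ _
  refine ⟨C, hC1, ?_⟩
  intro b hbm hb Φ hΦ₁ hΦ₂ hΦ₃ _ f₀ hm₀ hp₀ hn₀ hfin T hT
  have hk : AdmissibleKernel γ b Cb := ⟨hγ₀, hγ₁, hbm, hb⟩
  have hΦ : AdmissiblePotential Φ := ⟨hΦ₁, hΦ₂, hΦ₃⟩
  set N := (weightedNorm (k + 1) Φ f₀).toReal with hN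
  have hN0 : 0 ≤ N := ENNReal.toReal_nonneg
  have hNof : ENNReal.ofReal N = weightedNorm (k + 1) Φ f₀ := ENNReal.ofReal_toReal hfin.ne
  have hae₀ := ae_abs_le_of_weightedNorm_le hΦ hN0 hNof.ge
  have hTpos : 0 < T := by rw [hT]; positivity
  -- With 1 + 2N ≤ 2(1 + N), the two smallness conditions hold with N/2 in place of N and 1/4 in
  -- place of 1/2.
  have hTC : T * (C * (1 + N)) = 1 / 8 := by
    rw [hT]
    have : C ≠ 0 := by positivity
    have : 1 + N ≠ 0 := by positivity
    field_simp
  have hT₁ : T * (srcConst Cb (k + 1) * (2 * N * (1 + 2 * N))) ≤ N := by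
    have hs : srcConst Cb (k + 1) ≤ C := (le_max_left _ _).trans (le_max_right _ _)
    calc T * (srcConst Cb (k + 1) * (2 * N * (1 + 2 * N)))
        ≤ T * (C * (2 * N * (2 * (1 + N)))) := by gcongr; linarith
      _ = T * (C * (1 + N)) * (4 * N) := by ring
      _ ≤ N := by rw [hTC]; linarith
  have hT₂ : T * (srcConst Cb k * (1 + 2 * N)) ≤ 1 / 2 := by
    have hs : srcConst Cb k ≤ C := (le_max_right _ _).trans (le_max_right _ _)
    calc T * (srcConst Cb k * (1 + 2 * N)) ≤ T * (C * (2 * (1 + N))) := by gcongr; linarith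
      _ = T * (C * (1 + N)) * 2 := by ring
      _ ≤ 1 / 2 := by rw [hTC]; norm_num
  classical
  -- The datum satisfies its bound and its sign only almost everywhere. Setting it to zero
  -- elsewhere, where the density becomes μ_E, gives a periodic representative f₁ for which both
  -- hold everywhere.
  let good : Set (E3 × E3) := {z | |f₀ z.1 z.2| ≤ N * en (Φ z.1) z.2 ^ (-((k + 1) / 2)) ∧
    0 ≤ sqrtLoc (Φ z.1) z.2 + f₀ z.1 z.2}
  have hgood : MeasurableSet good :=
    (measurableSet_le (continuous_abs.measurable.comp hm₀)
      (((measurable_en hΦ).pow_const _).const_mul N)).inter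
    (measurableSet_le measurable_const (((fieldMeasurable_sqrtLoc hΦ).phase 0).add hm₀))
  let f₁ : E3 → E3 → ℝ := fun x v => if (x, v) ∈ good then f₀ x v else 0
  have hm₁ : Measurable fun z : E3 × E3 => f₁ z.1 z.2 :=
    Measurable.ite hgood hm₀ measurable_const
  have hp₁ : IsPeriodic f₁ := by
    intro i x
    funext v
    simp only [f₁, good, Set.mem_ofPred_eq, hΦ₂ i x, hp₀ i x]
  have hb₁ : ∀ x v, |f₁ x v| ≤ N * en (Φ x) v ^ (-((k + 1) / 2)) := by
    intro x v
    by_cases h : (x, v) ∈ good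
    · simp only [f₁, if_pos h]; exact h.1
    · simp only [f₁, if_neg h, abs_zero]
      exact mul_nonneg hN0 (Real.rpow_nonneg (en_pos (hΦ₃ x) v).le _)
  have hn₁ : ∀ x v, 0 ≤ sqrtLoc (Φ x) v + f₁ x v := by
    intro x v
    by_cases h : (x, v) ∈ good
    · simp only [f₁, if_pos h]; exact h.2
    · simp only [f₁, if_neg h, add_zero]; exact (sqrtLoc_pos _ _).le
  have h₀₁ : ∀ᵐ z ∂phaseMeasure, f₀ z.1 z.2 = f₁ z.1 z.2 := by
    filter_upwards [hae₀, hn₀] with z hz hz'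
    have h : (z.1, z.2) ∈ good := ⟨hz, (density_nonneg_iff _ _ _ _).1 hz'⟩
    simp only [f₁, if_pos h]
  obtain ⟨f, hf, hfi⟩ := exists_integral_solution hk hΦ h1 hm₁ hp₁ hb₁ hn₁ hTpos.le hT₁ hT₂
  have hf0 : ∀ z : E3 × E3, f 0 z.1 z.2 = f₁ z.1 z.2 := by
    intro z
    have := hfi z 0 ⟨le_rfl, hTpos.le⟩
    simpa [along, flow_zero hΦ₁ hΦ₂] using this
  have h₀f : ∀ᵐ z ∂phaseMeasure, f₀ z.1 z.2 = f 0 z.1 z.2 := by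
    filter_upwards [h₀₁] with z hz
    rw [hz, hf0]
  have hmild : IsMildSolution γ b Φ T f₁ f :=
    (mild_iff hk hΦ hf.decays h1' hp₁).2 fun t ht =>
      Eventually.of_forall fun z => dampedRHS_of_integral hk hΦ hf.decays h1' (hfi z) t ht
  have hens : ∀ t, HasEntropy (density Φ (f t)) := by
    intro t
    have := (integrable_entropy hΦ hf h1' le_rfl zero_le_one t).2
    simp only [regDensity_zero] at this
    exact this
  have haeE : (fun z : E3 × E3 => density Φ (f 0) z.1 z.2 * Real.log (density Φ (f 0) z.1 z.2))
      =ᵐ[phaseMeasure] fun z => density Φ f₀ z.1 z.2 * Real.log (density Φ f₀ z.1 z.2) := by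
    filter_upwards [h₀f] with z hz
    simp only [density_eq, hz]
  refine ⟨f, ?_, ?_, ?_, ?_, ?_, ?_, ?_, ?_, ?_, ?_⟩
  · exact mild_congr hk hΦ hmild hf.decays.measurable hf.decays.periodic hp₁ hp₀
      (h₀₁.mono fun z hz => hz.symm) fun t _ => Eventually.of_forall fun z => rfl
  · exact fun t _ => Eventually.of_forall fun z => (density_nonneg_iff _ _ _ _).2 (hf.nonneg t _ _)
  · intro t _
    refine (weightedNorm_le hΦ (hf.decays.bound t)).trans (le_of_eq ?_)
    rw [ENNReal.ofReal_mul (by norm_num), hNof, ENNReal.ofReal_ofNat]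
  · intro f' hf' hsup
    set S := ⨆ t ∈ Set.Icc 0 T, weightedNorm (k + 1) Φ (f' t) with hS
    -- A common bound for both solutions. The uniqueness argument imposes no relation between T and
    -- A, so competitors of any size are covered.
    set A := max (2 * N) S.toReal with hA
    have hf'₁ : IsMildSolution γ b Φ T f₁ f' :=
      mild_congr hk hΦ hf' hf'.measurable hf'.periodic hp₀ hp₁ h₀₁
        fun t _ => Eventually.of_forall fun z => rfl
    have hfA : PhaseDecays Φ (k + 1) A f := ⟨hf.decays.measurable, hf.decays.periodic,
      fun t x => ((hf.decays.decays t x).mono_const (hΦ₃ x) (le_max_left _ _)).bound⟩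
    refine mild_unique hk hΦ hm₁ hp₁ hfA h1 hf.nonneg hfi hf'₁ fun t ht => ?_
    refine ae_abs_le_of_weightedNorm_le hΦ (ENNReal.toReal_nonneg.trans (le_max_right _ _)) ?_
    calc weightedNorm (k + 1) Φ (f' t) ≤ S :=
          le_iSup₂ (f := fun t (_ : t ∈ Set.Icc 0 T) => weightedNorm (k + 1) Φ (f' t)) t ht
      _ = ENNReal.ofReal S.toReal := (ENNReal.ofReal_toReal hsup.ne).symm
      _ ≤ ENNReal.ofReal A := ENNReal.ofReal_le_ofReal (le_max_right _ _)
  · intro t ht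
    refine sameMoment_of_conserved hΦ hk hf.decays h1' hfi h₀f measurable_const (Q := 1)
      (fun x v => ?_) (fun _ _ => rfl) (fun _ _ => rfl) (fun _ _ _ _ => rfl) ht
    rw [abs_one, one_mul]
    exact one_le_en (hΦ₃ x) v
  · intro t ht
    refine sameMoment_of_conserved hΦ hk hf.decays h1' hfi h₀f ?_ (Q := 1)
      (fun x v => ?_) (fun i x => ?_) (fun s z => flow_energy hΦ₁ hΦ₂ s z)
      (fun x v u ω => ?_) ht
    · have := hΦ.measurable
      fun_prop
    · have := hΦ₃ x
      rw [abs_of_nonneg (by positivity), en]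
      linarith
    · simp only [hΦ₂ i x]
    · have := norm_sq_post v u ω
      linarith
  · intro e he t ht
    refine sameMoment_of_conserved hΦ hk hf.decays h1' hfi h₀f (by fun_prop) (Q := ‖e‖)
      (fun x v => ?_) (fun i x => rfl) (fun s z => flow_momentum hΦ₁ hΦ₂ he s z)
      (fun x v u ω => ?_) ht
    · refine (abs_real_inner_le_norm e v).trans (mul_le_mul_of_nonneg_left ?_ (norm_nonneg e))
      have := one_add_le_en (hΦ₃ x) v
      nlinarith [sq_nonneg (‖v‖ - 1)]
    · rw [← inner_add_right, vPost_add_uPost, inner_add_right]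
  · exact (hens 0).congr haeE
  -- μ_E is the density of the zero perturbation, so its entropy is a special case.
  · have hz : IterClass Φ 1 0 fun _ _ _ => 0 :=
      ⟨⟨measurable_const, fun _ _ _ => rfl, fun t x v => by simp⟩, fun t x v => by
        simpa using (sqrtLoc_pos (Φ x) v).le⟩
    have := (integrable_entropy hΦ hz le_rfl le_rfl zero_le_one 0).2
    refine this.congr (Filter.Eventually.of_forall fun z => ?_)
    simp only [regDensity_zero, density, mul_zero, add_zero]
  · intro t ht
    refine ⟨hens t, sub_le_sub_right ?_ _⟩
    have := entropy_le hk hΦ hf h1' hfi ht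
    simp only [regDensity_zero] at this
    refine this.trans (le_of_eq ?_)
    exact MeasureTheory.integral_congr_ae haeE
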